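/- **Setting.** Let $N\ge 1$, $r\ge 1$. Consider $N$ followers with states $z_i\in\mathbb R^{n_i-r}$, $\xi_i=(\xi_{1i},\dots,\xi_{ri})\in\mathbb R^r$, input $u_i\in\mathbb R$ and output $y_i=\xi_{1i}$, $$\dot z_i=A_{1i}(w)z_i+A_{2i}(w)\xi_{1i}+E_{0i}(w)v,\quad \dot\xi_{si}=\xi_{(s+1)i}\ (1\le s<r),\quad \dot\xi_{ri}=A_{3i}(w)z_i+\sum_{s=1}^r c_{si}(w)\xi_{si}+E_{ri}(w)v+b_i(w)u_i ,$$ an exosystem $\dot v=Sv$, $v\in\mathbb R^{n_v}$, with output $y_0=F(w)v\in\mathbb R$, and the errors $e_i=y_i-y_0$, $e=(e_1,\dots,e_N)$. Each coefficient is a nominal value plus a perturbation, and the unknown parameter $w\in\mathbb R^{n_w}$ is the vector of all perturbations. Let $\mathbb V\subset\mathbb R^{n_v}$ and $\mathbb W\subset\mathbb R^{n_w}$ be compact with $0\in\mathbb V$, $0\in\mathbb W$, and let $b_i(w)>0$ for all $i$ and all $w\in\mathbb W$. Let $\bar{\mathcal G}$ be a digraph on the nodes $0,1,\dots,N$ ($0$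 is the leader); put $a_{ij}=1$ if $i\ne j$ and $(j,i)$ is an edge, $a_{ij}=0$ otherwise, $e_{vi}=\sum_{j=0}^N a_{ij}(y_i-y_j)$, and $H=(h_{ij})_{i,j=1}^N$ with $h_{ii}=\sum_{j=0}^N a_{ij}$, $h_{ij}=-a_{ij}$ for $i\ne j$. **Assumptions.** (1) All eigenvalues of $S$ are semi-simple with zero real parts. (2) $A_{1i}(w)$ is Hurwitz for all $i$ and all $w\in\mathbb W$. (3) $\bar{\mathcal G}$ contains a directed spanning tree with root $0$. **Controller.** Let $l$ be the degree of the minimal polynomial of $S$, $\Phi\in\mathbb R^{l\times l}$ its companion matrix (last row made of minus the coefficients, ones on the superdiagonal), $\Gamma=[1,0,\dots,0]$, $(M,Q)$ a controllable pair with $M\in\mathbb R^{l\times l}$ Hurwitz and $Q\in\mathbb R^{l\times 1}$, and $T$ the solution of $T\Phi-MT=Q\Gamma$. Let $s^{r-1}+\gamma_{r-2}s^{r-2}+\dots+\gamma_0$ and $s^r+\delta_{r-1}s^{r-1}+\dots+\delta_0$ be stable polynomials, $\Omega=[\gamma_0,\dots,\gamma_{r-2},1]$, $B_o(h)=(h\delta_{r-1},h^2\delta_{r-2},\dots,h^r\delta_0)^T$,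 and let $A_o(h)$ be the $r\times r$ matrix with ones on the superdiagonal and first column $-B_o(h)$ (these are added). The control law of agent $i$ is, for $t\in[t^i_k,t^i_{k+1})$, $$u_i(t)=\Gamma T^{-1}\eta_i(t^i_k)-K\Omega\zeta_i(t^i_k),\quad \dot\eta_i(t)=M\eta_i(t)+Q\,u_i(t),\quad \dot\zeta_i(t)=A_o(h)\zeta_i(t)+B_o(h)e_{vi}(t^i_k),$$ and the triggering times are $t^i_0=0$ and $$t^i_{k+1}=\inf\{t>t^i_k:\ \|\eta_i(t^i_k)-\eta_i(t)\|^2+\|\zeta_i(t^i_k)-\zeta_i(t)\|^2+(e_{vi}(t^i_k)-e_{vi}(t))^2\ \ge\ \bar\sigma(\|\zeta_i(t)\|^2+e_{vi}(t)^2)+\beta e^{-\alpha t}+\delta\}$$ (with $\inf\emptyset=\infty$). **Constants.** For $w\in\mathbb W$ let $A_c(w)$ be the matrix of the linear closed loop for $(z,\xi,\eta,\zeta)$ that results with $v=0$ and without sampling (current values in place of the values at $t^i_k$), and let $P(w)$ be the symmetric positive definite solution of $A_c(w)^TP(w)+P(w)A_c(w)=-2I$. With $B_{0i}(w)=(0,\dots,0,b_i(w))^T$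 put $\bar A_6(w)=\mathrm{blockdiag}_i(B_{0i}(w)\Gamma T^{-1})$, $\bar A_7(w)=\mathrm{blockdiag}_i(-B_{0i}(w)K\Omega)$, $\bar A_9=-I_N\otimes(QK\Omega)$, $\bar A_{10}=I_N\otimes(Q\Gamma T^{-1})$. Let $\lambda_M=\sup_{w\in\mathbb W}\lambda_{\max}(P(w))$, $\lambda_m=\inf_{w\in\mathbb W}\lambda_{\min}(P(w))$, $\lambda_1=\sup_{w\in\mathbb W}\|P(w)\|^2$, $\lambda_2=\max\|H'\|^2$ over the matrices $H'$ of all digraphs on $\{0,\dots,N\}$ that satisfy (3), $\lambda_3=\|B_o(h)\|^2$, $\lambda_4=\sup_{w\in\mathbb W}\{\|\bar A_6(w)\|^2+\|\bar A_{10}\|^2\}$, $\lambda_5=\sup_{w\in\mathbb W}\{\|\bar A_7(w)\|^2+\|\bar A_9\|^2\}$, $\bar\lambda_2=\max\{1,\lambda_2\}$, $\bar\lambda_M=\max\{\lambda_3,\lambda_4,\lambda_5\}$, $\lambda_0=\lambda_1\bar\lambda_MN$. **Theorem.** Under Assumptions (1)–(3) there are $K^*>0$ and, for every $K>K^*$,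 a number $h^*=h^*(K)>0$ such that for all $K>K^*$ and $h>h^*(K)$ the following holds. For every $w\in\mathbb W$ the symmetric positive definite solution $P(w)$ exists and is unique; and for all $\sigma\in(0,1)$, $\beta>0$, $\alpha\in(0,\lambda)$ with $\lambda=(1-\sigma)/\lambda_M$, and all $\epsilon>0$, the control law with the above event-triggered mechanism, where $\bar\sigma=\sigma/(\lambda_1\bar\lambda_M\bar\lambda_2)$ and $\delta=\lambda\lambda_m\epsilon^2/\lambda_0$, solves the event-triggered cooperative robust practical output regulation problem: for all $v(0)\in\mathbb V$, $w\in\mathbb W$ and all initial states of the plants and controllers, (a) a trajectory of the closed loop exists on $[0,\infty)$, every trajectory on an interval $[0,T_e)$ is the restriction of one on $[0,\infty)$, and every trajectory on $[0,\infty)$ is bounded; (b) $\limsup_{t\to\infty}\|e(t)\|\le\epsilon$ along every trajectory on $[0,\infty)$; (c) there is no Zeno behavior: for every compact set of initial states $(z,\xi,\eta,\zeta)(0)$ there is $\tau_d>0$ with $t^i_{k+1}-t^i_k\ge\tau_d$ for all $i$, all $k$ with $t^i_k<\infty$, all $v(0)\in\mathbb V$, all $w\in\mathbb W$ and all such initial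 states. -/

import Mathlib

open Filter Topology

noncomputable section

namespace EventTriggered

/-! ### Linear algebra -/

/-- A real square matrix is Hurwitz: all its complex eigenvalues have negative real part. -/
def IsHurwitz {n : Type*} [Fintype n] [DecidableEq n] (A : Matrix n n ℝ) : Prop :=
  ∀ μ ∈ spectrum ℂ (A.map (algebraMap ℝ ℂ)), μ.re < 0

/-- Neutral stability: every complex eigenvalue of `S` has zero real part and is semi-simple. -/
def IsNeutrallyStable {n : Type*} [Fintype n] [DecidableEq n] (S : Matrix n n ℝ) : Prop :=
  ∀ μ ∈ spectrum ℂ (S.map (algebraMap ℝ ℂ)), μ.re = 0 ∧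
    Module.End.maxGenEigenspace (Matrix.toLin' (S.map (algebraMap ℝ ℂ))) μ =
      Module.End.eigenspace (Matrix.toLin' (S.map (algebraMap ℝ ℂ))) μ

/-- Controllability of the single-input pair `(M, Q)`: the controllability matrix
`[Q, M Q, …, M^(l-1) Q]` has full rank. -/
def IsControllable {l : ℕ} (M : Matrix (Fin l) (Fin l) ℝ) (Q : Fin l → ℝ) : Prop :=
  (Matrix.of fun a (j : Fin l) => (M ^ (j : ℕ)).mulVec Q a).rank = l

/-- The monic polynomial `s^m + c_{m-1} s^{m-1} + ⋯ + c_1 s + c_0` is stable: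
all its complex roots have negative real part. -/
def IsStableMonic {m : ℕ} (c : Fin m → ℝ) : Prop :=
  ∀ s : ℂ, s ^ m + ∑ j : Fin m, (c j : ℂ) * s ^ (j : ℕ) = 0 → s.re < 0

/-- The matrix norm induced by the Euclidean vector norms. -/
def opNorm {m n : Type*} [Fintype m] [Fintype n] [DecidableEq n] (A : Matrix m n ℝ) : ℝ :=
  ‖LinearMap.toContinuousLinearMap (Matrix.toEuclideanLin A)‖

/-- The squared Euclidean norm of a vector. -/
def sqNorm {m : Type*} [Fintype m] (x : m → ℝ) : ℝ := ∑ j, x j ^ 2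

/-- The largest eigenvalue (used for symmetric matrices). -/
def lambdaMax {n : Type*} [Fintype n] [DecidableEq n] (A : Matrix n n ℝ) : ℝ :=
  sSup (spectrum ℝ A)

/-- The smallest eigenvalue (used for symmetric matrices). -/
def lambdaMin {n : Type*} [Fintype n] [DecidableEq n] (A : Matrix n n ℝ) : ℝ :=
  sInf (spectrum ℝ A)

/-- `P` is symmetric positive definite and solves `Aᵀ P + P A = -2 I`. -/
def IsLyapunovSolution {n : Type*} [Fintype n] [DecidableEq n] (A P : Matrix n n ℝ) : Prop :=
  P.PosDef ∧ A.transpose * P + P * A = (-2 : ℝ) • (1 : Matrix n n ℝ)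

/-! ### The communication digraph

Node `0` is the leader; follower `i : Fin N` is node `i.succ`. `G.Adj j i` is the edge `(j, i)`. -/

/-- `G` contains a directed spanning tree with root `root`. -/
def HasSpanningTree {V : Type*} (G : Digraph V) (root : V) : Prop :=
  ∃ T : Digraph V, (∀ a b, T.Adj a b → G.Adj a b) ∧ (∀ a, ¬ T.Adj a root) ∧
    (∀ b, b ≠ root → ∃! a, T.Adj a b) ∧ ∀ b, Relation.ReflTransGen T.Adj root b

open Classical in
/-- The entry `a_{ij}` of the adjacency matrix: `1` if `j ≠ i` and `(j, i)` is an edge, else `0`. -/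
def adjEntry {N : ℕ} (G : Digraph (Fin (N + 1))) (i j : Fin (N + 1)) : ℝ :=
  if i ≠ j ∧ G.Adj j i then 1 else 0

/-- The matrix `H`: `h_{ii} = ∑_{j=0}^N a_{ij}` and `h_{ij} = -a_{ij}` for followers `i ≠ j`. -/
def graphH {N : ℕ} (G : Digraph (Fin (N + 1))) : Matrix (Fin N) (Fin N) ℝ :=
  Matrix.of fun i j =>
    if i = j then ∑ k : Fin (N + 1), adjEntry G i.succ k else - adjEntry G i.succ j.succ

/-! ### The plant -/

/-- The space of all plant coefficients
`(A_{1i}, A_{2i}, A_{3i}, E_{0i}, E_{ri}, c_{·i}, b_i, F)`; here `d i` is the dimension of `z_i`.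
The nominal coefficients and the unknown parameter `w` are points of this finite-dimensional space,
and the actual coefficients are those of `nominal + w`. -/
abbrev PlantParam (N nv r : ℕ) (d : Fin N → ℕ) : Type :=
  ((i : Fin N) → Matrix (Fin (d i)) (Fin (d i)) ℝ) × ((i : Fin N) → Fin (d i) → ℝ) ×
  ((i : Fin N) → Fin (d i) → ℝ) × ((i : Fin N) → Matrix (Fin (d i)) (Fin nv) ℝ) ×
  (Fin N → Fin nv → ℝ) × (Fin N → Fin r → ℝ) × (Fin N → ℝ) × (Fin nv → ℝ)

section Plant

variable {N nv r : ℕ} {d : Fin N → ℕ}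

def coefA1 (p : PlantParam N nv r d) (i : Fin N) : Matrix (Fin (d i)) (Fin (d i)) ℝ := p.1 i
def coefA2 (p : PlantParam N nv r d) (i : Fin N) : Fin (d i) → ℝ := p.2.1 i
def coefA3 (p : PlantParam N nv r d) (i : Fin N) : Fin (d i) → ℝ := p.2.2.1 i
def coefE0 (p : PlantParam N nv r d) (i : Fin N) : Matrix (Fin (d i)) (Fin nv) ℝ := p.2.2.2.1 i
def coefEr (p : PlantParam N nv r d) (i : Fin N) : Fin nv → ℝ := p.2.2.2.2.1 i
def coefC (p : PlantParam N nv r d) (i : Fin N) : Fin r → ℝ := p.2.2.2.2.2.1 i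
def coefB (p : PlantParam N nv r d) (i : Fin N) : ℝ := p.2.2.2.2.2.2.1 i
def coefF (p : PlantParam N nv r d) : Fin nv → ℝ := p.2.2.2.2.2.2.2

end Plant

/-! ### Controller matrices -/

/-- The companion matrix `Φ` of the minimal polynomial of `S` (whose degree is `l`). -/
def companionPhi {nv : ℕ} (S : Matrix (Fin nv) (Fin nv) ℝ) (l : ℕ) :
    Matrix (Fin l) (Fin l) ℝ :=
  Matrix.of fun i j =>
    if (i : ℕ) + 1 = l then - (minpoly ℝ S).coeff (j : ℕ)
    else if (j : ℕ) = (i : ℕ) + 1 then 1 else 0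

/-- The row vector `Γ = [1, 0, …, 0]`. -/
def rowGamma (l : ℕ) : Fin l → ℝ := fun j => if (j : ℕ) = 0 then 1 else 0

/-- The row vector `Γ T⁻¹`. -/
def rowGammaTinv {l : ℕ} (T : Matrix (Fin l) (Fin l) ℝ) : Fin l → ℝ :=
  Matrix.vecMul (rowGamma l) T⁻¹

/-- The row vector `Ω = [γ_0, …, γ_{r-2}, 1]`. -/
def rowOmega {r : ℕ} (γ : Fin (r - 1) → ℝ) : Fin r → ℝ :=
  fun j => if hj : (j : ℕ) < r - 1 then γ ⟨j, hj⟩ else 1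

/-- The vector `B_o(h) = (h δ_{r-1}, h² δ_{r-2}, …, h^r δ_0)`. -/
def vecBo {r : ℕ} (δc : Fin r → ℝ) (h : ℝ) : Fin r → ℝ :=
  fun s => h ^ ((s : ℕ) + 1) * δc s.rev

/-- The matrix `A_o(h)`: first column `-B_o(h)`, ones on the superdiagonal. -/
def matAo {r : ℕ} (δc : Fin r → ℝ) (h : ℝ) : Matrix (Fin r) (Fin r) ℝ :=
  Matrix.of fun s s' => (if (s' : ℕ) = 0 then - vecBo δc h s else 0) +
    (if (s' : ℕ) = (s : ℕ) + 1 then 1 else 0)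

/-- The data of the distributed controller: the internal model pair `(M, Q)`, the matrix `T`, the
coefficients `γ_0, …, γ_{r-2}` and `δ_0, …, δ_{r-1}`, and the gains `K` and `h`. -/
structure Controller (r l : ℕ) where
  M : Matrix (Fin l) (Fin l) ℝ
  Q : Fin l → ℝ
  T : Matrix (Fin l) (Fin l) ℝ
  γ : Fin (r - 1) → ℝ
  δc : Fin r → ℝ
  K : ℝ
  h : ℝ

/-- The design parameters `σ̄`, `β`, `α`, `δ` of the event-triggered mechanism. -/
structure Trigger where
  sigmaBar : ℝ
  β : ℝ
  α : ℝ
  δ : ℝ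

/-! ### The matrix `A_c(w)` and the constants of the design -/

section Constants

variable {N nv r l : ℕ} {d : Fin N → ℕ}

/-- The column `B_{0i} = (0, …, 0, b_i)`. -/
def vecB0 (p : PlantParam N nv r d) (i : Fin N) : Fin r → ℝ :=
  fun s => if (s : ℕ) + 1 = r then coefB p i else 0

def blockA1 (p : PlantParam N nv r d) :
    Matrix ((i : Fin N) × Fin (d i)) ((i : Fin N) × Fin (d i)) ℝ :=
  Matrix.blockDiagonal' fun i => coefA1 p i

def blockA2 (p : PlantParam N nv r d) :
    Matrix ((i : Fin N) × Fin (d i)) ((_ : Fin N) × Fin r) ℝ :=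
  Matrix.blockDiagonal' fun i =>
    Matrix.of fun a (s : Fin r) => if (s : ℕ) = 0 then coefA2 p i a else 0

def blockA4 (p : PlantParam N nv r d) :
    Matrix ((_ : Fin N) × Fin r) ((i : Fin N) × Fin (d i)) ℝ :=
  Matrix.blockDiagonal' fun i =>
    Matrix.of fun (s : Fin r) a => if (s : ℕ) + 1 = r then coefA3 p i a else 0

def blockA5 (p : PlantParam N nv r d) :
    Matrix ((_ : Fin N) × Fin r) ((_ : Fin N) × Fin r) ℝ :=
  Matrix.blockDiagonal' fun i =>
    Matrix.of fun (s s' : Fin r) =>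
      if (s : ℕ) + 1 = r then coefC p i s' else if (s' : ℕ) = (s : ℕ) + 1 then 1 else 0

def blockA6 (p : PlantParam N nv r d) (c : Controller r l) :
    Matrix ((_ : Fin N) × Fin r) ((_ : Fin N) × Fin l) ℝ :=
  Matrix.blockDiagonal' fun i => Matrix.vecMulVec (vecB0 p i) (rowGammaTinv c.T)

def blockA7 (p : PlantParam N nv r d) (c : Controller r l) :
    Matrix ((_ : Fin N) × Fin r) ((_ : Fin N) × Fin r) ℝ :=
  Matrix.blockDiagonal' fun i => - Matrix.vecMulVec (vecB0 p i) (c.K • rowOmega c.γ)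

def blockA8 (N : ℕ) (c : Controller r l) :
    Matrix ((_ : Fin N) × Fin l) ((_ : Fin N) × Fin l) ℝ :=
  Matrix.blockDiagonal' fun _ => c.M + Matrix.vecMulVec c.Q (rowGammaTinv c.T)

def blockA9 (N : ℕ) (c : Controller r l) :
    Matrix ((_ : Fin N) × Fin l) ((_ : Fin N) × Fin r) ℝ :=
  Matrix.blockDiagonal' fun _ => - Matrix.vecMulVec c.Q (c.K • rowOmega c.γ)

def blockA10 (N : ℕ) (c : Controller r l) :
    Matrix ((_ : Fin N) × Fin l) ((_ : Fin N) × Fin l) ℝ :=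
  Matrix.blockDiagonal' fun _ => Matrix.vecMulVec c.Q (rowGammaTinv c.T)

/-- The block `(H ⊗ I_r) (I_N ⊗ [B_o(h) 0]) = H ⊗ [B_o(h) 0]`. -/
def blockA11 (G : Digraph (Fin (N + 1))) (c : Controller r l) :
    Matrix ((_ : Fin N) × Fin r) ((_ : Fin N) × Fin r) ℝ :=
  Matrix.of fun a b =>
    graphH G a.1 b.1 * (if (b.2 : ℕ) = 0 then vecBo c.δc c.h a.2 else 0)

def blockA12 (N : ℕ) (c : Controller r l) :
    Matrix ((_ : Fin N) × Fin r) ((_ : Fin N) × Fin r) ℝ :=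
  Matrix.blockDiagonal' fun _ => matAo c.δc c.h

/-- The index set of the stacked vector `col(z, ξ, η, ζ)`. -/
abbrev LoopIdx (N r l : ℕ) (d : Fin N → ℕ) : Type :=
  (((i : Fin N) × Fin (d i)) ⊕ ((_ : Fin N) × Fin r)) ⊕
    (((_ : Fin N) × Fin l) ⊕ ((_ : Fin N) × Fin r))

/-- The matrix `A_c(w)` of the nominal (not sampled) closed loop. -/
def matAc (G : Digraph (Fin (N + 1))) (c : Controller r l) (p : PlantParam N nv r d) :
    Matrix (LoopIdx N r l d) (LoopIdx N r l d) ℝ :=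
  Matrix.fromBlocks
    (Matrix.fromBlocks (blockA1 p) (blockA2 p) (blockA4 p) (blockA5 p))
    (Matrix.fromBlocks 0 0 (blockA6 p c) (blockA7 p c))
    (Matrix.fromBlocks 0 0 0 (blockA11 G c))
    (Matrix.fromBlocks (blockA8 N c) (blockA9 N c) 0 (blockA12 N c))

variable (W : Set (PlantParam N nv r d))
  (P : PlantParam N nv r d → Matrix (LoopIdx N r l d) (LoopIdx N r l d) ℝ)

/-- `λ_M = sup_{w ∈ W} λ_max(P(w))`. -/
def lamM : ℝ := sSup ((fun w => lambdaMax (P w)) '' W)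

/-- `λ_m = inf_{w ∈ W} λ_min(P(w))`. -/
def lamm : ℝ := sInf ((fun w => lambdaMin (P w)) '' W)

/-- `λ_1 = sup_{w ∈ W} ‖P(w)‖²`. -/
def lam1 : ℝ := sSup ((fun w => opNorm (P w) ^ 2) '' W)

/-- `λ_2`: the maximum of `‖H‖²` over the (finitely many) digraphs on `N + 1` nodes that contain a
directed spanning tree with root `0`. -/
def lam2 (N : ℕ) : ℝ :=
  sSup {x : ℝ | ∃ G : Digraph (Fin (N + 1)), HasSpanningTree G 0 ∧ x = opNorm (graphH G) ^ 2}

/-- `λ_3 = ‖B_o(h)‖²`. -/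
def lam3 (c : Controller r l) : ℝ := sqNorm (vecBo c.δc c.h)

/-- `λ_4 = sup_{w ∈ W} (‖A_6(w)‖² + ‖A_10‖²)`. -/
def lam4 (nom : PlantParam N nv r d) (c : Controller r l) : ℝ :=
  sSup ((fun w => opNorm (blockA6 (nom + w) c) ^ 2 + opNorm (blockA10 N c) ^ 2) '' W)

/-- `λ_5 = sup_{w ∈ W} (‖A_7(w)‖² + ‖A_9‖²)`. -/
def lam5 (nom : PlantParam N nv r d) (c : Controller r l) : ℝ :=
  sSup ((fun w => opNorm (blockA7 (nom + w) c) ^ 2 + opNorm (blockA9 N c) ^ 2) '' W)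

/-- `max {1, λ_2}`. -/
def lamBar2 (N : ℕ) : ℝ := max 1 (lam2 N)

/-- `max {λ_3, λ_4, λ_5}`. -/
def lamBarM (nom : PlantParam N nv r d) (c : Controller r l) : ℝ :=
  max (lam3 c) (max (lam4 W nom c) (lam5 W nom c))

/-- `λ_0 = λ_1 max{λ_3, λ_4, λ_5} N`. -/
def lam0 (nom : PlantParam N nv r d) (c : Controller r l) : ℝ :=
  lam1 W P * lamBarM W nom c * N

/-- `λ = (1 - σ) / λ_M`. -/
def lamRate (σ : ℝ) : ℝ := (1 - σ) / lamM W P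

/-- The triggering parameters: `σ̄ = σ / (λ_1 max{λ_3, λ_4, λ_5} max{1, λ_2})` and
`δ = λ λ_m ε² / λ_0`. -/
def designTrigger (nom : PlantParam N nv r d) (c : Controller r l) (σ β α ε : ℝ) : Trigger where
  sigmaBar := σ / (lam1 W P * lamBarM W nom c * lamBar2 N)
  β := β
  α := α
  δ := lamRate W P σ * lamm W P / lam0 W P nom c * ε ^ 2

end Constants

/-! ### The closed loop -/

/-- The states `(z, ξ, η, ζ)` of the plants and of the controllers. -/
abbrev CState (N r l : ℕ) (d : Fin N → ℕ) : Type :=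
  ((i : Fin N) → Fin (d i) → ℝ) × (Fin N → Fin r → ℝ) × (Fin N → Fin l → ℝ) × (Fin N → Fin r → ℝ)

/-- The state of the whole closed loop: `v` together with `(z, ξ, η, ζ)`. -/
abbrev LoopState (N nv r l : ℕ) (d : Fin N → ℕ) : Type :=
  (Fin nv → ℝ) × CState N r l d

section Loop

variable {N nv r l : ℕ} {d : Fin N → ℕ} [NeZero r]

def stV (x : LoopState N nv r l d) : Fin nv → ℝ := x.1
def stZ (x : LoopState N nv r l d) (i : Fin N) : Fin (d i) → ℝ := x.2.1 i
def stXi (x : LoopState N nv r l d) (i : Fin N) : Fin r → ℝ := x.2.2.1 i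
def stEta (x : LoopState N nv r l d) (i : Fin N) : Fin l → ℝ := x.2.2.2.1 i
def stZeta (x : LoopState N nv r l d) (i : Fin N) : Fin r → ℝ := x.2.2.2.2 i

/-- The outputs of all nodes: `y_0 = F(w) v` and `y_i = ξ_{1i}`. -/
def nodeOutput (p : PlantParam N nv r d) (x : LoopState N nv r l d) : Fin (N + 1) → ℝ :=
  Fin.cons (coefF p ⬝ᵥ stV x) (fun i => stXi x i 0)

/-- The vector of regulated errors `e_i = y_i - y_0`. -/
def regError (p : PlantParam N nv r d) (x : LoopState N nv r l d) : EuclideanSpace ℝ (Fin N) :=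
  WithLp.toLp 2 fun i => nodeOutput p x i.succ - nodeOutput p x 0

/-- The virtual output `e_{vi} = ∑_{j=0}^N a_{ij} (y_i - y_j)`. -/
def virtualOutput (G : Digraph (Fin (N + 1))) (p : PlantParam N nv r d)
    (x : LoopState N nv r l d) (i : Fin N) : ℝ :=
  ∑ j : Fin (N + 1), adjEntry G i.succ j * (nodeOutput p x i.succ - nodeOutput p x j)

/-- The control input `u_i = Γ T⁻¹ η_i(t_k^i) - K Ω ζ_i(t_k^i)`, where `s` is the state of the loop
at the last triggering time of agent `i`. -/
def controlInput (c : Controller r l) (s : LoopState N nv r l d) (i : Fin N) : ℝ :=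
  rowGammaTinv c.T ⬝ᵥ stEta s i - c.K * (rowOmega c.γ ⬝ᵥ stZeta s i)

/-- The right-hand side of the closed loop (exosystem, plants, internal models and compensators) at
the state `x`, when `s i` is the state of the loop at the last triggering time of agent `i`. -/
def loopField (S : Matrix (Fin nv) (Fin nv) ℝ) (G : Digraph (Fin (N + 1))) (c : Controller r l)
    (p : PlantParam N nv r d) (x : LoopState N nv r l d) (s : Fin N → LoopState N nv r l d) :
    LoopState N nv r l d :=
  (S.mulVec (stV x),
    fun i => (coefA1 p i).mulVec (stZ x i) + stXi x i 0 • coefA2 p i + (coefE0 p i).mulVec (stV x),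
    fun i q =>
      if hq : (q : ℕ) + 1 < r then stXi x i ⟨(q : ℕ) + 1, hq⟩
      else coefA3 p i ⬝ᵥ stZ x i + coefC p i ⬝ᵥ stXi x i + coefEr p i ⬝ᵥ stV x
        + coefB p i * controlInput c (s i) i,
    fun i => c.M.mulVec (stEta x i) + controlInput c (s i) i • c.Q,
    fun i => (matAo c.δc c.h).mulVec (stZeta x i) + virtualOutput G p (s i) i • vecBo c.δc c.h)

/-- The squared sampling error
`‖η_i(t_k^i) - η_i(t)‖² + ‖ζ_i(t_k^i) - ζ_i(t)‖² + (e_{vi}(t_k^i) - e_{vi}(t))²`, where `s` and `x`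
are the states of the loop at the times `t_k^i` and `t`. -/
def sampleErrorSq (G : Digraph (Fin (N + 1))) (p : PlantParam N nv r d)
    (s x : LoopState N nv r l d) (i : Fin N) : ℝ :=
  sqNorm (stEta s i - stEta x i) + sqNorm (stZeta s i - stZeta x i) +
    (virtualOutput G p s i - virtualOutput G p x i) ^ 2

/-- The triggering threshold `σ̄ (‖ζ_i(t)‖² + e_{vi}(t)²) + β exp(-α t) + δ`. -/
def threshold (G : Digraph (Fin (N + 1))) (p : PlantParam N nv r d) (g : Trigger)
    (t : ℝ) (x : LoopState N nv r l d) (i : Fin N) : ℝ :=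
  g.sigmaBar * (sqNorm (stZeta x i) + virtualOutput G p x i ^ 2) +
    g.β * Real.exp (-g.α * t) + g.δ

/-- The triggering times `t_0^i = 0 ≤ t_1^i ≤ ⋯` of agent `i` along the curve `x`, observed on the
time interval `[0, Tend)`: `t_{k+1}^i` is the infimum of all `t > t_k^i` at which the squared
sampling error is at least the threshold. It is `⊤` when there is no such `t`. -/
def eventTime (G : Digraph (Fin (N + 1))) (p : PlantParam N nv r d) (g : Trigger)
    (Tend : EReal) (x : ℝ → LoopState N nv r l d) (i : Fin N) : ℕ → EReal
  | 0 => 0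
  | k + 1 => sInf ((fun t : ℝ => (t : EReal)) ''
      {t : ℝ | eventTime G p g Tend x i k < (t : EReal) ∧ (t : EReal) < Tend ∧
        threshold G p g t (x t) i ≤
          sampleErrorSq G p (x (eventTime G p g Tend x i k).toReal) (x t) i})

/-- `x` is a trajectory of the event-triggered closed loop on `[0, Tend)` that starts at `x₀`:
it is continuous, every instant of `[0, Tend)` lies in an inter-event interval
`[t_k^i, t_{k+1}^i)` of every agent `i`, and the closed-loop equations hold there. -/
structure IsTrajectory (S : Matrix (Fin nv) (Fin nv) ℝ) (G : Digraph (Fin (N + 1)))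
    (c : Controller r l) (g : Trigger) (p : PlantParam N nv r d) (Tend : EReal)
    (x₀ : LoopState N nv r l d) (x : ℝ → LoopState N nv r l d) : Prop where
  init : x 0 = x₀
  cont : ContinuousOn x {t : ℝ | 0 ≤ t ∧ (t : EReal) < Tend}
  cover : ∀ t : ℝ, 0 ≤ t → (t : EReal) < Tend → ∀ i : Fin N, ∃ k : ℕ,
    eventTime G p g Tend x i k ≤ t ∧ (t : EReal) < eventTime G p g Tend x i (k + 1)
  ode : ∀ t : ℝ, 0 ≤ t → (t : EReal) < Tend → ∀ k : Fin N → ℕ,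
    (∀ i, eventTime G p g Tend x i (k i) ≤ t ∧
      (t : EReal) < eventTime G p g Tend x i (k i + 1)) →
    HasDerivWithinAt x
      (loopField S G c p (x t) fun i => x (eventTime G p g Tend x i (k i)).toReal)
      (Set.Ici t) t

/-- The controller `c` with the event-triggered mechanism `g` solves the event-triggered cooperative
robust practical output regulation problem with accuracy `ε`, without Zeno behavior. -/
structure SolvesPracticalRegulation (S : Matrix (Fin nv) (Fin nv) ℝ) (G : Digraph (Fin (N + 1)))
    (nom : PlantParam N nv r d) (V : Set (Fin nv → ℝ)) (W : Set (PlantParam N nv r d))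
    (c : Controller r l) (g : Trigger) (ε : ℝ) : Prop where
  /-- For all data, a trajectory exists for all time. -/
  exist : ∀ v₀ ∈ V, ∀ w ∈ W, ∀ c₀ : CState N r l d,
    ∃ x, IsTrajectory S G c g (nom + w) ⊤ (v₀, c₀) x
  /-- The maximal interval of existence is `[0, ∞)`: every trajectory on some `[0, Tend)` is the
  restriction of one on `[0, ∞)`. -/
  extend : ∀ v₀ ∈ V, ∀ w ∈ W, ∀ c₀ : CState N r l d, ∀ Tend : EReal, 0 < Tend →
    ∀ x, IsTrajectory S G c g (nom + w) Tend (v₀, c₀) x →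
      ∃ y, IsTrajectory S G c g (nom + w) ⊤ (v₀, c₀) y ∧
        ∀ t : ℝ, 0 ≤ t → (t : EReal) < Tend → y t = x t
  /-- Every trajectory is bounded. -/
  bounded : ∀ v₀ ∈ V, ∀ w ∈ W, ∀ c₀ : CState N r l d,
    ∀ x, IsTrajectory S G c g (nom + w) ⊤ (v₀, c₀) x → ∃ C : ℝ, ∀ t : ℝ, 0 ≤ t → ‖x t‖ ≤ C
  /-- `limsup ‖e(t)‖ ≤ ε`. -/
  regulated : ∀ v₀ ∈ V, ∀ w ∈ W, ∀ c₀ : CState N r l d,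
    ∀ x, IsTrajectory S G c g (nom + w) ⊤ (v₀, c₀) x →
      limsup (fun t : ℝ => ((‖regError (nom + w) (x t)‖ : ℝ) : EReal)) atTop ≤ (ε : EReal)
  /-- The inter-event times have a positive lower bound, uniformly over `V`, `W` and any compact
  set of initial states of the plants and of the controllers. -/
  noZeno : ∀ X : Set (CState N r l d), IsCompact X → ∃ τ : ℝ, 0 < τ ∧
    ∀ v₀ ∈ V, ∀ w ∈ W, ∀ c₀ ∈ X, ∀ x, IsTrajectory S G c g (nom + w) ⊤ (v₀, c₀) x →
      ∀ (i : Fin N) (k : ℕ),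
        eventTime G (nom + w) g ⊤ x i k + (τ : EReal) ≤ eventTime G (nom + w) g ⊤ x i (k + 1)

end Loop

end EventTriggered

end

noncomputable section

namespace EventTriggered

/-! ### Compactness -/

/-! Steady state. Each `A_{1i}(w)` is Hurwitz and `S` has only semi-simple imaginary eigenvalues, so
the Sylvester equations of the zero dynamics are solvable. They give a linear map `v ↦ steadyState`
whose graph is invariant under the unsampled loop, with `e = 0` and `ζ = 0` on it
(`loopField_steadyState`). The internal model generates the required input for every `w`: this input
is a row vector times `v`, hence obeys the recursion of the minimal polynomial of `S`, and `T`
carries that recursion into `(M, Q)`. The stacked deviation `X` from the steady state satisfies `X'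
= A_c(w) X + (sampling errors)`.

High gain. `A_c(w)` is Hurwitz by a small-gain argument on a single eigenmode with `Re μ ≥ 0`
(`LoopBounds.isHurwitz_matAc`). Let `m` be the size of `ϑ = Ω ξ` and `E` that of the observer error.
Stability of the polynomial `γ`, of the zero dynamics and of `M` bounds `z`, `ξ` and `η` by
multiples of `m`. Since `-diag(b) H` is Hurwitz, by a maximum principle along the spanning tree, a
large `K` gives `m ≤ const · E`. A large `h` then gives `E ≤ q E` with `q < 1`, so the mode
vanishes. All constants are uniform in `w` by compactness of `W`.

Decay. Put `V = Xᵀ P(w) X`. Of the `-2|X|²` in `V'`, one half absorbs the sampling error by Young's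
inequality. The triggering rule bounds the rest, giving `V' ≤ -(1-σ)|X|² + λ₀ (β e^{-αt} + δ)`
(`lyapunov_dissipation`). The choice of `δ` makes the ultimate bound of `V` equal to `λ_m ε²`, that
is `|e| ≤ ε` in the limit. The rule is stated with `max {λ₃, λ₄, λ₅}`, while the errors of `η` and
`ζ` enter through the same input and their constants add up. This is repaired by taking `h` so large
that `λ₃ = ‖B_o(h)‖²` already dominates their joint constant.

No Zeno behavior and existence. The decay estimate holds on every interval of existence, so states
and velocities are bounded uniformly over compact sets of data. An event needs a squared error above
`δ > 0`, and reaching it takes a uniformly positive time. So a bounded interval contains finitely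
many events, every trajectory can be continued, and gluing by uniqueness yields one on `[0, ∞)`. -/

theorem exists_uniform_lower_bound {X E F : Type*} [TopologicalSpace X] [NormedAddCommGroup E]
    [NormedSpace ℝ E] [FiniteDimensional ℝ E] [NormedAddCommGroup F] [NormedSpace ℝ F]
    {s : Set X} (hs : IsCompact s) (f : X → E → F)
    (hf : ContinuousOn (Function.uncurry f) (s ×ˢ Set.univ))
    (hsmul : ∀ x ∈ s, ∀ (c : ℝ) y, f x (c • y) = c • f x y)
    (hinj : ∀ x ∈ s, ∀ y, f x y = 0 → y = 0) :
    ∃ C : ℝ, 0 < C ∧ ∀ x ∈ s, ∀ y, ‖y‖ ≤ C * ‖f x y‖ := by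
  have hK : IsCompact (s ×ˢ Metric.sphere (0 : E) 1) := hs.prod (isCompact_sphere 0 1)
  rcases (s ×ˢ Metric.sphere (0 : E) 1).eq_empty_or_nonempty with hem | hne
  · refine ⟨1, one_pos, fun x hx y => ?_⟩
    have hy : y = 0 := by
      by_contra hy
      have : (x, ‖y‖⁻¹ • y) ∈ s ×ˢ Metric.sphere (0 : E) 1 := by
        refine ⟨hx, ?_⟩
        simp [norm_smul, inv_mul_cancel₀ (norm_ne_zero_iff.2 hy)]
      rw [hem] at this
      exact this
    subst hy
    simp
  -- Injectivity makes the minimum of `‖f x y‖` over `s` times the unit sphere positive, and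
  -- homogeneity extends the bound to all `y`. Applied to resolvents, Lyapunov operators and
  -- Sylvester operators, this gives uniform bounds on solutions without any continuity of the
  -- solutions in the parameter.
  · obtain ⟨⟨x₀, y₀⟩, ⟨hx₀, hy₀⟩, hmin⟩ := hK.exists_isMinOn hne
      ((hf.norm).mono (Set.prod_mono_right (Set.subset_univ _)))
    have hy₀' : y₀ ≠ 0 := by
      rintro rfl
      simp at hy₀
    have hm : 0 < ‖f x₀ y₀‖ := norm_pos_iff.2 fun h => hy₀' (hinj x₀ hx₀ y₀ h)
    refine ⟨‖f x₀ y₀‖⁻¹, inv_pos.2 hm, fun x hx y => ?_⟩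
    by_cases hy : y = 0
    · subst hy
      simp only [norm_zero]
      positivity
    have hny : 0 < ‖y‖ := norm_pos_iff.2 hy
    have hmem : (x, ‖y‖⁻¹ • y) ∈ s ×ˢ Metric.sphere (0 : E) 1 := by
      refine ⟨hx, ?_⟩
      simp [norm_smul, inv_mul_cancel₀ hny.ne']
    have h1 := hmin hmem
    simp only [Function.uncurry, Set.mem_ofPred_eq] at h1
    rw [hsmul x hx, norm_smul, norm_inv, norm_norm] at h1
    rw [le_inv_mul_iff₀ hm]
    calc ‖f x₀ y₀‖ * ‖y‖ ≤ (‖y‖⁻¹ * ‖f x y‖) * ‖y‖ := by gcongr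
      _ = ‖f x y‖ := by field_simp

/-! ### Hurwitz matrices -/

section Hurwitz

variable {n : Type*} [Fintype n] [DecidableEq n]

/-- A real matrix acting on complex vectors. -/
abbrev cmulVec {m n : Type*} [Fintype n] (A : Matrix m n ℝ) (x : n → ℂ) : m → ℂ :=
  (A.map (algebraMap ℝ ℂ)).mulVec x

theorem mem_spectrum_iff {𝕜 : Type*} [Field 𝕜] (A : Matrix n n 𝕜) (μ : 𝕜) :
    μ ∈ spectrum 𝕜 A ↔ ∃ x : n → 𝕜, x ≠ 0 ∧ A.mulVec x = μ • x := by
  rw [← Matrix.spectrum_toLin', ← Module.End.hasEigenvalue_iff_mem_spectrum]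
  constructor
  · intro h
    obtain ⟨x, hx⟩ := h.exists_hasEigenvector
    exact ⟨x, hx.2, by simpa using hx.apply_eq_smul⟩
  · rintro ⟨x, hx0, hx⟩
    exact Module.End.hasEigenvalue_of_hasEigenvector (x := x)
      ⟨Module.End.mem_eigenspace_iff.2 (by simpa using hx), hx0⟩

/-- The working form of the Hurwitz property: a mode in the closed right half plane is shown to be
zero, rather than an eigenvalue shown to lie on the left. -/
theorem isHurwitz_iff (A : Matrix n n ℝ) :
    IsHurwitz A ↔ ∀ (μ : ℂ) (x : n → ℂ), 0 ≤ μ.re → cmulVec A x = μ • x → x = 0 := by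
  simp only [IsHurwitz, mem_spectrum_iff]
  constructor
  · intro h μ x hμ hx
    by_contra hx0
    exact absurd (h μ ⟨x, hx0, hx⟩) (not_lt.2 hμ)
  · rintro h μ ⟨x, hx0, hx⟩
    by_contra hμ
    exact hx0 (h μ x (not_lt.1 hμ) hx)

theorem IsHurwitz.eq_zero_of_real {A : Matrix n n ℝ} (hA : IsHurwitz A) {c : ℝ} (hc : 0 ≤ c)
    {x : n → ℝ} (hx : A.mulVec x = c • x) : x = 0 := by
  have h := (isHurwitz_iff A).1 hA (c : ℂ) (fun i => (x i : ℂ)) (by simpa using hc) (by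
    funext i
    have := congrFun hx i
    simp only [Matrix.mulVec, dotProduct, Pi.smul_apply, smul_eq_mul, cmulVec, Matrix.map_apply,
      Complex.coe_algebraMap] at this ⊢
    exact_mod_cast this)
  funext i
  have h2 : (x i : ℂ) = 0 := congrFun h i
  exact_mod_cast h2

/-- A bound for the resolvents of a compact family of Hurwitz matrices on the closed right half
plane. -/
theorem exists_resolvent_bound {X : Type*} [TopologicalSpace X] {s : Set X} (hs : IsCompact s)
    (A : X → Matrix n n ℝ) (hA : ContinuousOn A s) (hH : ∀ x ∈ s, IsHurwitz (A x)) :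
    ∃ C : ℝ, 0 < C ∧ ∀ x ∈ s, ∀ μ : ℂ, 0 ≤ μ.re → ∀ y : n → ℂ,
      ‖y‖ ≤ C * ‖μ • y - cmulVec (A x) y‖ := by
  have hentry : ∀ i j, ContinuousOn (fun x => A x i j) s := fun i j =>
    (continuous_id.matrix_elem i j).comp_continuousOn hA
  obtain ⟨a, ha⟩ : ∃ a : ℝ, ∀ x ∈ s, ∀ i j, ‖A x i j‖ ≤ a := by
    have : ∀ ij : n × n, ∃ a : ℝ, ∀ x ∈ s, ‖A x ij.1 ij.2‖ ≤ a := fun ij =>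
      hs.exists_bound_of_continuousOn (hentry ij.1 ij.2)
    choose a ha using this
    refine ⟨∑ ij, |a ij|, fun x hx i j => (ha (i, j) x hx).trans ((le_abs_self _).trans ?_)⟩
    exact Finset.single_le_sum (f := fun ij => |a ij|) (fun _ _ => abs_nonneg _)
      (Finset.mem_univ (i, j))
  have hbig : ∀ x ∈ s, ∀ y : n → ℂ, ‖cmulVec (A x) y‖ ≤ Fintype.card n * |a| * ‖y‖ := by
    intro x hx y
    refine (pi_norm_le_iff_of_nonneg (by positivity)).2 fun i => ?_
    calc ‖∑ j, (A x i j : ℂ) * y j‖ ≤ ∑ j, ‖(A x i j : ℂ) * y j‖ := norm_sum_le _ _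
      _ ≤ ∑ _j : n, |a| * ‖y‖ := by
          refine Finset.sum_le_sum fun j _ => ?_
          rw [norm_mul, Complex.norm_real]
          exact mul_le_mul ((ha x hx i j).trans (le_abs_self a)) (norm_le_pi_norm y j)
            (norm_nonneg _) (abs_nonneg _)
      _ = Fintype.card n * |a| * ‖y‖ := by simp [mul_assoc]
  -- Outside the disc of radius `R` the term `μ y` exceeds `A y` by at least `‖y‖`, so only a
  -- compact set of `μ` is left to the compactness argument.
  set R : ℝ := Fintype.card n * |a| + 1 with hR
  have hR0 : 0 ≤ R := by positivity
  obtain ⟨C, hC0, hC⟩ := exists_uniform_lower_bound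
    (s := s ×ˢ (Metric.closedBall (0 : ℂ) R ∩ {μ | 0 ≤ μ.re}))
    (hs.prod ((isCompact_closedBall 0 R).inter_right
      (isClosed_le continuous_const Complex.continuous_re)))
    (fun (q : X × ℂ) (y : n → ℂ) => q.2 • y - cmulVec (A q.1) y) (by
      refine continuousOn_pi.2 fun i => ?_
      simp only [Function.uncurry, Pi.sub_apply, Pi.smul_apply, smul_eq_mul, cmulVec, Matrix.mulVec,
        dotProduct, Matrix.map_apply, Complex.coe_algebraMap]
      refine ContinuousOn.sub (by fun_prop) (continuousOn_finsetSum _ fun j _ => ?_)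
      refine ContinuousOn.mul ?_ (by fun_prop)
      refine Complex.continuous_ofReal.comp_continuousOn ?_
      exact (hentry i j).comp (by fun_prop) fun q hq => hq.1.1)
    (by
      rintro q - c y
      have h1 : cmulVec (A q.1) (c • y) = c • cmulVec (A q.1) y := Matrix.mulVec_smul _ _ _
      rw [h1, smul_sub, smul_comm])
    (by
      rintro q hq y h
      exact (isHurwitz_iff _).1 (hH q.1 hq.1) q.2 y hq.2.2 (sub_eq_zero.1 h).symm)
  refine ⟨max C 1, by positivity, fun x hx μ hμ y => ?_⟩
  by_cases hμR : ‖μ‖ ≤ R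
  · refine (hC (x, μ) ⟨hx, by simpa using hμR, hμ⟩ y).trans ?_
    gcongr
    exact le_max_left _ _
  · push Not at hμR
    have h1 : ‖y‖ ≤ ‖μ • y - cmulVec (A x) y‖ := by
      have h2 := norm_sub_norm_le (μ • y) (cmulVec (A x) y)
      rw [norm_smul] at h2
      have h3 := hbig x hx y
      have h4 : R * ‖y‖ ≤ ‖μ‖ * ‖y‖ := by gcongr
      rw [hR] at h4
      linarith
    refine h1.trans (le_mul_of_one_le_left (norm_nonneg _) (le_max_right _ _))

end Hurwitz

/-! ### Lyapunov equations -/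

section Lyapunov

variable {n : Type*} [Fintype n] [DecidableEq n]

/-- The Cayley transform of a matrix. -/
def cayley (A : Matrix n n ℝ) : Matrix n n ℝ := (1 + A) * (1 - A)⁻¹

theorem IsHurwitz.isUnit_one_sub {A : Matrix n n ℝ} (hA : IsHurwitz A) : IsUnit (1 - A) := by
  rw [← Matrix.mulVec_injective_iff_isUnit]
  refine (injective_iff_map_eq_zero (Matrix.mulVecLin (1 - A))).2 fun x hx => ?_
  refine hA.eq_zero_of_real zero_le_one ?_
  have : x - A.mulVec x = 0 := by simpa [Matrix.sub_mulVec] using hx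
  rw [one_smul]
  exact (sub_eq_zero.1 this).symm

/-- The Cayley transform carries the open left half plane into the open unit disc. An eigenvalue `κ`
of the transform with eigenvector `y` gives `A x = (κ - 1)/(κ + 1) x` for `x = (1 - A)⁻¹ y`, and
this quotient has nonnegative real part when `|κ| ≥ 1`. -/
theorem IsHurwitz.norm_lt_one_of_mem_spectrum_cayley {A : Matrix n n ℝ} (hA : IsHurwitz A) {κ : ℂ}
    (hκ : κ ∈ spectrum ℂ ((cayley A).map (algebraMap ℝ ℂ))) : ‖κ‖ < 1 := by
  obtain ⟨y, hy0, hy⟩ := (mem_spectrum_iff _ κ).1 hκ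
  by_contra hlt
  push Not at hlt
  have hu : (1 - A) * (1 - A)⁻¹ = 1 :=
    Matrix.mul_nonsing_inv _ ((Matrix.isUnit_iff_isUnit_det _).1 hA.isUnit_one_sub)
  set x : n → ℂ := cmulVec ((1 - A)⁻¹) y with hx
  have hy1 : x - cmulVec A x = y := by
    have : cmulVec (1 - A) x = y := by
      rw [hx, cmulVec, cmulVec, Matrix.mulVec_mulVec, ← Matrix.map_mul, hu]
      simp
    rw [← this, cmulVec, cmulVec, Matrix.map_sub _ (by simp), Matrix.sub_mulVec]
    simp
  have hy2 : x + cmulVec A x = κ • y := by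
    rw [← hy, cayley, Matrix.map_mul, ← Matrix.mulVec_mulVec, Matrix.map_add _ (by simp),
      Matrix.add_mulVec]
    simp [hx, cmulVec]
  have h3 : (1 + κ) • cmulVec A x = (κ - 1) • x := by
    rw [← hy1] at hy2
    rw [smul_sub] at hy2
    rw [add_smul, sub_smul, one_smul, one_smul]
    linear_combination (exp := 1) hy2
  -- The value `κ = -1` would correspond to the point at infinity; the relation `h3` then reads `0 =
  -- -2 x`.
  by_cases hk : 1 + κ = 0
  · have hk' : κ = -1 := by linear_combination hk
    rw [hk', show (1 : ℂ) + -1 = 0 by ring, zero_smul] at h3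
    have hx0 : x = 0 := by
      have : (-1 - 1 : ℂ) ≠ 0 := by norm_num
      exact (smul_eq_zero.1 h3.symm).resolve_left this
    apply hy0
    rw [← hy1, hx0]
    simp
  · have hx0 : x = 0 := by
      refine (isHurwitz_iff A).1 hA ((1 + κ)⁻¹ * (κ - 1)) x ?_ ?_
      · have h4 : (1 + κ)⁻¹ * (κ - 1) =
            ((κ - 1) * (starRingEnd ℂ) (1 + κ)) * ((Complex.normSq (1 + κ))⁻¹ : ℝ) := by
          rw [Complex.inv_def]
          ring
        rw [h4, Complex.re_mul_ofReal]
        refine mul_nonneg ?_ (inv_nonneg.2 (Complex.normSq_nonneg _))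
        have h5 : 1 ≤ κ.re * κ.re + κ.im * κ.im := by
          have h6 : 1 ≤ ‖κ‖ ^ 2 := by nlinarith
          rwa [Complex.sq_norm, Complex.normSq_apply] at h6
        simp
        nlinarith
      · rw [mul_smul, ← h3, smul_smul, inv_mul_cancel₀ hk, one_smul]
    apply hy0
    rw [← hy1, hx0]
    simp

/-- Gelfand's formula: eventually `‖a ^ k‖ ≤ ρ ^ k` for some `ρ < 1` above the spectral radius. -/
theorem tendsto_pow_of_spectralRadius_lt_one {𝔸 : Type*} [NormedRing 𝔸] [NormedAlgebra ℂ 𝔸]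
    [CompleteSpace 𝔸] {a : 𝔸} (ha : spectralRadius ℂ a < 1) :
    Tendsto (fun k : ℕ => a ^ k) atTop (𝓝 0) := by
  obtain ⟨ρ, hρ1, hρ2⟩ := ENNReal.lt_iff_exists_nnreal_btwn.1 ha
  have hρ3 : ρ < 1 := by exact_mod_cast hρ2
  have hev := (spectrum.pow_nnnorm_pow_one_div_tendsto_nhds_spectralRadius a).eventually_lt_const hρ1
  rw [tendsto_zero_iff_norm_tendsto_zero]
  refine squeeze_zero' (Eventually.of_forall fun _ => norm_nonneg _) ?_
    (tendsto_pow_atTop_nhds_zero_of_lt_one ρ.2 (by exact_mod_cast hρ3))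
  filter_upwards [hev, eventually_gt_atTop 0] with k hk hk0
  have hk1 : (k : ℝ) ≠ 0 := by positivity
  have h5 : ((‖a ^ k‖₊ : ENNReal) ^ (1 / k : ℝ)) ^ (k : ℝ) ≤ (ρ : ENNReal) ^ (k : ℝ) :=
    ENNReal.rpow_le_rpow hk.le (by positivity)
  rw [← ENNReal.rpow_mul, one_div, inv_mul_cancel₀ hk1, ENNReal.rpow_one,
    ENNReal.rpow_natCast] at h5
  have h6 : ‖a ^ k‖₊ ≤ ρ ^ k := by exact_mod_cast h5
  exact_mod_cast h6

theorem tendsto_matrix_pow_apply {B : Matrix n n ℂ} (hB : ∀ κ ∈ spectrum ℂ B, ‖κ‖ < 1) (i j : n) :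
    Tendsto (fun k : ℕ => (B ^ k) i j) atTop (𝓝 0) := by
  let _ : NormedRing (Matrix n n ℂ) := Matrix.linftyOpNormedRing
  let _ : NormedAlgebra ℂ (Matrix n n ℂ) := Matrix.linftyOpNormedAlgebra
  have : CompleteSpace (Matrix n n ℂ) := FiniteDimensional.complete ℂ _
  have : Nonempty n := ⟨i⟩
  have hr : spectralRadius ℂ B < 1 :=
    spectrum.spectralRadius_lt_of_forall_lt B (r := 1) fun κ hκ => by
      have := hB κ hκ
      exact_mod_cast this
  have hc := (Matrix.entryLinearMap ℂ ℂ i j).continuous_of_finiteDimensional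
  have := (hc.tendsto 0).comp (tendsto_pow_of_spectralRadius_lt_one hr)
  simpa [Function.comp_def] using this

theorem IsHurwitz.tendsto_cayley_pow {A : Matrix n n ℝ} (hA : IsHurwitz A) :
    Tendsto (fun k : ℕ => cayley A ^ k) atTop (𝓝 0) := by
  refine tendsto_pi_nhds.2 fun i => tendsto_pi_nhds.2 fun j => ?_
  have h1 := (Complex.continuous_re.tendsto 0).comp
    (tendsto_matrix_pow_apply (fun κ => hA.norm_lt_one_of_mem_spectrum_cayley) i j)
  have h2 : ∀ k : ℕ, (cayley A).map (algebraMap ℝ ℂ) ^ k =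
      ((cayley A) ^ k).map (algebraMap ℝ ℂ) := fun k =>
    (Matrix.map_pow (cayley A) (algebraMap ℝ ℂ) k).symm
  simp only [Function.comp_def, h2, Matrix.map_apply] at h1
  exact h1

theorem dotProduct_transpose_mul_mul_mulVec {m n : Type*} [Fintype m] [Fintype n] (C : Matrix m n ℝ)
    (P : Matrix m m ℝ) (x : n → ℝ) :
    x ⬝ᵥ (C.transpose * P * C).mulVec x = C.mulVec x ⬝ᵥ P.mulVec (C.mulVec x) := by
  rw [← Matrix.mulVec_mulVec, ← Matrix.mulVec_mulVec, Matrix.dotProduct_mulVec x,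
    Matrix.vecMul_transpose]

/-- The identity `(1 - A)ᵀ X (1 - A) - (1 + A)ᵀ X (1 + A) = -2 (Aᵀ X + X A)`, conjugated by `(1 -
A)⁻¹`. It replaces the integral formula for Lyapunov solutions by powers of a matrix that tend to
zero. -/
theorem IsHurwitz.stein_of_lyapunov {A X R : Matrix n n ℝ} (hA : IsHurwitz A)
    (hX : A.transpose * X + X * A = R) :
    X - (cayley A).transpose * X * cayley A =
      (-2 : ℝ) • (((1 - A)⁻¹).transpose * R * (1 - A)⁻¹) := by
  have hu : (1 - A) * (1 - A)⁻¹ = 1 :=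
    Matrix.mul_nonsing_inv _ ((Matrix.isUnit_iff_isUnit_det _).1 hA.isUnit_one_sub)
  have hut : ((1 - A)⁻¹).transpose * (1 - A).transpose = 1 := by
    rw [← Matrix.transpose_mul, hu, Matrix.transpose_one]
  have h1 : X = ((1 - A)⁻¹).transpose * ((1 - A).transpose * X * (1 - A)) * (1 - A)⁻¹ := by
    calc X = (((1 - A)⁻¹).transpose * (1 - A).transpose) * X * ((1 - A) * (1 - A)⁻¹) := by
          rw [hu, hut]; simp
      _ = _ := by simp only [mul_assoc]
  have h2 : (cayley A).transpose * X * cayley A =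
      ((1 - A)⁻¹).transpose * ((1 + A).transpose * X * (1 + A)) * (1 - A)⁻¹ := by
    rw [cayley, Matrix.transpose_mul]
    simp only [mul_assoc]
  rw [h2]
  nth_rewrite 1 [h1]
  rw [← sub_mul, ← mul_sub, ← hX, ← smul_mul_assoc, ← mul_smul_comm]
  congr 2
  rw [Matrix.transpose_sub, Matrix.transpose_add, Matrix.transpose_one]
  rw [smul_add, neg_smul, neg_smul, two_smul, two_smul]
  noncomm_ring

/-- With zero right side the Stein equation says `X = Cᵀ X C` for the Cayley transform `C`.
Iterating gives `X = (Cᵏ)ᵀ X Cᵏ → 0`. -/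
theorem IsHurwitz.eq_zero_of_lyapunov {A X : Matrix n n ℝ} (hA : IsHurwitz A)
    (hX : A.transpose * X + X * A = 0) : X = 0 := by
  have h1 : (cayley A).transpose * X * cayley A = X := by
    have := hA.stein_of_lyapunov hX
    simp only [mul_zero, zero_mul, smul_zero] at this
    exact (sub_eq_zero.1 this).symm
  have h2 : ∀ k : ℕ, (cayley A ^ k).transpose * X * cayley A ^ k = X := by
    intro k
    induction k with
    | zero => simp
    | succ k ih =>
      rw [pow_succ, Matrix.transpose_mul]
      calc _ = (cayley A).transpose * ((cayley A ^ k).transpose * X * cayley A ^ k) * cayley A := by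
            simp only [mul_assoc]
        _ = X := by rw [ih, h1]
  have hc : Continuous fun M : Matrix n n ℝ => M.transpose * X * M := by fun_prop
  have h3 := (hc.tendsto 0).comp hA.tendsto_cayley_pow
  have h4 : ((fun M : Matrix n n ℝ => M.transpose * X * M) ∘ fun k : ℕ => cayley A ^ k) =
      fun _ => X := funext h2
  rw [h4] at h3
  have := tendsto_nhds_unique h3 tendsto_const_nhds
  simpa using this.symm

/-- The Lyapunov operator is injective on a finite-dimensional space, hence bijective, and the
transpose of a solution solves the same equation. For positivity, the Stein form reads `xᵀ P x = (C
x)ᵀ P (C x) + 4 |R x|²` with `R = (1 - A)⁻¹` invertible. So the form decreases along the powers of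
`C` to the limit `0`, and is positive at the start unless `x = 0`. -/
theorem IsHurwitz.existsUnique_lyapunov {A : Matrix n n ℝ} (hA : IsHurwitz A) :
    ∃! P, IsLyapunovSolution A P := by
  let f : Matrix n n ℝ →ₗ[ℝ] Matrix n n ℝ :=
    LinearMap.mulLeft ℝ A.transpose + LinearMap.mulRight ℝ A
  have hinj : Function.Injective f := by
    rw [injective_iff_map_eq_zero]
    intro X hX
    exact hA.eq_zero_of_lyapunov (by simpa [f] using hX)
  obtain ⟨P, hP⟩ := (LinearMap.injective_iff_surjective.1 hinj) ((-2 : ℝ) • (1 : Matrix n n ℝ))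
  have hP' : A.transpose * P + P * A = (-2 : ℝ) • (1 : Matrix n n ℝ) := by simpa [f] using hP
  refine ⟨P, ⟨?_, hP'⟩, fun P' hP'' => hinj ?_⟩
  · have hsymm : P.IsHermitian := by
      rw [Matrix.IsHermitian, Matrix.conjTranspose_eq_transpose_of_trivial]
      apply hinj
      rw [hP]
      have := congrArg Matrix.transpose hP'
      simp only [Matrix.transpose_add, Matrix.transpose_mul, Matrix.transpose_transpose,
        Matrix.transpose_smul, Matrix.transpose_one] at this
      simpa [f, add_comm] using this
    have hst := hA.stein_of_lyapunov hP'
    set Rm := (1 - A)⁻¹ with hRm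
    have hstep : ∀ x : n → ℝ, x ⬝ᵥ P.mulVec x =
        (cayley A).mulVec x ⬝ᵥ P.mulVec ((cayley A).mulVec x) +
          4 * (Rm.mulVec x ⬝ᵥ Rm.mulVec x) := by
      intro x
      have h1 : P = (cayley A).transpose * P * cayley A +
          (4 : ℝ) • (Rm.transpose * 1 * Rm) := by
        rw [sub_eq_iff_eq_add'] at hst
        nth_rewrite 1 [hst]
        congr 1
        simp only [mul_smul_comm, smul_mul_assoc, mul_one, smul_smul]
        norm_num
      nth_rewrite 1 [h1]
      rw [Matrix.add_mulVec, dotProduct_add, Matrix.smul_mulVec, dotProduct_smul, smul_eq_mul,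
        dotProduct_transpose_mul_mul_mulVec, dotProduct_transpose_mul_mul_mulVec, Matrix.one_mulVec]
    have hnn : ∀ x : n → ℝ, 0 ≤ x ⬝ᵥ P.mulVec x := by
      intro x
      set a : ℕ → ℝ := fun k =>
        (cayley A ^ k).mulVec x ⬝ᵥ P.mulVec ((cayley A ^ k).mulVec x) with ha
      have hanti : Antitone a := antitone_nat_of_succ_le fun k => by
        simp only [ha]
        rw [hstep ((cayley A ^ k).mulVec x), pow_succ', ← Matrix.mulVec_mulVec]
        have := dotProduct_self_star_nonneg (Rm.mulVec ((cayley A ^ k).mulVec x))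
        simp only [star_trivial] at this
        linarith
      have hlim : Tendsto a atTop (𝓝 0) := by
        have hc : Continuous fun M : Matrix n n ℝ => M.mulVec x ⬝ᵥ P.mulVec (M.mulVec x) := by
          fun_prop
        have := (hc.tendsto 0).comp hA.tendsto_cayley_pow
        simpa only [Function.comp_def, Matrix.zero_mulVec, zero_dotProduct] using this
      simpa [ha] using hanti.le_of_tendsto hlim 0
    refine Matrix.PosDef.of_dotProduct_mulVec_pos hsymm fun x hx => ?_
    rw [star_trivial, hstep x]
    have h0 : Rm.mulVec x ≠ 0 := by
      intro h0
      apply hx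
      have h1 : (1 - A) * Rm = 1 :=
        Matrix.mul_nonsing_inv _ ((Matrix.isUnit_iff_isUnit_det _).1 hA.isUnit_one_sub)
      rw [← Matrix.one_mulVec x, ← h1, ← Matrix.mulVec_mulVec, h0, Matrix.mulVec_zero]
    have h2 : 0 < Rm.mulVec x ⬝ᵥ Rm.mulVec x := by
      have := dotProduct_self_star_nonneg (Rm.mulVec x)
      simp only [star_trivial] at this
      exact lt_of_le_of_ne this fun h => h0 (dotProduct_self_eq_zero.1 h.symm)
    linarith [hnn ((cayley A).mulVec x)]
  · rw [hP]
    simpa [f] using hP''.2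


end Lyapunov

/-! ### Norms and extreme eigenvalues -/

section Norms

variable {m n : Type*} [Fintype m] [Fintype n]

theorem sqNorm_nonneg (x : n → ℝ) : 0 ≤ sqNorm x := Finset.sum_nonneg fun _ _ => sq_nonneg _

theorem sqNorm_eq_dotProduct (x : n → ℝ) : sqNorm x = x ⬝ᵥ x := by
  simp only [sqNorm, dotProduct, sq]

theorem sqNorm_eq_norm_sq (x : n → ℝ) : sqNorm x = ‖WithLp.toLp 2 x‖ ^ 2 := by
  rw [EuclideanSpace.real_norm_sq_eq, sqNorm]

theorem sqNorm_pos {x : n → ℝ} (hx : x ≠ 0) : 0 < sqNorm x := by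
  rw [sqNorm_eq_norm_sq]
  have : WithLp.toLp 2 x ≠ 0 := by simpa using hx
  positivity

/-- The state spaces carry the sup norm, while the Lyapunov estimates are Euclidean. This comparison
and its converse pass between the two. -/
theorem norm_sq_le_sqNorm (x : n → ℝ) : ‖x‖ ^ 2 ≤ sqNorm x := by
  rw [← Real.le_sqrt (norm_nonneg _) (sqNorm_nonneg x)]
  refine (pi_norm_le_iff_of_nonneg (Real.sqrt_nonneg _)).2 fun i => ?_
  rw [Real.le_sqrt (norm_nonneg _) (sqNorm_nonneg x), Real.norm_eq_abs, sq_abs]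
  exact Finset.single_le_sum (f := fun i => x i ^ 2) (fun _ _ => sq_nonneg _) (Finset.mem_univ i)

theorem sqNorm_le_card_mul_norm_sq (x : n → ℝ) : sqNorm x ≤ Fintype.card n * ‖x‖ ^ 2 := by
  calc sqNorm x ≤ ∑ _i : n, ‖x‖ ^ 2 := by
        refine Finset.sum_le_sum fun i _ => ?_
        rw [← sq_abs]
        gcongr
        exact norm_le_pi_norm x i
    _ = _ := by simp

theorem dotProduct_sq_le (x y : n → ℝ) : (x ⬝ᵥ y) ^ 2 ≤ sqNorm x * sqNorm y :=
  Finset.sum_mul_sq_le_sq_mul_sq _ _ _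

theorem two_mul_dotProduct_le (x y : n → ℝ) : 2 * (x ⬝ᵥ y) ≤ sqNorm x + sqNorm y := by
  simp only [sqNorm, dotProduct, Finset.mul_sum, ← Finset.sum_add_distrib]
  exact Finset.sum_le_sum fun i _ => by nlinarith [sq_nonneg (x i - y i)]

variable [DecidableEq n]

theorem opNorm_nonneg (A : Matrix m n ℝ) : 0 ≤ opNorm A := norm_nonneg _

theorem sqNorm_mulVec_le (A : Matrix m n ℝ) (x : n → ℝ) :
    sqNorm (A.mulVec x) ≤ opNorm A ^ 2 * sqNorm x := by
  rw [sqNorm_eq_norm_sq, sqNorm_eq_norm_sq, ← mul_pow]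
  gcongr
  exact (LinearMap.toContinuousLinearMap (Matrix.toEuclideanLin A)).le_opNorm (WithLp.toLp 2 x)

theorem abs_dotProduct_mulVec_le (A : Matrix n n ℝ) (x : n → ℝ) :
    |x ⬝ᵥ A.mulVec x| ≤ opNorm A * sqNorm x := by
  refine abs_le_of_sq_le_sq ?_ (mul_nonneg (opNorm_nonneg _) (sqNorm_nonneg _))
  calc (x ⬝ᵥ A.mulVec x) ^ 2 ≤ sqNorm x * sqNorm (A.mulVec x) := dotProduct_sq_le _ _
    _ ≤ sqNorm x * (opNorm A ^ 2 * sqNorm x) := by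
        gcongr
        · exact sqNorm_nonneg x
        · exact sqNorm_mulVec_le A x
    _ = _ := by ring

theorem continuous_opNorm : Continuous (opNorm : Matrix m n ℝ → ℝ) := by
  refine continuous_norm.comp ?_
  exact ((LinearMap.toContinuousLinearMap :
    (EuclideanSpace ℝ n →ₗ[ℝ] EuclideanSpace ℝ m) ≃ₗ[ℝ] _).toLinearMap ∘ₗ
    (Matrix.toEuclideanLin (𝕜 := ℝ) (m := m) (n := n)).toLinearMap).continuous_of_finiteDimensional

/-- Finiteness makes the supremum and infimum in `lambdaMax` and `lambdaMin` genuine bounds of the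
spectrum. -/
theorem finite_real_spectrum (P : Matrix n n ℝ) : (spectrum ℝ P).Finite := by
  rw [← Matrix.spectrum_toLin']
  exact Module.End.finite_spectrum _

theorem dotProduct_mulVec_le_lambdaMax {P : Matrix n n ℝ} (hP : P.IsHermitian) (x : n → ℝ) :
    x ⬝ᵥ P.mulVec x ≤ lambdaMax P * sqNorm x := by
  have h : (lambdaMax P • (1 : Matrix n n ℝ) - P).PosSemidef := by
    rw [Matrix.posSemidef_iff_isHermitian_and_spectrum_nonneg]
    refine ⟨(Matrix.isHermitian_one.smul (IsSelfAdjoint.all _)).sub hP, fun μ hμ => ?_⟩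
    obtain ⟨y, hy0, hy⟩ := (mem_spectrum_iff _ μ).1 hμ
    have hmem : lambdaMax P - μ ∈ spectrum ℝ P := (mem_spectrum_iff _ _).2 ⟨y, hy0, by
      rw [Matrix.sub_mulVec, Matrix.smul_mulVec, Matrix.one_mulVec] at hy
      rw [sub_smul, ← hy, sub_sub_cancel]⟩
    have : lambdaMax P - μ ≤ lambdaMax P := le_csSup (finite_real_spectrum P).bddAbove hmem
    exact sub_le_self_iff _ |>.1 this
  have := h.dotProduct_mulVec_nonneg x
  rw [star_trivial, Matrix.sub_mulVec, dotProduct_sub, Matrix.smul_mulVec, Matrix.one_mulVec,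
    dotProduct_smul, smul_eq_mul, ← sqNorm_eq_dotProduct] at this
  linarith

theorem lambdaMin_le_dotProduct_mulVec {P : Matrix n n ℝ} (hP : P.IsHermitian) (x : n → ℝ) :
    lambdaMin P * sqNorm x ≤ x ⬝ᵥ P.mulVec x := by
  have h : (P - lambdaMin P • (1 : Matrix n n ℝ)).PosSemidef := by
    rw [Matrix.posSemidef_iff_isHermitian_and_spectrum_nonneg]
    refine ⟨hP.sub (Matrix.isHermitian_one.smul (IsSelfAdjoint.all _)), fun μ hμ => ?_⟩
    obtain ⟨y, hy0, hy⟩ := (mem_spectrum_iff _ μ).1 hμ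
    have hmem : lambdaMin P + μ ∈ spectrum ℝ P := (mem_spectrum_iff _ _).2 ⟨y, hy0, by
      rw [Matrix.sub_mulVec, Matrix.smul_mulVec, Matrix.one_mulVec] at hy
      rw [add_smul, ← hy, add_sub_cancel]⟩
    have : lambdaMin P ≤ lambdaMin P + μ := csInf_le (finite_real_spectrum P).bddBelow hmem
    exact le_add_iff_nonneg_right _ |>.1 this
  have := h.dotProduct_mulVec_nonneg x
  rw [star_trivial, Matrix.sub_mulVec, dotProduct_sub, Matrix.smul_mulVec, Matrix.one_mulVec,
    dotProduct_smul, smul_eq_mul, ← sqNorm_eq_dotProduct] at this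
  linarith

theorem real_spectrum_nonempty [Nonempty n] {P : Matrix n n ℝ} (hP : P.IsHermitian) :
    (spectrum ℝ P).Nonempty := by
  rw [hP.spectrum_eq_image_range]
  exact (Set.range_nonempty _).image _

theorem lambdaMax_le_opNorm [Nonempty n] {P : Matrix n n ℝ} (hP : P.IsHermitian) :
    lambdaMax P ≤ opNorm P := by
  refine csSup_le (real_spectrum_nonempty hP) fun μ hμ => ?_
  obtain ⟨x, hx0, hx⟩ := (mem_spectrum_iff _ μ).1 hμ
  have h := (le_abs_self _).trans (abs_dotProduct_mulVec_le P x)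
  rw [hx, dotProduct_smul, smul_eq_mul, ← sqNorm_eq_dotProduct] at h
  exact le_of_mul_le_mul_right h (sqNorm_pos hx0)

/-- By symmetry of `P` the two terms of the Lyapunov equation contribute equally, so each carries
half of `-2|x|²`. -/
theorem IsLyapunovSolution.quadratic_form {A P : Matrix n n ℝ} (h : IsLyapunovSolution A P)
    (x : n → ℝ) : x ⬝ᵥ P.mulVec (A.mulVec x) = - sqNorm x := by
  have h1 := congrArg (fun B : Matrix n n ℝ => x ⬝ᵥ B.mulVec x) h.2
  simp only [Matrix.add_mulVec, dotProduct_add, Matrix.smul_mulVec, Matrix.one_mulVec,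
    dotProduct_smul, smul_eq_mul, ← Matrix.mulVec_mulVec, ← sqNorm_eq_dotProduct] at h1
  have hs : P.transpose = P := by
    have := h.1.isHermitian
    rwa [Matrix.IsHermitian, Matrix.conjTranspose_eq_transpose_of_trivial] at this
  have h2 : x ⬝ᵥ A.transpose.mulVec (P.mulVec x) = x ⬝ᵥ P.mulVec (A.mulVec x) := by
    rw [Matrix.dotProduct_mulVec, Matrix.vecMul_transpose, Matrix.dotProduct_mulVec,
      ← Matrix.mulVec_transpose, hs, dotProduct_comm]
  rw [h2] at h1
  linarith

/-- On an eigenvector of the least eigenvalue the quadratic form gives `λ_min (x · A x) = -|x|²`.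
This bounds `λ_min(P(w))` from below through `‖A_c(w)‖` alone, so positivity of `λ_m` needs no
continuity of `P`. -/
theorem IsLyapunovSolution.one_le_lambdaMin_mul_opNorm [Nonempty n] {A P : Matrix n n ℝ}
    (h : IsLyapunovSolution A P) : 1 ≤ lambdaMin P * opNorm A := by
  have hmem : lambdaMin P ∈ spectrum ℝ P :=
    (real_spectrum_nonempty h.1.isHermitian).csInf_mem (finite_real_spectrum P)
  obtain ⟨x, hx0, hx⟩ := (mem_spectrum_iff _ _).1 hmem
  have hpos := sqNorm_pos hx0
  have hs : P.transpose = P := by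
    have := h.1.isHermitian
    rwa [Matrix.IsHermitian, Matrix.conjTranspose_eq_transpose_of_trivial] at this
  have hmin : 0 < lambdaMin P := by
    have h1 := h.1.dotProduct_mulVec_pos hx0
    rw [star_trivial, hx, dotProduct_smul, smul_eq_mul, ← sqNorm_eq_dotProduct] at h1
    exact pos_of_mul_pos_left h1 hpos.le
  have h2 := h.quadratic_form x
  rw [Matrix.dotProduct_mulVec, ← Matrix.mulVec_transpose, hs, hx, smul_dotProduct,
    smul_eq_mul] at h2
  have h3 := (neg_le_abs _).trans (abs_dotProduct_mulVec_le A x)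
  have h4 : lambdaMin P * -(x ⬝ᵥ A.mulVec x) ≤ lambdaMin P * (opNorm A * sqNorm x) := by gcongr
  have h5 : 1 * sqNorm x ≤ (lambdaMin P * opNorm A) * sqNorm x := by linarith
  exact le_of_mul_le_mul_right h5 hpos

theorem exists_opNorm_bound {X : Type*} [TopologicalSpace X] {s : Set X} (hs : IsCompact s)
    {A : X → Matrix m n ℝ} (hA : ContinuousOn A s) :
    ∃ C : ℝ, 0 < C ∧ ∀ x ∈ s, opNorm (A x) ≤ C := by
  obtain ⟨C, hC⟩ := hs.exists_bound_of_continuousOn (continuous_opNorm.comp_continuousOn hA)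
  exact ⟨max C 1, by positivity, fun x hx =>
    (le_abs_self _).trans ((hC x hx).trans (le_max_left _ _))⟩

/-- The Lyapunov operators depend continuously on `x` and are injective, so their inverses are
uniformly bounded; the right side `-2 I` is fixed. -/
theorem exists_lyapunov_bound {X : Type*} [TopologicalSpace X] {s : Set X} (hs : IsCompact s)
    {A : X → Matrix n n ℝ} (hA : ContinuousOn A s) (hH : ∀ x ∈ s, IsHurwitz (A x)) :
    ∃ C : ℝ, 0 < C ∧ ∀ x ∈ s, ∀ P, IsLyapunovSolution (A x) P → opNorm P ≤ C := by
  let f : X → (n → n → ℝ) → (n → n → ℝ) := fun x P =>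
    Matrix.of.symm ((A x).transpose * Matrix.of P + Matrix.of P * A x)
  obtain ⟨C, hC0, hC⟩ := exists_uniform_lower_bound hs f (by
      have h1 : ContinuousOn (fun q : X × (n → n → ℝ) => A q.1) (s ×ˢ Set.univ) :=
        hA.comp continuousOn_fst fun q hq => hq.1
      have h2 : ContinuousOn (fun q : X × (n → n → ℝ) => q.2) (s ×ˢ Set.univ) := continuousOn_snd
      have hc : Continuous fun q : Matrix n n ℝ × Matrix n n ℝ =>
        q.1.transpose * q.2 + q.2 * q.1 := by fun_prop
      exact hc.comp_continuousOn (h1.prodMk h2))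
    (fun x _ c P => by
      have h1 : Matrix.of (c • P) = c • Matrix.of P := rfl
      have h2 : ∀ B : Matrix n n ℝ, Matrix.of.symm (c • B) = c • Matrix.of.symm B := fun B => rfl
      simp only [f, h1, ← h2, smul_add, mul_smul_comm, smul_mul_assoc])
    (fun x hx P hP => (hH x hx).eq_zero_of_lyapunov hP)
  obtain ⟨D, hD0, hD⟩ := exists_opNorm_bound
    (isCompact_closedBall (0 : n → n → ℝ)
      (C * ‖Matrix.of.symm ((-2 : ℝ) • (1 : Matrix n n ℝ))‖))
    (A := fun P => Matrix.of P) continuousOn_id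
  refine ⟨D, hD0, fun x hx P hP => hD (Matrix.of.symm P) ?_⟩
  rw [mem_closedBall_zero_iff, ← hP.2]
  exact hC x hx (Matrix.of.symm P)

end Norms

/-! ### The matrix of the digraph -/

section Graph

variable {N : ℕ}

theorem adjEntry_self (G : Digraph (Fin (N + 1))) (i : Fin (N + 1)) : adjEntry G i i = 0 := by
  simp [adjEntry]

theorem adjEntry_nonneg (G : Digraph (Fin (N + 1))) (i j : Fin (N + 1)) : 0 ≤ adjEntry G i j := by
  unfold adjEntry
  split_ifs <;> norm_num

/-- The rows of `H` are weighted sums of differences, where the leader has the value `0`. -/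
theorem sum_graphH_mul {R : Type*} [CommRing R] [Algebra ℝ R] (G : Digraph (Fin (N + 1)))
    (x : Fin N → R) (i : Fin N) :
    ∑ j, algebraMap ℝ R (graphH G i j) * x j =
      ∑ k, algebraMap ℝ R (adjEntry G i.succ k) *
        (x i - (Fin.cons 0 x : Fin (N + 1) → R) k) := by
  have h1 : ∀ j, graphH G i j = (if i = j then ∑ k, adjEntry G i.succ k else 0) -
      adjEntry G i.succ j.succ := by
    intro j
    by_cases h : i = j
    · subst h
      simp [graphH, adjEntry_self]
    · simp [graphH, h]
  have h2 : ∀ j, algebraMap ℝ R (graphH G i j) * x j =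
      (if i = j then (∑ k, algebraMap ℝ R (adjEntry G i.succ k)) * x i else 0) -
      algebraMap ℝ R (adjEntry G i.succ j.succ) * x j := by
    intro j
    rw [h1, map_sub, sub_mul]
    by_cases h : i = j
    · subst h
      simp
    · simp [h]
  simp only [h2, Finset.sum_sub_distrib, Finset.sum_ite_eq, Finset.mem_univ, if_true, mul_sub,
    ← Finset.sum_mul]
  congr 1
  rw [Fin.sum_univ_succ]
  simp

/-- A maximum principle. Extend a mode `x` with `Re μ ≥ 0` by the value `0` at the leader. Row `i`
reads `(∑ a_ik + μ / b_i) x_i = ∑ a_ik Y_k`, so if `|x_i|` is maximal then no in-neighbour can have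
smaller modulus. Hence being strictly below the maximum spreads along the tree from the leader to
every node, although the maximum is attained. -/
theorem isHurwitz_neg_diagonal_mul_graphH {G : Digraph (Fin (N + 1))} (hG : HasSpanningTree G 0)
    {b : Fin N → ℝ} (hb : ∀ i, 0 < b i) : IsHurwitz (-(Matrix.diagonal b * graphH G)) := by
  rw [isHurwitz_iff]
  intro μ x hμ hx
  by_contra hx0
  have hm : 0 < ‖x‖ := norm_pos_iff.2 hx0
  set Y : Fin (N + 1) → ℂ := Fin.cons 0 x with hY
  have hrow : ∀ i, ((∑ k, (adjEntry G i.succ k : ℂ)) + μ / b i) * x i =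
      ∑ k, (adjEntry G i.succ k : ℂ) * Y k := by
    intro i
    have h1 := congrFun hx i
    have hbi : (b i : ℂ) ≠ 0 := by exact_mod_cast (hb i).ne'
    have h2 := sum_graphH_mul (R := ℂ) G x i
    simp only [mul_sub, Finset.sum_sub_distrib, ← Finset.sum_mul, Complex.coe_algebraMap,
      ← hY] at h2
    have h3 : cmulVec (-(Matrix.diagonal b * graphH G)) x i =
        -((b i : ℂ) * ∑ j, (graphH G i j : ℂ) * x j) := by
      simp only [cmulVec, Matrix.mulVec, dotProduct, Matrix.map_apply, Matrix.neg_apply,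
        Matrix.diagonal_mul, Finset.mul_sum, Complex.coe_algebraMap]
      rw [← Finset.sum_neg_distrib]
      refine Finset.sum_congr rfl fun j _ => ?_
      push_cast
      ring
    rw [h3, h2] at h1
    simp only [Pi.smul_apply, smul_eq_mul] at h1
    field_simp
    linear_combination -h1
  obtain ⟨T, hTG, -, -, hT⟩ := hG
  have hlt : ∀ c, ‖Y c‖ < ‖x‖ := by
    intro c
    induction hT c with
    | refl => simpa [hY] using hm
    | @tail a c _ hac ih =>
      rcases Fin.eq_zero_or_eq_succ c with rfl | ⟨i, rfl⟩
      · simpa [hY] using hm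
      -- Loops have weight zero in `adjEntry`; for a loop the claim is the induction hypothesis
      -- itself.
      · by_cases hai : a = i.succ
        · rwa [hai] at ih
        have hx1 : ‖x i‖ ≤ ‖x‖ := norm_le_pi_norm x i
        have hY1 : ∀ k, ‖Y k‖ ≤ ‖x‖ := by
          intro k
          rcases Fin.eq_zero_or_eq_succ k with rfl | ⟨j, rfl⟩
          · simp [hY]
          · simpa [hY] using norm_le_pi_norm x j
        by_contra hge
        have heq : ‖x i‖ = ‖x‖ := by
          refine le_antisymm hx1 ?_
          simpa [hY] using hge
        have hadj : adjEntry G i.succ a = 1 := by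
          simp [adjEntry, hTG _ _ hac, Ne.symm hai]
        have hleft : (∑ k, adjEntry G i.succ k) * ‖x‖ ≤
            ‖((∑ k, (adjEntry G i.succ k : ℂ)) + μ / b i) * x i‖ := by
          rw [norm_mul, heq]
          gcongr
          refine le_trans ?_ (Complex.re_le_norm _)
          rw [Complex.add_re, Complex.div_ofReal_re, ← Complex.ofReal_sum, Complex.ofReal_re]
          have := div_nonneg hμ (hb i).le
          linarith
        have hright : ‖∑ k, (adjEntry G i.succ k : ℂ) * Y k‖ <
            (∑ k, adjEntry G i.succ k) * ‖x‖ := by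
          refine (norm_sum_le _ _).trans_lt ?_
          rw [Finset.sum_mul]
          refine Finset.sum_lt_sum (fun k _ => ?_) ⟨a, Finset.mem_univ _, ?_⟩
          · rw [norm_mul, Complex.norm_real, Real.norm_eq_abs,
              abs_of_nonneg (adjEntry_nonneg G _ _)]
            exact mul_le_mul_of_nonneg_left (hY1 k) (adjEntry_nonneg G _ _)
          · rw [norm_mul, hadj]
            simpa using ih
        rw [hrow i] at hleft
        exact absurd hright (not_lt.2 hleft)
  have : ‖x‖ < ‖x‖ := by
    refine (pi_norm_lt_iff hm).2 fun i => ?_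
    simpa [hY] using hlt i.succ
  exact lt_irrefl _ this

theorem opNorm_graphH_sq_le_lam2 {G : Digraph (Fin (N + 1))} (hG : HasSpanningTree G 0) :
    opNorm (graphH G) ^ 2 ≤ lam2 N := by
  have hfin : (Set.range fun G : Digraph (Fin (N + 1)) => opNorm (graphH G) ^ 2).Finite := by
    have : Finite (Digraph (Fin (N + 1))) :=
      Finite.of_injective (fun G : Digraph (Fin (N + 1)) => G.Adj) fun _ _ h => Digraph.ext h
    exact Set.finite_range _
  refine le_csSup (hfin.bddAbove.mono ?_) ⟨G, hG, rfl⟩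
  rintro x ⟨G', -, rfl⟩
  exact ⟨G', rfl⟩

end Graph

/-! ### Stable polynomials -/

section StablePoly

/-- A stable monic polynomial of degree `m` dominates the powers up to `m` on the closed right half
plane. -/
theorem IsStableMonic.exists_pow_bound {m : ℕ} {c : Fin m → ℝ} (hc : IsStableMonic c) :
    ∃ C : ℝ, 0 < C ∧ ∀ μ : ℂ, 0 ≤ μ.re → ∀ q ≤ m,
      ‖μ‖ ^ q ≤ C * ‖μ ^ m + ∑ j : Fin m, (c j : ℂ) * μ ^ (j : ℕ)‖ := by
  set p : ℂ → ℂ := fun μ => μ ^ m + ∑ j : Fin m, (c j : ℂ) * μ ^ (j : ℕ) with hp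
  have hpc : Continuous p := by fun_prop
  -- For `|μ| > R` the lower-order terms amount to at most half of `|μ| ^ m`; on the remaining half
  -- disc the polynomial has a positive minimum modulus.
  set R : ℝ := 1 + 2 * ∑ j, |c j| with hR
  have hR1 : 1 ≤ R := by
    have : 0 ≤ ∑ j, |c j| := Finset.sum_nonneg fun _ _ => abs_nonneg _
    linarith
  have hK : IsCompact (Metric.closedBall (0 : ℂ) R ∩ {μ : ℂ | 0 ≤ μ.re}) :=
    (isCompact_closedBall 0 R).inter_right (isClosed_le continuous_const Complex.continuous_re)
  obtain ⟨μ₀, hμ₀, hmin⟩ := hK.exists_isMinOn ⟨0, by simp; linarith⟩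
    (continuous_norm.comp hpc).continuousOn
  have hpos : 0 < ‖p μ₀‖ := norm_pos_iff.2 fun h => absurd (hc μ₀ h) (not_lt.2 hμ₀.2)
  refine ⟨max 2 (R ^ m / ‖p μ₀‖), by positivity, fun μ hμ q hq => ?_⟩
  by_cases hμR : ‖μ‖ ≤ R
  · have h1 : ‖p μ₀‖ ≤ ‖p μ‖ := hmin ⟨by simpa using hμR, hμ⟩
    calc ‖μ‖ ^ q ≤ R ^ q := by gcongr
      _ ≤ R ^ m := by gcongr
      _ = R ^ m / ‖p μ₀‖ * ‖p μ₀‖ := by field_simp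
      _ ≤ max 2 (R ^ m / ‖p μ₀‖) * ‖p μ‖ := by
        gcongr
        exact le_max_right _ _
  · push Not at hμR
    have hμ1 : 1 ≤ ‖μ‖ := hR1.trans hμR.le
    have h2 : 2 * ‖∑ j : Fin m, (c j : ℂ) * μ ^ (j : ℕ)‖ ≤ ‖μ‖ ^ m := by
      rcases m with _ | m
      · simp
      calc 2 * ‖∑ j : Fin (m + 1), (c j : ℂ) * μ ^ (j : ℕ)‖
          ≤ 2 * ∑ j : Fin (m + 1), |c j| * ‖μ‖ ^ m := by
            gcongr
            refine norm_sum_le_of_le _ fun j _ => ?_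
            rw [norm_mul, norm_pow, Complex.norm_real, Real.norm_eq_abs]
            gcongr
            exact Nat.lt_succ_iff.1 j.2
        _ = (2 * ∑ j, |c j|) * ‖μ‖ ^ m := by rw [← Finset.sum_mul]; ring
        _ ≤ ‖μ‖ * ‖μ‖ ^ m := by gcongr; linarith
        _ = ‖μ‖ ^ (m + 1) := by ring
    have h3 : ‖μ‖ ^ m ≤ 2 * ‖p μ‖ := by
      have h4 := norm_sub_le_norm_add (μ ^ m) (∑ j : Fin m, (c j : ℂ) * μ ^ (j : ℕ))
      rw [norm_pow] at h4
      simp only [hp]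
      linarith
    calc ‖μ‖ ^ q ≤ ‖μ‖ ^ m := by gcongr
      _ ≤ 2 * ‖p μ‖ := h3
      _ ≤ _ := by gcongr; exact le_max_left _ _

theorem cmulVec_matAo {r : ℕ} [NeZero r] (δc : Fin r → ℝ) (h : ℝ) (x : Fin r → ℂ) (s : Fin r) :
    cmulVec (matAo δc h) x s = -((vecBo δc h s : ℂ) * x 0) +
      (if hs : (s : ℕ) + 1 < r then x ⟨s + 1, hs⟩ else 0) := by
  simp only [cmulVec, matAo, Matrix.mulVec, dotProduct, Matrix.map_apply, Matrix.of_apply,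
    map_add, add_mul, Finset.sum_add_distrib]
  congr 1
  · rw [Finset.sum_eq_single 0]
    · simp
    · intro j _ hj
      simp [hj]
    · simp
  · split_ifs with h
    · rw [Finset.sum_eq_single ⟨s + 1, h⟩]
      · simp
      · intro j _ hj
        have : (j : ℕ) ≠ s + 1 := fun h' => hj (Fin.ext h')
        simp [this]
      · simp
    · refine Finset.sum_eq_zero fun j _ => ?_
      have : (j : ℕ) ≠ s + 1 := by omega
      simp [this]

/-- The companion matrix of the compensator is Hurwitz. -/
theorem IsStableMonic.isHurwitz_matAo {r : ℕ} {δc : Fin r → ℝ} (hδ : IsStableMonic δc) :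
    IsHurwitz (matAo δc 1) := by
  rw [isHurwitz_iff]
  intro μ x hμ hx
  rcases r with _ | r
  · exact Subsingleton.elim _ _
  have hrow : ∀ s : Fin (r + 1), μ * x s = -((δc s.rev : ℂ) * x 0) +
      (if h : (s : ℕ) + 1 < r + 1 then x ⟨s + 1, h⟩ else 0) := by
    intro s
    have h1 := congrFun hx s
    rw [cmulVec_matAo] at h1
    simpa [vecBo] using h1.symm
  -- The rows are solved from the top: the component `k` is the Horner truncation of the polynomial
  -- at `μ`, times `x 0`. The last row then says that the full polynomial at `μ` annihilates `x 0`.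
  -- The coefficients appear reversed because the first column lists `δ` from the top degree down.
  have hex : ∀ k (hk : k < r + 1), x ⟨k, hk⟩ =
      (μ ^ k + ∑ j ∈ Finset.range k, (δc (Fin.rev (Fin.ofNat (r + 1) j)) : ℂ) * μ ^ (k - 1 - j))
        * x 0 := by
    intro k
    induction k with
    | zero => intro hk; simp
    | succ k ih =>
      intro hk
      have h1 := hrow ⟨k, by omega⟩
      rw [dif_pos (by simpa using hk), ih (by omega)] at h1
      have h2 : Fin.ofNat (r + 1) k = ⟨k, by omega⟩ := by
        ext
        simp [Nat.mod_eq_of_lt (show k < r + 1 by omega)]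
      have h3 : ∑ j ∈ Finset.range k, (δc (Fin.rev (Fin.ofNat (r + 1) j)) : ℂ) * μ ^ (k - j) =
          μ * ∑ j ∈ Finset.range k, (δc (Fin.rev (Fin.ofNat (r + 1) j)) : ℂ) * μ ^ (k - 1 - j) := by
        rw [Finset.mul_sum]
        refine Finset.sum_congr rfl fun j hj => ?_
        have : k - j = (k - 1 - j) + 1 := by have := Finset.mem_range.1 hj; omega
        rw [this]
        ring
      rw [Finset.sum_range_succ, h2]
      simp only [Nat.add_sub_cancel, Nat.sub_self, pow_zero, mul_one]
      rw [h3]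
      linear_combination -h1
  have hx0 : x 0 = 0 := by
    have h1 := hrow (Fin.last r)
    rw [dif_neg (by simp)] at h1
    have h2 := hex r (by omega)
    have h3 : (⟨r, by omega⟩ : Fin (r + 1)) = Fin.last r := rfl
    rw [h3] at h2
    rw [h2] at h1
    by_contra h0
    have h4 : μ ^ (r + 1) + ∑ j : Fin (r + 1), (δc j : ℂ) * μ ^ (j : ℕ) = 0 := by
      have h5 : ∑ j : Fin (r + 1), (δc j : ℂ) * μ ^ (j : ℕ) =
          ∑ j ∈ Finset.range (r + 1), (δc (Fin.rev (Fin.ofNat (r + 1) j)) : ℂ) * μ ^ (r - j) := by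
        rw [Finset.sum_range, ← Equiv.sum_comp Fin.revPerm]
        refine Finset.sum_congr rfl fun j _ => ?_
        simp [Fin.val_rev]
      rw [h5, Finset.sum_range_succ]
      have h3 : ∑ j ∈ Finset.range r, (δc (Fin.rev (Fin.ofNat (r + 1) j)) : ℂ) * μ ^ (r - j) =
          μ * ∑ j ∈ Finset.range r, (δc (Fin.rev (Fin.ofNat (r + 1) j)) : ℂ) * μ ^ (r - 1 - j) := by
        rw [Finset.mul_sum]
        refine Finset.sum_congr rfl fun j hj => ?_
        have : r - j = (r - 1 - j) + 1 := by have := Finset.mem_range.1 hj; omega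
        rw [this]
        ring
      have h6 : Fin.ofNat (r + 1) r = Fin.last r := by ext; simp
      rw [h3, h6]
      refine mul_right_cancel₀ h0 ?_
      simp only [Nat.sub_self, pow_zero, mul_one]
      linear_combination h1
    exact absurd (hδ μ h4) (not_lt.2 hμ)
  funext k
  rw [show k = ⟨k, k.2⟩ from rfl, hex k k.2, hx0, mul_zero]
  rfl

end StablePoly

/-! ### The rows of `A_c` -/

section Rows

theorem sum_blockDiagonal'_mul {N : ℕ} {m n : Fin N → Type*} [∀ i, Fintype (n i)]
    {R : Type*} [CommRing R] [Algebra ℝ R]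
    (B : (i : Fin N) → Matrix (m i) (n i) ℝ) (x : ((i : Fin N) × n i) → R) (i : Fin N) (a : m i) :
    ∑ q, algebraMap ℝ R (Matrix.blockDiagonal' B ⟨i, a⟩ q) * x q =
      ∑ a', algebraMap ℝ R (B i a a') * x ⟨i, a'⟩ := by
  rw [Fintype.sum_sigma, Finset.sum_eq_single i]
  · simp [Matrix.blockDiagonal'_apply_eq]
  · intro j _ hj
    refine Finset.sum_eq_zero fun a' _ => ?_
    rw [Matrix.blockDiagonal'_apply_ne _ _ _ hj.symm, map_zero, zero_mul]
  · simp

variable {N nv r l : ℕ} {d : Fin N → ℕ} {R : Type*} [CommRing R] [Algebra ℝ R]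

/-- The control input as a linear function of `(η_i, ζ_i)`. -/
def inputOf (c : Controller r l) (η : Fin l → R) (ζ : Fin r → R) : R :=
  ∑ j, algebraMap ℝ R (rowGammaTinv c.T j) * η j -
    algebraMap ℝ R c.K * ∑ s, algebraMap ℝ R (rowOmega c.γ s) * ζ s

variable (G : Digraph (Fin (N + 1))) (c : Controller r l) (p : PlantParam N nv r d)
  (X : LoopIdx N r l d → R)

/-- The row formulas are stated over an `ℝ`-algebra `R` to serve twice: with `R = ℂ` for the modes
of `A_c`, and with `R = ℝ` to match `A_c` with the closed-loop vector field. -/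
theorem matAc_row_z [NeZero r] (i : Fin N) (a : Fin (d i)) :
    ((matAc G c p).map (algebraMap ℝ R)).mulVec X (Sum.inl (Sum.inl ⟨i, a⟩)) =
      ∑ a', algebraMap ℝ R (coefA1 p i a a') * X (Sum.inl (Sum.inl ⟨i, a'⟩)) +
        algebraMap ℝ R (coefA2 p i a) * X (Sum.inl (Sum.inr ⟨i, 0⟩)) := by
  simp only [Matrix.mulVec, dotProduct, Matrix.map_apply, matAc, Fintype.sum_sum_type,
    Matrix.fromBlocks_apply₁₁, Matrix.fromBlocks_apply₁₂, Matrix.zero_apply, map_zero, zero_mul,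
    Finset.sum_const_zero, add_zero, blockA1, blockA2]
  rw [sum_blockDiagonal'_mul _ (fun q => X (Sum.inl (Sum.inl q))),
    sum_blockDiagonal'_mul _ (fun q => X (Sum.inl (Sum.inr q)))]
  congr 1
  rw [Finset.sum_eq_single 0]
  · simp
  · intro s _ hs
    simp [hs]
  · simp

theorem matAc_row_xi (i : Fin N) (s : Fin r) :
    ((matAc G c p).map (algebraMap ℝ R)).mulVec X (Sum.inl (Sum.inr ⟨i, s⟩)) =
      if h : (s : ℕ) + 1 < r then X (Sum.inl (Sum.inr ⟨i, ⟨s + 1, h⟩⟩))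
      else ∑ a', algebraMap ℝ R (coefA3 p i a') * X (Sum.inl (Sum.inl ⟨i, a'⟩)) +
        ∑ s', algebraMap ℝ R (coefC p i s') * X (Sum.inl (Sum.inr ⟨i, s'⟩)) +
        algebraMap ℝ R (coefB p i) * inputOf c (fun j => X (Sum.inr (Sum.inl ⟨i, j⟩)))
          (fun s' => X (Sum.inr (Sum.inr ⟨i, s'⟩))) := by
  simp only [Matrix.mulVec, dotProduct, Matrix.map_apply, matAc, Fintype.sum_sum_type,
    Matrix.fromBlocks_apply₁₁, Matrix.fromBlocks_apply₁₂, Matrix.fromBlocks_apply₂₁,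
    Matrix.fromBlocks_apply₂₂, blockA4, blockA5, blockA6, blockA7]
  rw [sum_blockDiagonal'_mul _ (fun q => X (Sum.inl (Sum.inl q))),
    sum_blockDiagonal'_mul _ (fun q => X (Sum.inl (Sum.inr q))),
    sum_blockDiagonal'_mul _ (fun q => X (Sum.inr (Sum.inl q))),
    sum_blockDiagonal'_mul _ (fun q => X (Sum.inr (Sum.inr q)))]
  split_ifs with h
  · have h1 : (s : ℕ) + 1 ≠ r := h.ne
    simp only [Matrix.of_apply, h1, if_false, map_zero, zero_mul, Finset.sum_const_zero, zero_add,
      Matrix.vecMulVec_apply, vecB0, Matrix.neg_apply, neg_zero, add_zero]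
    rw [Finset.sum_eq_single ⟨s + 1, h⟩]
    · simp
    · intro s' _ hs'
      have : (s' : ℕ) ≠ s + 1 := fun h => hs' (Fin.ext h)
      simp [this]
    · simp
  · have h1 : (s : ℕ) + 1 = r := by omega
    simp only [Matrix.of_apply, h1, if_true, Matrix.vecMulVec_apply, vecB0, Matrix.neg_apply,
      inputOf, Pi.smul_apply, smul_eq_mul, map_neg, map_mul, neg_mul, Finset.sum_neg_distrib,
      mul_sub, Finset.mul_sum, mul_assoc]
    ring

theorem matAc_row_eta (i : Fin N) (j : Fin l) :
    ((matAc G c p).map (algebraMap ℝ R)).mulVec X (Sum.inr (Sum.inl ⟨i, j⟩)) =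
      ∑ j', algebraMap ℝ R (c.M j j') * X (Sum.inr (Sum.inl ⟨i, j'⟩)) +
        algebraMap ℝ R (c.Q j) * inputOf c (fun j => X (Sum.inr (Sum.inl ⟨i, j⟩)))
          (fun s' => X (Sum.inr (Sum.inr ⟨i, s'⟩))) := by
  simp only [Matrix.mulVec, dotProduct, Matrix.map_apply, matAc, Fintype.sum_sum_type,
    Matrix.fromBlocks_apply₂₁, Matrix.fromBlocks_apply₁₂, Matrix.fromBlocks_apply₁₁,
    Matrix.fromBlocks_apply₂₂, Matrix.zero_apply, map_zero, zero_mul, Finset.sum_const_zero,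
    zero_add, blockA8, blockA9]
  rw [sum_blockDiagonal'_mul _ (fun q => X (Sum.inr (Sum.inl q))),
    sum_blockDiagonal'_mul _ (fun q => X (Sum.inr (Sum.inr q)))]
  simp only [Matrix.add_apply, Matrix.vecMulVec_apply, Matrix.neg_apply,
    inputOf, Pi.smul_apply, smul_eq_mul, map_neg, map_mul, map_add, neg_mul, add_mul,
    Finset.sum_neg_distrib, Finset.sum_add_distrib, mul_sub, Finset.mul_sum, mul_assoc]
  ring

theorem matAc_row_zeta [NeZero r] (i : Fin N) (s : Fin r) :
    ((matAc G c p).map (algebraMap ℝ R)).mulVec X (Sum.inr (Sum.inr ⟨i, s⟩)) =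
      ∑ s', algebraMap ℝ R (matAo c.δc c.h s s') * X (Sum.inr (Sum.inr ⟨i, s'⟩)) +
        algebraMap ℝ R (vecBo c.δc c.h s) * ∑ j, algebraMap ℝ R (graphH G i j) * X (Sum.inl (Sum.inr ⟨j, 0⟩)) := by
  simp only [Matrix.mulVec, dotProduct, Matrix.map_apply, matAc, Fintype.sum_sum_type,
    Matrix.fromBlocks_apply₂₁, Matrix.fromBlocks_apply₂₂, Matrix.zero_apply, map_zero, zero_mul,
    Finset.sum_const_zero, zero_add, blockA11, blockA12, Matrix.of_apply]
  rw [sum_blockDiagonal'_mul _ (fun q => X (Sum.inr (Sum.inr q))), add_comm]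
  congr 1
  rw [Fintype.sum_sigma, Finset.mul_sum]
  refine Finset.sum_congr rfl fun j _ => ?_
  rw [Finset.sum_eq_single 0]
  · simp
    ring
  · intro s _ hs
    simp [hs]
  · simp

end Rows

/-! ### Modes of the closed loop in the closed right half plane -/

section Modes

/-- On a mode, differentiation is multiplication by `μ`, so the integrator chain is determined by
its output. -/
theorem chain_eq_pow_mul {r : ℕ} [NeZero r] {μ : ℂ} {ξ : Fin r → ℂ}
    (h : ∀ (s : Fin r) (hs : (s : ℕ) + 1 < r), μ * ξ s = ξ ⟨s + 1, hs⟩) (s : Fin r) :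
    ξ s = μ ^ (s : ℕ) * ξ 0 := by
  obtain ⟨k, hk⟩ := s
  induction k with
  | zero => simp only [pow_zero, one_mul]; rfl
  | succ k ih => rw [← h ⟨k, by omega⟩ hk, ih]; ring

theorem sum_rowOmega_mul {r : ℕ} [NeZero r] (γ : Fin (r - 1) → ℝ) (x : Fin r → ℂ) :
    ∑ s, (rowOmega γ s : ℂ) * x s =
      ∑ j : Fin (r - 1), (γ j : ℂ) * x ⟨j, by omega⟩ +
        x ⟨r - 1, Nat.sub_lt (NeZero.pos r) one_pos⟩ := by
  rcases r with _ | r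
  · exact absurd rfl (NeZero.ne 0)
  rw [Fin.sum_univ_castSucc]
  congr 1
  · refine Finset.sum_congr rfl fun j _ => ?_
    have h : rowOmega γ j.castSucc = γ j := by simp [rowOmega]
    rw [h]
    rfl
  · simp [rowOmega]
    rfl

/-- The observer error is of order `1 / h`. -/
theorem norm_le_of_observer_mode {r : ℕ} [NeZero r] {δc : Fin r → ℝ} {c₀ h : ℝ} (hc₀ : 0 ≤ c₀)
    (hh : 1 ≤ h)
    (hAo : ∀ μ : ℂ, 0 ≤ μ.re → ∀ y : Fin r → ℂ, ‖y‖ ≤ c₀ * ‖μ • y - cmulVec (matAo δc 1) y‖)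
    {μ : ℂ} (hμ : 0 ≤ μ.re) {ε : Fin r → ℂ} {Y : ℂ}
    (hε : ∀ s, μ * ε s = cmulVec (matAo δc h) ε s + if (s : ℕ) + 1 = r then Y else 0) :
    ‖ε‖ ≤ c₀ / h * ‖Y‖ := by
  have hh0 : 0 < h := by linarith
  have hhc : (h : ℂ) ≠ 0 := by exact_mod_cast hh0.ne'
  -- The high-gain scaling: in these coordinates `A_o(h)` becomes `h A_o(1)`, and the forcing of the
  -- last component is damped to `h⁻ʳ Y`. Undoing the scaling costs at most `h ^ (r - 1)`, which
  -- leaves the factor `1 / h`.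
  set y : Fin r → ℂ := fun s => ((h : ℂ) ^ (s : ℕ))⁻¹ * ε s with hy
  have h1 : ‖(μ / h) • y - cmulVec (matAo δc 1) y‖ ≤ (h ^ r)⁻¹ * ‖Y‖ := by
    refine (pi_norm_le_iff_of_nonneg (by positivity)).2 fun s => ?_
    have h2 := hε s
    rw [cmulVec_matAo] at h2
    have h3 : ((μ / h) • y - cmulVec (matAo δc 1) y) s =
        ((h : ℂ) ^ ((s : ℕ) + 1))⁻¹ * if (s : ℕ) + 1 = r then Y else 0 := by
      rw [← sub_eq_iff_eq_add'] at h2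
      rw [← h2, Pi.sub_apply, cmulVec_matAo]
      simp only [hy, Pi.smul_apply, smul_eq_mul, vecBo, one_pow, one_mul]
      by_cases hs : (s : ℕ) + 1 < r
      · simp only [hs, dif_pos]
        push_cast
        simp only [Fin.val_zero]
        field_simp
        ring
      · simp only [hs, dif_neg, not_false_eq_true]
        push_cast
        simp only [Fin.val_zero]
        field_simp
        ring
    rw [h3]
    split_ifs with hs
    · rw [hs, norm_mul, norm_inv, norm_pow, Complex.norm_real, Real.norm_of_nonneg hh0.le]
    · simp only [mul_zero, norm_zero]
      positivity
  have h2 := hAo (μ / h) (by rw [Complex.div_ofReal_re]; positivity) y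
  refine (pi_norm_le_iff_of_nonneg (by positivity)).2 fun s => ?_
  have h3 : ε s = (h : ℂ) ^ (s : ℕ) * y s := by
    simp only [hy]
    field_simp
  rw [h3, norm_mul, norm_pow, Complex.norm_real, Real.norm_of_nonneg hh0.le]
  have h4 : h ^ (s : ℕ) ≤ h ^ (r - 1) := by
    gcongr
    have := s.2
    omega
  have h5 : h ^ (r - 1) * (h ^ r)⁻¹ = h⁻¹ := by
    have : r = (r - 1) + 1 := by have := NeZero.pos r; omega
    rw [this, pow_succ]
    simp only [Nat.add_sub_cancel]
    field_simp
  calc h ^ (s : ℕ) * ‖y s‖ ≤ h ^ (r - 1) * (c₀ * ((h ^ r)⁻¹ * ‖Y‖)) := by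
        gcongr
        exact (norm_le_pi_norm y s).trans (h2.trans (by gcongr))
    _ = c₀ * (h ^ (r - 1) * (h ^ r)⁻¹) * ‖Y‖ := by ring
    _ = c₀ / h * ‖Y‖ := by rw [h5]; ring

variable {N nv r l : ℕ} {d : Fin N → ℕ}

/-- Bounds that make the high gain design work: `c₀` bounds the data of the loop and the resolvents
of its Hurwitz blocks. -/
structure LoopBounds [NeZero r] (G : Digraph (Fin (N + 1))) (c : Controller r l)
    (p : PlantParam N nv r d) (c₀ : ℝ) : Prop where
  one_le : 1 ≤ c₀
  resolventA1 : ∀ i, ∀ μ : ℂ, 0 ≤ μ.re → ∀ y : Fin (d i) → ℂ,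
    ‖y‖ ≤ c₀ * ‖μ • y - cmulVec (coefA1 p i) y‖
  resolventM : ∀ μ : ℂ, 0 ≤ μ.re → ∀ y : Fin l → ℂ, ‖y‖ ≤ c₀ * ‖μ • y - cmulVec c.M y‖
  resolventH : ∀ μ : ℂ, 0 ≤ μ.re → ∀ y : Fin N → ℂ,
    ‖y‖ ≤ c₀ * ‖μ • y - cmulVec (-(Matrix.diagonal (coefB p) * graphH G)) y‖
  resolventAo : ∀ μ : ℂ, 0 ≤ μ.re → ∀ y : Fin r → ℂ,
    ‖y‖ ≤ c₀ * ‖μ • y - cmulVec (matAo c.δc 1) y‖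
  powγ : ∀ μ : ℂ, 0 ≤ μ.re → ∀ q ≤ r - 1,
    ‖μ‖ ^ q ≤ c₀ * ‖μ ^ (r - 1) + ∑ j : Fin (r - 1), (c.γ j : ℂ) * μ ^ (j : ℕ)‖
  coefB_pos : ∀ i, 0 < coefB p i
  coefB_le : ∀ i, coefB p i ≤ c₀
  coefB_inv_le : ∀ i, (coefB p i)⁻¹ ≤ c₀
  coefA2_le : ∀ i a, |coefA2 p i a| ≤ c₀
  coefA3_le : ∀ i, ∑ a, |coefA3 p i a| ≤ c₀
  coefC_le : ∀ i, ∑ s, |coefC p i s| ≤ c₀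
  graphH_le : ∀ i, ∑ j, |graphH G i j| ≤ c₀
  gammaTinv_le : ∑ j, |rowGammaTinv c.T j| ≤ c₀
  omega_le : ∑ s, |rowOmega c.γ s| ≤ c₀
  γ_le : ∑ j, |c.γ j| ≤ c₀
  Q_le : ∀ j, |c.Q j| ≤ c₀
  MQ_le : ∀ j, |c.M.mulVec c.Q j| ≤ c₀

theorem norm_sum_ofReal_mul_le {n : Type*} [Fintype n] {a : n → ℝ} {x : n → ℂ} {c₀ B : ℝ}
    (ha : ∑ j, |a j| ≤ c₀) (hB : 0 ≤ B) (hx : ∀ j, ‖x j‖ ≤ B) :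
    ‖∑ j, (a j : ℂ) * x j‖ ≤ c₀ * B := by
  calc ‖∑ j, (a j : ℂ) * x j‖ ≤ ∑ j, |a j| * B := by
        refine norm_sum_le_of_le _ fun j _ => ?_
        rw [norm_mul, Complex.norm_real, Real.norm_eq_abs]
        gcongr
        exact hx j
    _ = (∑ j, |a j|) * B := by rw [Finset.sum_mul]
    _ ≤ c₀ * B := by gcongr

/-- The gain `K` above which the state feedback is stabilizing. -/
def gainK (c₀ : ℝ) : ℝ := 16 * c₀ ^ 10

/-- The gain `h` above which the observer is fast enough. -/
def gainH (c₀ K : ℝ) : ℝ := c₀ ^ 2 * (16 * c₀ ^ 12 + 3 * K * c₀ ^ 7) + 1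

/-- One agent of a mode `μ` of the closed loop: the state is controlled by `ϑ = Ω ξ`, up to the
observer error. -/
theorem LoopBounds.agent_mode_bounds [NeZero r] {G : Digraph (Fin (N + 1))} {c : Controller r l}
    {p : PlantParam N nv r d} {c₀ : ℝ} (hB : LoopBounds G c p c₀) {μ : ℂ} (hμ : 0 ≤ μ.re)
    {i : Fin N} {z : Fin (d i) → ℂ} {ξ : Fin r → ℂ} {η : Fin l → ℂ} {u : ℂ} {m : ℝ}
    (hz : ∀ a, μ * z a = cmulVec (coefA1 p i) z a + (coefA2 p i a : ℂ) * ξ 0)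
    (hξ : ∀ (s : Fin r) (hs : (s : ℕ) + 1 < r), μ * ξ s = ξ ⟨s + 1, hs⟩)
    (hξr : μ * ξ ⟨r - 1, Nat.sub_lt (NeZero.pos r) one_pos⟩ = ∑ a, (coefA3 p i a : ℂ) * z a +
      ∑ s, (coefC p i s : ℂ) * ξ s + (coefB p i : ℂ) * u)
    (hη : ∀ j, μ * η j = cmulVec c.M η j + (c.Q j : ℂ) * u)
    (hm : ‖∑ s, (rowOmega c.γ s : ℂ) * ξ s‖ ≤ m) :
    (∀ s, ‖ξ s‖ ≤ c₀ * m) ∧ ‖z‖ ≤ c₀ ^ 3 * m ∧ ‖η‖ ≤ 5 * c₀ ^ 7 * m ∧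
      ∃ κ : ℂ, ‖κ‖ ≤ 3 * c₀ ^ 4 * m ∧
        μ * ∑ s, (rowOmega c.γ s : ℂ) * ξ s = κ + (coefB p i : ℂ) * u := by
  have hc := hB.one_le
  have hc0 : 0 ≤ c₀ := by linarith
  have hm0 : 0 ≤ m := (norm_nonneg _).trans hm
  set ϑ : ℂ := ∑ s, (rowOmega c.γ s : ℂ) * ξ s with hϑ
  have hξ1 : ∀ s, ‖ξ s‖ ≤ c₀ * m := by
    intro s
    -- Along the chain `Ω ξ` is the stable polynomial with coefficients `γ` at `μ`, times the
    -- output; `powγ` therefore bounds every `ξ s` by `ϑ`.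
    have h1 : ϑ = (μ ^ (r - 1) + ∑ j : Fin (r - 1), (c.γ j : ℂ) * μ ^ (j : ℕ)) * ξ 0 := by
      rw [hϑ, sum_rowOmega_mul, chain_eq_pow_mul hξ ⟨r - 1, _⟩, add_mul, add_comm, Finset.sum_mul]
      congr 1
      refine Finset.sum_congr rfl fun j _ => ?_
      rw [chain_eq_pow_mul hξ ⟨j, _⟩, mul_assoc]
    rw [chain_eq_pow_mul hξ s, norm_mul, norm_pow]
    have h2 := hB.powγ μ hμ s (by have := s.2; omega)
    calc ‖μ‖ ^ (s : ℕ) * ‖ξ 0‖ ≤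
        (c₀ * ‖μ ^ (r - 1) + ∑ j : Fin (r - 1), (c.γ j : ℂ) * μ ^ (j : ℕ)‖) * ‖ξ 0‖ := by gcongr
      _ = c₀ * ‖ϑ‖ := by rw [h1, norm_mul]; ring
      _ ≤ c₀ * m := by gcongr
  have hz1 : ‖z‖ ≤ c₀ ^ 3 * m := by
    have h1 : ‖μ • z - cmulVec (coefA1 p i) z‖ ≤ c₀ * (c₀ * m) := by
      refine (pi_norm_le_iff_of_nonneg (by positivity)).2 fun a => ?_
      rw [Pi.sub_apply, Pi.smul_apply, smul_eq_mul, hz a, add_sub_cancel_left, norm_mul,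
        Complex.norm_real, Real.norm_eq_abs]
      gcongr
      · exact hB.coefA2_le i a
      · exact hξ1 0
    calc ‖z‖ ≤ c₀ * ‖μ • z - cmulVec (coefA1 p i) z‖ := hB.resolventA1 i μ hμ z
      _ ≤ c₀ * (c₀ * (c₀ * m)) := by gcongr
      _ = c₀ ^ 3 * m := by ring
  have hp : ∀ a b : ℕ, a ≤ b → c₀ ^ a ≤ c₀ ^ b := fun a b hab => pow_le_pow_right₀ hc hab
  -- `κ` is the drift of `ϑ`: all of `μ ϑ` except the input term.
  set κ : ℂ := ∑ j : Fin (r - 1), (c.γ j : ℂ) * ξ ⟨j + 1, by omega⟩ +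
    (∑ a, (coefA3 p i a : ℂ) * z a + ∑ s, (coefC p i s : ℂ) * ξ s) with hκ
  have hκ1 : ‖κ‖ ≤ 3 * c₀ ^ 4 * m := by
    have h1 : ‖∑ j : Fin (r - 1), (c.γ j : ℂ) * ξ ⟨j + 1, by omega⟩‖ ≤ c₀ * (c₀ * m) :=
      norm_sum_ofReal_mul_le hB.γ_le (by positivity) fun j => hξ1 _
    have h2 : ‖∑ a, (coefA3 p i a : ℂ) * z a‖ ≤ c₀ * (c₀ ^ 3 * m) :=
      norm_sum_ofReal_mul_le (hB.coefA3_le i) (by positivity)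
        fun a => (norm_le_pi_norm z a).trans hz1
    have h3 : ‖∑ s, (coefC p i s : ℂ) * ξ s‖ ≤ c₀ * (c₀ * m) :=
      norm_sum_ofReal_mul_le (hB.coefC_le i) (by positivity) hξ1
    have h4 : c₀ ^ 2 * m ≤ c₀ ^ 4 * m := by gcongr; norm_num
    calc ‖κ‖ ≤ _ := (norm_add_le _ _).trans (add_le_add_right (norm_add_le _ _) _)
      _ ≤ c₀ * (c₀ * m) + (c₀ * (c₀ ^ 3 * m) + c₀ * (c₀ * m)) := by gcongr
      _ ≤ 3 * c₀ ^ 4 * m := by nlinarith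
  have hκ2 : μ * ϑ = κ + (coefB p i : ℂ) * u := by
    rw [hϑ, sum_rowOmega_mul, mul_add, hξr, hκ, Finset.mul_sum]
    have : ∀ j : Fin (r - 1), μ * ((c.γ j : ℂ) * ξ ⟨j, by omega⟩) =
        (c.γ j : ℂ) * ξ ⟨j + 1, by omega⟩ := by
      intro j
      rw [← hξ ⟨j, by omega⟩ (by simp; omega)]
      ring
    simp only [this]
    ring
  refine ⟨hξ1, hz1, ?_, κ, hκ1, hκ2⟩
  have hb := hB.coefB_pos i
  have hbc : (coefB p i : ℂ) ≠ 0 := by exact_mod_cast hb.ne'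
  -- This change of variable removes the input from the internal model. Since `b u = μ ϑ - κ`, the
  -- new variable obeys `μ y = M y + b⁻¹ (ϑ M Q - κ Q)`, which contains neither `u` nor the gain
  -- `K`.
  set y : Fin l → ℂ := fun j => η j - (coefB p i : ℂ)⁻¹ * ϑ * c.Q j with hy
  have hbn : ‖(coefB p i : ℂ)⁻¹‖ ≤ c₀ := by
    rw [norm_inv, Complex.norm_real, Real.norm_of_nonneg hb.le]
    exact hB.coefB_inv_le i
  have h1 : ‖μ • y - cmulVec c.M y‖ ≤ c₀ * (m * c₀ + 3 * c₀ ^ 4 * m * c₀) := by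
    refine (pi_norm_le_iff_of_nonneg (by positivity)).2 fun j => ?_
    have h2 : cmulVec c.M y j = cmulVec c.M η j -
        (coefB p i : ℂ)⁻¹ * ϑ * (c.M.mulVec c.Q j : ℝ) := by
      simp only [cmulVec, Matrix.mulVec, dotProduct, Matrix.map_apply, hy, mul_sub,
        Finset.sum_sub_distrib, Complex.coe_algebraMap]
      congr 1
      generalize ϑ = t
      push_cast
      rw [Finset.mul_sum]
      exact Finset.sum_congr rfl fun _ _ => by ring
    have h3 : (μ • y - cmulVec c.M y) j =
        (coefB p i : ℂ)⁻¹ * (ϑ * (c.M.mulVec c.Q j : ℝ) - κ * c.Q j) := by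
      rw [Pi.sub_apply, Pi.smul_apply, smul_eq_mul, h2]
      simp only [hy]
      have h4 := hη j
      field_simp
      linear_combination (coefB p i : ℂ) * h4 - (c.Q j : ℂ) * hκ2
    rw [h3, norm_mul]
    refine mul_le_mul hbn ((norm_sub_le _ _).trans ?_) (norm_nonneg _) hc0
    rw [norm_mul, norm_mul, Complex.norm_real, Complex.norm_real, Real.norm_eq_abs,
      Real.norm_eq_abs]
    gcongr
    · exact hB.MQ_le j
    · exact hB.Q_le j
  have h2 : ‖y‖ ≤ c₀ * (c₀ * (m * c₀ + 3 * c₀ ^ 4 * m * c₀)) :=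
    (hB.resolventM μ hμ y).trans (by gcongr)
  refine (pi_norm_le_iff_of_nonneg (by positivity)).2 fun j => ?_
  have h3 : η j = y j + (coefB p i : ℂ)⁻¹ * ϑ * c.Q j := by simp [hy]
  rw [h3]
  calc ‖y j + (coefB p i : ℂ)⁻¹ * ϑ * c.Q j‖
      ≤ ‖y j‖ + ‖(coefB p i : ℂ)⁻¹ * ϑ * c.Q j‖ := norm_add_le _ _
    _ ≤ c₀ * (c₀ * (m * c₀ + 3 * c₀ ^ 4 * m * c₀)) + c₀ * m * c₀ := by
        refine add_le_add ((norm_le_pi_norm y j).trans h2) ?_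
        rw [norm_mul, norm_mul, Complex.norm_real (c.Q j), Real.norm_eq_abs]
        gcongr
        exact hB.Q_le j
    _ = (c₀ ^ 3 + 3 * c₀ ^ 7 + c₀ ^ 2) * m := by ring
    _ ≤ (c₀ ^ 7 + 3 * c₀ ^ 7 + c₀ ^ 7) * m := by
        gcongr ?_ * m
        have := hp 3 7 (by norm_num)
        have := hp 2 7 (by norm_num)
        linarith
    _ = 5 * c₀ ^ 7 * m := by ring


/-- Small gain on one mode with `Re μ ≥ 0`: the consensus loop gives `m ≤ 2 c₀³ E`, the observer
gives `E ≤ q E` with `q < 1`, so `E = 0`, then `m = 0`, and every component is bounded by `m` and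
`E`. -/
theorem LoopBounds.isHurwitz_matAc [NeZero r] {G : Digraph (Fin (N + 1))} {c : Controller r l}
    {p : PlantParam N nv r d} {c₀ : ℝ} (hB : LoopBounds G c p c₀) (hK : gainK c₀ < c.K)
    (hh : gainH c₀ c.K < c.h) : IsHurwitz (matAc G c p) := by
  rw [isHurwitz_iff]
  intro μ X hμ hX
  have hc := hB.one_le
  have hc0 : 0 < c₀ := by linarith
  have hK0 : 0 < c.K := lt_of_le_of_lt (by unfold gainK; positivity) hK
  have hh1 : 1 < c.h := lt_of_le_of_lt (by
    unfold gainH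
    have : 0 ≤ c₀ ^ 2 * (16 * c₀ ^ 12 + 3 * c.K * c₀ ^ 7) := by positivity
    linarith) hh
  set z : (i : Fin N) → Fin (d i) → ℂ := fun i a => X (Sum.inl (Sum.inl ⟨i, a⟩)) with hz
  set ξ : Fin N → Fin r → ℂ := fun i s => X (Sum.inl (Sum.inr ⟨i, s⟩)) with hξ
  set η : Fin N → Fin l → ℂ := fun i j => X (Sum.inr (Sum.inl ⟨i, j⟩)) with hη
  set ζ : Fin N → Fin r → ℂ := fun i s => X (Sum.inr (Sum.inr ⟨i, s⟩)) with hζ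
  set u : Fin N → ℂ := fun i => inputOf c (η i) (ζ i) with hu
  set last : Fin r := ⟨r - 1, Nat.sub_lt (NeZero.pos r) one_pos⟩ with hlast
  have hlast1 : (last : ℕ) + 1 = r := by have := NeZero.pos r; simp only [hlast]; omega
  have ez : ∀ i a, μ * z i a = cmulVec (coefA1 p i) (z i) a + (coefA2 p i a : ℂ) * ξ i 0 := by
    intro i a
    exact (congrFun hX _).symm.trans (matAc_row_z (R := ℂ) G c p X i a)
  have eξ : ∀ i (s : Fin r) (hs : (s : ℕ) + 1 < r), μ * ξ i s = ξ i ⟨s + 1, hs⟩ := by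
    intro i s hs
    refine (congrFun hX _).symm.trans ((matAc_row_xi (R := ℂ) G c p X i s).trans ?_)
    rw [dif_pos hs]
  have eξr : ∀ i, μ * ξ i last = ∑ a, (coefA3 p i a : ℂ) * z i a +
      ∑ s, (coefC p i s : ℂ) * ξ i s + (coefB p i : ℂ) * u i := by
    intro i
    refine (congrFun hX _).symm.trans ((matAc_row_xi (R := ℂ) G c p X i last).trans ?_)
    rw [dif_neg (by omega)]
    rfl
  have eη : ∀ i j, μ * η i j = cmulVec c.M (η i) j + (c.Q j : ℂ) * u i := by
    intro i j
    exact (congrFun hX _).symm.trans (matAc_row_eta (R := ℂ) G c p X i j)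
  have eζ : ∀ i s, μ * ζ i s = cmulVec (matAo c.δc c.h) (ζ i) s +
      (vecBo c.δc c.h s : ℂ) * ∑ j, (graphH G i j : ℂ) * ξ j 0 := by
    intro i s
    exact (congrFun hX _).symm.trans (matAc_row_zeta (R := ℂ) G c p X i s)
  set ϑ : Fin N → ℂ := fun i => ∑ s, (rowOmega c.γ s : ℂ) * ξ i s with hϑ
  set m : ℝ := ‖ϑ‖ with hm
  have hm0 : 0 ≤ m := norm_nonneg _
  have hag := fun i => hB.agent_mode_bounds hμ (ez i) (eξ i) (eξr i) (eη i) (m := m)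
    (norm_le_pi_norm ϑ i)
  choose hξb hzb hηb κ hκb hκ using hag
  -- the observer error
  set x : Fin N → Fin r → ℂ := fun i s => ∑ j, (graphH G i j : ℂ) * ξ j s with hx
  have hxb : ∀ i s, ‖x i s‖ ≤ c₀ * (c₀ * m) := fun i s =>
    norm_sum_ofReal_mul_le (hB.graphH_le i) (by positivity) fun j => hξb j s
  set ε : Fin N → Fin r → ℂ := fun i s => x i s - ζ i s with hε
  set E : ℝ := ‖ε‖ with hE
  have hE0 : 0 ≤ E := norm_nonneg _
  have hεb : ∀ i s, ‖ε i s‖ ≤ E := fun i s =>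
    (norm_le_pi_norm (ε i) s).trans (norm_le_pi_norm ε i)
  have hζb : ∀ i s, ‖ζ i s‖ ≤ c₀ ^ 2 * m + E := by
    intro i s
    have h1 : ζ i s = x i s - ε i s := by simp [hε]
    rw [h1]
    refine (norm_sub_le _ _).trans (add_le_add ((hxb i s).trans_eq (by ring)) (hεb i s))
  -- the feedback
  set f : Fin N → ℂ := fun i =>
    κ i + (coefB p i : ℂ) * ∑ j, (rowGammaTinv c.T j : ℂ) * η i j with hf
  have hbn : ∀ i, ‖(coefB p i : ℂ)‖ ≤ c₀ := by
    intro i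
    rw [Complex.norm_real, Real.norm_of_nonneg (hB.coefB_pos i).le]
    exact hB.coefB_le i
  have hgη : ∀ i, ‖(coefB p i : ℂ) * ∑ j, (rowGammaTinv c.T j : ℂ) * η i j‖ ≤
      c₀ * (c₀ * (5 * c₀ ^ 7 * m)) := by
    intro i
    rw [norm_mul]
    refine mul_le_mul (hbn i) ?_ (norm_nonneg _) hc0.le
    exact norm_sum_ofReal_mul_le hB.gammaTinv_le (by positivity)
      fun j => (norm_le_pi_norm (η i) j).trans (hηb i)
  have hp : ∀ a b : ℕ, a ≤ b → c₀ ^ a ≤ c₀ ^ b := fun a b hab => pow_le_pow_right₀ hc hab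
  have hfb : ∀ i, ‖f i‖ ≤ 8 * c₀ ^ 9 * m := by
    intro i
    calc ‖f i‖ ≤ 3 * c₀ ^ 4 * m + c₀ * (c₀ * (5 * c₀ ^ 7 * m)) :=
          (norm_add_le _ _).trans (add_le_add (hκb i) (hgη i))
      _ = (3 * c₀ ^ 4 + 5 * c₀ ^ 9) * m := by ring
      _ ≤ (3 * c₀ ^ 9 + 5 * c₀ ^ 9) * m := by
          have := hp 4 9 (by norm_num)
          gcongr
      _ = 8 * c₀ ^ 9 * m := by ring
  -- The compensator estimates `(H ⊗ I) ξ`, so its output under `Ω` is `H ϑ` up to the observer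
  -- error.
  have hΩζ : ∀ i, ∑ s, (rowOmega c.γ s : ℂ) * ζ i s =
      ∑ j, (graphH G i j : ℂ) * ϑ j - ∑ s, (rowOmega c.γ s : ℂ) * ε i s := by
    intro i
    have h1 : ∑ j, (graphH G i j : ℂ) * ϑ j = ∑ s, (rowOmega c.γ s : ℂ) * x i s := by
      simp only [hϑ, hx, Finset.mul_sum]
      rw [Finset.sum_comm]
      exact Finset.sum_congr rfl fun _ _ => Finset.sum_congr rfl fun _ _ => by ring
    rw [h1, ← Finset.sum_sub_distrib]
    refine Finset.sum_congr rfl fun s _ => ?_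
    simp only [hε]
    ring
  -- Dividing `μ ϑ = f - K diag(b) (H ϑ - Ω ε)` by `K` expresses `ϑ` through the resolvent of
  -- `-diag(b) H` at `μ / K`. The term `f / K` contributes at most `8 c₀¹⁰ m / K ≤ m / 2`, which is
  -- where `gainK` comes from, and is absorbed on the left.
  have hmE : m ≤ 2 * c₀ ^ 3 * E := by
    have h1 : ‖(μ / c.K) • ϑ - cmulVec (-(Matrix.diagonal (coefB p) * graphH G)) ϑ‖ ≤
        8 * c₀ ^ 9 * m / c.K + c₀ * (c₀ * E) := by
      refine (pi_norm_le_iff_of_nonneg (by positivity)).2 fun i => ?_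
      have hKc : (c.K : ℂ) ≠ 0 := by exact_mod_cast hK0.ne'
      have h2 : cmulVec (-(Matrix.diagonal (coefB p) * graphH G)) ϑ i =
          -((coefB p i : ℂ) * ∑ j, (graphH G i j : ℂ) * ϑ j) := by
        simp only [cmulVec, Matrix.mulVec, dotProduct, Matrix.map_apply, Matrix.neg_apply,
          Matrix.diagonal_mul, Finset.mul_sum, Complex.coe_algebraMap]
        rw [← Finset.sum_neg_distrib]
        refine Finset.sum_congr rfl fun j _ => ?_
        generalize ϑ j = t
        push_cast
        ring
      have h3 : ((μ / c.K) • ϑ - cmulVec (-(Matrix.diagonal (coefB p) * graphH G)) ϑ) i =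
          f i / c.K + (coefB p i : ℂ) * ∑ s, (rowOmega c.γ s : ℂ) * ε i s := by
        rw [Pi.sub_apply, h2, Pi.smul_apply, smul_eq_mul]
        have h4 : μ * ϑ i = f i - c.K * (coefB p i : ℂ) *
            (∑ j, (graphH G i j : ℂ) * ϑ j - ∑ s, (rowOmega c.γ s : ℂ) * ε i s) := by
          rw [← hΩζ, hκ i]
          simp only [hu, inputOf, hf, Complex.coe_algebraMap]
          ring
        field_simp
        linear_combination h4
      rw [h3]
      refine (norm_add_le _ _).trans (add_le_add ?_ ?_)
      · rw [norm_div, Complex.norm_real, Real.norm_of_nonneg hK0.le]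
        gcongr
        exact hfb i
      · rw [norm_mul]
        refine mul_le_mul (hbn i) ?_ (norm_nonneg _) hc0.le
        exact norm_sum_ofReal_mul_le hB.omega_le hE0 (hεb i)
    have h2 : m ≤ c₀ * (8 * c₀ ^ 9 * m / c.K + c₀ * (c₀ * E)) :=
      (hB.resolventH (μ / c.K) (by rw [Complex.div_ofReal_re]; positivity) ϑ).trans (by gcongr)
    have h3 : c₀ * (8 * c₀ ^ 9 * m / c.K) ≤ m / 2 := by
      rw [mul_div_assoc', div_le_div_iff₀ hK0 two_pos]
      have : gainK c₀ * m ≤ c.K * m := by gcongr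
      unfold gainK at this
      nlinarith
    nlinarith
  -- This is the only signal that drives the observer error, since the compensator copies the chain
  -- except for its last row. With `m` already bounded by `E`, it is bounded by `E` with a factor
  -- independent of `h`.
  have hY : ∀ i, ‖μ * x i last‖ ≤ c₀ * ((16 * c₀ ^ 12 + 3 * c.K * c₀ ^ 7) * E) := by
    intro i
    have h1 : μ * x i last = ∑ j, (graphH G i j : ℂ) * (μ * ξ j last) := by
      simp only [hx, Finset.mul_sum]
      exact Finset.sum_congr rfl fun _ _ => by ring
    rw [h1]
    refine norm_sum_ofReal_mul_le (hB.graphH_le i) (by positivity) fun j => ?_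
    have h2 : μ * ξ j last = (∑ a, (coefA3 p j a : ℂ) * z j a + ∑ s, (coefC p j s : ℂ) * ξ j s +
        (coefB p j : ℂ) * ∑ k, (rowGammaTinv c.T k : ℂ) * η j k) -
        (c.K : ℂ) * ((coefB p j : ℂ) * ∑ s, (rowOmega c.γ s : ℂ) * ζ j s) := by
      rw [eξr j]
      simp only [hu, inputOf, Complex.coe_algebraMap]
      ring
    have h3 : ‖∑ a, (coefA3 p j a : ℂ) * z j a‖ ≤ c₀ * (c₀ ^ 3 * m) :=
      norm_sum_ofReal_mul_le (hB.coefA3_le j) (by positivity)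
        fun a => (norm_le_pi_norm (z j) a).trans (hzb j)
    have h4 : ‖∑ s, (coefC p j s : ℂ) * ξ j s‖ ≤ c₀ * (c₀ * m) :=
      norm_sum_ofReal_mul_le (hB.coefC_le j) (by positivity) (hξb j)
    have h5 : ‖(c.K : ℂ) * ((coefB p j : ℂ) * ∑ s, (rowOmega c.γ s : ℂ) * ζ j s)‖ ≤
        c.K * (c₀ * (c₀ * (c₀ ^ 2 * m + E))) := by
      rw [norm_mul, norm_mul, Complex.norm_real c.K, Real.norm_of_nonneg hK0.le]
      gcongr
      · exact hbn j
      · exact norm_sum_ofReal_mul_le hB.omega_le (by positivity) (hζb j)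
    rw [h2]
    calc _ ≤ (c₀ * (c₀ ^ 3 * m) + c₀ * (c₀ * m) + c₀ * (c₀ * (5 * c₀ ^ 7 * m))) +
          c.K * (c₀ * (c₀ * (c₀ ^ 2 * m + E))) :=
          (norm_sub_le _ _).trans (add_le_add ((norm_add_le _ _).trans
            (add_le_add ((norm_add_le _ _).trans (add_le_add h3 h4)) (hgη j))) h5)
      _ = (c₀ ^ 4 + c₀ ^ 2 + 5 * c₀ ^ 9) * m + c.K * (c₀ ^ 4 * m + c₀ ^ 2 * E) := by ring
      _ ≤ (c₀ ^ 9 + c₀ ^ 9 + 5 * c₀ ^ 9) * (2 * c₀ ^ 3 * E) +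
          c.K * (c₀ ^ 4 * (2 * c₀ ^ 3 * E) + c₀ ^ 7 * E) := by
          have h6 := hp 4 9 (by norm_num)
          have h7 := hp 2 9 (by norm_num)
          have h8 := hp 2 7 (by norm_num)
          gcongr
      _ = (14 * c₀ ^ 12 + 3 * c.K * c₀ ^ 7) * E := by ring
      _ ≤ _ := by
          gcongr
          norm_num
  have hEh : E ≤ c₀ / c.h * (c₀ * ((16 * c₀ ^ 12 + 3 * c.K * c₀ ^ 7) * E)) := by
    refine (pi_norm_le_iff_of_nonneg (by positivity)).2 fun i => ?_
    refine (norm_le_of_observer_mode hc0.le hh1.le hB.resolventAo hμ (ε := ε i)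
      (Y := μ * x i last) fun s => ?_).trans (by gcongr; exact hY i)
    have h1 := eζ i s
    rw [cmulVec_matAo] at h1 ⊢
    have h2 : μ * ε i s = μ * x i s - μ * ζ i s := by simp only [hε]; ring
    rw [h2, h1]
    by_cases hs : (s : ℕ) + 1 < r
    · have h3 : μ * x i s = x i ⟨s + 1, hs⟩ := by
        simp only [hx, Finset.mul_sum]
        refine Finset.sum_congr rfl fun j _ => ?_
        rw [← eξ j s hs]
        ring
      rw [h3, dif_pos hs, dif_pos hs, if_neg hs.ne]
      simp only [hε, hx]
      ring
    · have hs' : (s : ℕ) + 1 = r := by omega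
      have h3 : s = last := Fin.ext (by omega)
      rw [dif_neg hs, dif_neg hs, if_pos hs', h3]
      simp only [hε, hx]
      ring
  -- `gainH` exceeds the loop factor `c₀² (16 c₀¹² + 3 K c₀⁷)`, so the inequality `E h ≤ factor · E`
  -- is only possible for `E = 0`.
  have hEz : E = 0 := by
    have hhpos : 0 < c.h := by linarith
    have h1 : E * c.h ≤ c₀ ^ 2 * (16 * c₀ ^ 12 + 3 * c.K * c₀ ^ 7) * E := by
      calc E * c.h ≤ (c₀ / c.h * (c₀ * ((16 * c₀ ^ 12 + 3 * c.K * c₀ ^ 7) * E))) * c.h := by gcongr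
        _ = _ := by field_simp
    unfold gainH at hh
    nlinarith
  have hmz : m = 0 := le_antisymm (by rw [hEz] at hmE; simpa using hmE) hm0
  rw [hmz] at hξb hzb hηb hζb
  rw [hEz] at hζb
  funext q
  rcases q with (⟨i, a⟩ | ⟨i, s⟩) | (⟨i, j⟩ | ⟨i, s⟩)
  · exact norm_le_zero_iff.1 (((norm_le_pi_norm (z i) a).trans (hzb i)).trans_eq (by simp))
  · exact norm_le_zero_iff.1 ((hξb i s).trans_eq (by simp))
  · exact norm_le_zero_iff.1 (((norm_le_pi_norm (η i) j).trans (hηb i)).trans_eq (by simp))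
  · exact norm_le_zero_iff.1 ((hζb i s).trans_eq (by simp))

end Modes

/-! ### The closed loop matrix is Hurwitz for high gains -/

section HighGain

variable {N nv r l : ℕ} {d : Fin N → ℕ}

theorem continuous_coefA1 (nom : PlantParam N nv r d) (i : Fin N) :
    Continuous fun w => coefA1 (nom + w) i := by unfold coefA1; fun_prop
theorem continuous_coefA2 (nom : PlantParam N nv r d) (i : Fin N) :
    Continuous fun w => coefA2 (nom + w) i := by unfold coefA2; fun_prop
theorem continuous_coefA3 (nom : PlantParam N nv r d) (i : Fin N) :
    Continuous fun w => coefA3 (nom + w) i := by unfold coefA3; fun_prop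
theorem continuous_coefE0 (nom : PlantParam N nv r d) (i : Fin N) :
    Continuous fun w => coefE0 (nom + w) i := by unfold coefE0; fun_prop
theorem continuous_coefEr (nom : PlantParam N nv r d) (i : Fin N) :
    Continuous fun w => coefEr (nom + w) i := by unfold coefEr; fun_prop
theorem continuous_coefC (nom : PlantParam N nv r d) (i : Fin N) :
    Continuous fun w => coefC (nom + w) i := by unfold coefC; fun_prop
theorem continuous_coefB (nom : PlantParam N nv r d) :
    Continuous fun w => coefB (nom + w) := by unfold coefB; fun_prop
theorem continuous_coefF (nom : PlantParam N nv r d) :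
    Continuous fun w => coefF (nom + w) := by unfold coefF; fun_prop

/-- Each bound is phrased as holding for all large constants, so that finitely many of them can be
intersected to yield a single `c₀`. -/
theorem eventually_bound {X : Type*} [TopologicalSpace X] {s : Set X} (hs : IsCompact s)
    {f : X → ℝ} (hf : ContinuousOn f s) : ∀ᶠ c : ℝ in atTop, ∀ x ∈ s, f x ≤ c := by
  obtain ⟨C, hC⟩ := hs.exists_bound_of_continuousOn hf
  filter_upwards [eventually_ge_atTop C] with c hc x hx
  exact (le_abs_self _).trans ((hC x hx).trans hc)

theorem eventually_resolvent_bound {X n : Type*} [Fintype n] [DecidableEq n] [TopologicalSpace X]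
    {s : Set X} (hs : IsCompact s) {A : X → Matrix n n ℝ} (hA : ContinuousOn A s)
    (hH : ∀ x ∈ s, IsHurwitz (A x)) :
    ∀ᶠ c : ℝ in atTop, ∀ x ∈ s, ∀ μ : ℂ, 0 ≤ μ.re → ∀ y : n → ℂ,
      ‖y‖ ≤ c * ‖μ • y - cmulVec (A x) y‖ := by
  obtain ⟨C, -, hC⟩ := exists_resolvent_bound hs A hA hH
  filter_upwards [eventually_ge_atTop C] with c hc x hx μ hμ y
  exact (hC x hx μ hμ y).trans (by gcongr)

/-- The constant is chosen before both gains: none of the bounded quantities involves `K` or `h`,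
the observer entering only through `matAo δc 1`. Hence the thresholds for `K` and `h` can be
computed from `c₀` without circularity. -/
theorem exists_loopBounds [NeZero r] (nom : PlantParam N nv r d) {G : Digraph (Fin (N + 1))}
    {W : Set (PlantParam N nv r d)} (hW : IsCompact W)
    (hb : ∀ w ∈ W, ∀ i, 0 < coefB (nom + w) i)
    (hmin : ∀ w ∈ W, ∀ i, IsHurwitz (coefA1 (nom + w) i)) (hG : HasSpanningTree G 0)
    {M : Matrix (Fin l) (Fin l) ℝ} (Q : Fin l → ℝ) (hM : IsHurwitz M)
    (T : Matrix (Fin l) (Fin l) ℝ) {γ : Fin (r - 1) → ℝ} (hγ : IsStableMonic γ)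
    {δc : Fin r → ℝ} (hδc : IsStableMonic δc) :
    ∃ c₀ : ℝ, ∀ w ∈ W, ∀ K h, LoopBounds G ⟨M, Q, T, γ, δc, K, h⟩ (nom + w) c₀ := by
  have e1 : ∀ᶠ c : ℝ in atTop, ∀ i, ∀ w ∈ W, ∀ μ : ℂ, 0 ≤ μ.re → ∀ y : Fin (d i) → ℂ,
      ‖y‖ ≤ c * ‖μ • y - cmulVec (coefA1 (nom + w) i) y‖ :=
    eventually_all.2 fun i => eventually_resolvent_bound hW (continuous_coefA1 nom i).continuousOn
      fun w hw => hmin w hw i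
  have e2 := eventually_resolvent_bound hW (A := fun _ => M) continuousOn_const fun _ _ => hM
  have e3 := eventually_resolvent_bound hW
    (A := fun w => -(Matrix.diagonal (coefB (nom + w)) * graphH G))
    (((continuous_coefB nom).matrix_diagonal.matrix_mul continuous_const).neg.continuousOn)
    fun w hw => isHurwitz_neg_diagonal_mul_graphH hG (hb w hw)
  have e4 := eventually_resolvent_bound hW (A := fun _ => matAo δc 1) continuousOn_const
    fun _ _ => hδc.isHurwitz_matAo
  have e5 : ∀ᶠ c : ℝ in atTop, ∀ μ : ℂ, 0 ≤ μ.re → ∀ q ≤ r - 1,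
      ‖μ‖ ^ q ≤ c * ‖μ ^ (r - 1) + ∑ j : Fin (r - 1), (γ j : ℂ) * μ ^ (j : ℕ)‖ := by
    obtain ⟨C, -, hC⟩ := hγ.exists_pow_bound
    filter_upwards [eventually_ge_atTop C] with c hc μ hμ q hq
    exact (hC μ hμ q hq).trans (by gcongr)
  have e6 : ∀ᶠ c : ℝ in atTop, ∀ i, ∀ w ∈ W, coefB (nom + w) i ≤ c :=
    eventually_all.2 fun i => eventually_bound hW
      ((continuous_apply i).comp (continuous_coefB nom)).continuousOn
  have e7 : ∀ᶠ c : ℝ in atTop, ∀ i, ∀ w ∈ W, (coefB (nom + w) i)⁻¹ ≤ c :=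
    eventually_all.2 fun i => eventually_bound hW
      (((continuous_apply i).comp (continuous_coefB nom)).continuousOn.inv₀
        fun w hw => (hb w hw i).ne')
  have e8 : ∀ᶠ c : ℝ in atTop, ∀ i a, ∀ w ∈ W, |coefA2 (nom + w) i a| ≤ c :=
    eventually_all.2 fun i => eventually_all.2 fun a => eventually_bound hW
      (by have := continuous_coefA2 nom i; exact Continuous.continuousOn (by fun_prop))
  have e9 : ∀ᶠ c : ℝ in atTop, ∀ i, ∀ w ∈ W, ∑ a, |coefA3 (nom + w) i a| ≤ c :=
    eventually_all.2 fun i => eventually_bound hW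
      (by have := continuous_coefA3 nom i; exact Continuous.continuousOn (by fun_prop))
  have e10 : ∀ᶠ c : ℝ in atTop, ∀ i, ∀ w ∈ W, ∑ s, |coefC (nom + w) i s| ≤ c :=
    eventually_all.2 fun i => eventually_bound hW
      (by have := continuous_coefC nom i; exact Continuous.continuousOn (by fun_prop))
  have e11 : ∀ᶠ c : ℝ in atTop, ∀ i, ∑ j, |graphH G i j| ≤ c :=
    eventually_all.2 fun i => eventually_ge_atTop _
  have e12 : ∀ᶠ c : ℝ in atTop, ∀ j, |Q j| ≤ c := eventually_all.2 fun j => eventually_ge_atTop _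
  have e13 : ∀ᶠ c : ℝ in atTop, ∀ j, |M.mulVec Q j| ≤ c :=
    eventually_all.2 fun j => eventually_ge_atTop _
  obtain ⟨c₀, h1, h2, h3, h4, h5, h6, h7, h8, h9, h10, h11, h12, h13, h14, h15, h16, h17⟩ :=
    (e1.and <| e2.and <| e3.and <| e4.and <| e5.and <| e6.and <| e7.and <| e8.and <| e9.and <|
      e10.and <| e11.and <| e12.and <| e13.and <| (eventually_ge_atTop 1).and <|
      (eventually_ge_atTop (∑ j, |rowGammaTinv T j|)).and <|
      (eventually_ge_atTop (∑ s, |rowOmega (r := r) γ s|)).and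
      (eventually_ge_atTop (∑ j, |γ j|))).exists
  exact ⟨c₀, fun w hw K h =>
    { one_le := h14
      resolventA1 := fun i => h1 i w hw
      resolventM := h2 w hw
      resolventH := h3 w hw
      resolventAo := h4 w hw
      powγ := h5
      coefB_pos := hb w hw
      coefB_le := fun i => h6 i w hw
      coefB_inv_le := fun i => h7 i w hw
      coefA2_le := fun i a => h8 i a w hw
      coefA3_le := fun i => h9 i w hw
      coefC_le := fun i => h10 i w hw
      graphH_le := h11
      gammaTinv_le := h15
      omega_le := h16
      γ_le := h17
      Q_le := h12
      MQ_le := h13 }⟩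

theorem continuous_matAc (G : Digraph (Fin (N + 1))) (c : Controller r l)
    (nom : PlantParam N nv r d) : Continuous fun w => matAc G c (nom + w) := by
  have h1 := continuous_coefA1 nom
  have h2 := continuous_coefA2 nom
  have h3 := continuous_coefA3 nom
  have h4 := continuous_coefC nom
  have h5 := continuous_coefB nom
  have hbd : ∀ {m n : Fin N → Type} (B : PlantParam N nv r d → (i : Fin N) → Matrix (m i) (n i) ℝ),
      (∀ i a b, Continuous fun w => B w i a b) →
      Continuous fun w => Matrix.blockDiagonal' (B w) := by
    intro m n B hB
    refine continuous_pi fun q => continuous_pi fun q' => ?_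
    simp only [Matrix.blockDiagonal', Matrix.of_apply]
    split_ifs with h
    · exact hB _ _ _
    · exact continuous_const
  have hite : ∀ (q : Prop) [Decidable q] (f g : PlantParam N nv r d → ℝ), Continuous f →
      Continuous g → Continuous fun w => if q then f w else g w := by
    intro q _ f g hf hg
    split_ifs <;> assumption
  have hb : ∀ i (s : Fin r), Continuous fun w => vecB0 (nom + w) i s := by
    intro i s
    exact hite _ _ _ (by fun_prop) continuous_const
  refine Continuous.matrix_fromBlocks (Continuous.matrix_fromBlocks ?_ ?_ ?_ ?_)
    (Continuous.matrix_fromBlocks continuous_const continuous_const ?_ ?_) continuous_const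
    continuous_const
  · exact hbd _ fun i a b => by fun_prop
  · exact hbd _ fun i a b => hite _ _ _ (by fun_prop) continuous_const
  · exact hbd _ fun i a b => hite _ _ _ (by fun_prop) continuous_const
  · exact hbd _ fun i a b => hite _ _ _ (by fun_prop) continuous_const
  · exact hbd _ fun i a b => by
      simp only [Matrix.vecMulVec_apply]
      exact (hb i a).mul continuous_const
  · exact hbd _ fun i a b => by
      simp only [Matrix.vecMulVec_apply, Matrix.neg_apply]
      exact ((hb i a).mul continuous_const).neg

end HighGain

/-! ### Neutrally stable matrices and Sylvester equations -/

section Neutral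

variable {m : Type*} [Fintype m] [DecidableEq m]

/-- Over `ℂ` the generalized eigenspaces span, and semi-simplicity makes each of them an eigenspace
with imaginary eigenvalue. An additive property therefore needs checking only on such eigenvectors.
-/
theorem IsNeutrallyStable.induction {S : Matrix m m ℝ} (hS : IsNeutrallyStable S)
    {motive : (m → ℂ) → Prop}
    (eigen : ∀ (μ : ℂ) x, μ.re = 0 → cmulVec S x = μ • x → motive x) (zero : motive 0)
    (add : ∀ x y, motive x → motive y → motive (x + y)) (x : m → ℂ) : motive x := by
  set f : Module.End ℂ (m → ℂ) := Matrix.toLin' (S.map (algebraMap ℝ ℂ)) with hf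
  have hx : x ∈ ⨆ μ : ℂ, f.maxGenEigenspace μ := by
    rw [Module.End.iSup_maxGenEigenspace_eq_top]
    trivial
  induction hx using Submodule.iSup_induction' with
  | zero => exact zero
  | add x y _ _ hx hy => exact add x y hx hy
  | mem μ x hx =>
    by_cases hμ : μ ∈ spectrum ℂ (S.map (algebraMap ℝ ℂ))
    · obtain ⟨h0, h1⟩ := hS μ hμ
      rw [← hf] at h1
      rw [h1, Module.End.mem_eigenspace_iff] at hx
      exact eigen μ x h0 hx
    · have h2 : ¬ f.HasEigenvalue μ := by
        rw [Module.End.hasEigenvalue_iff_mem_spectrum, hf, Matrix.spectrum_toLin']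
        exact hμ
      have h3 : f.maxGenEigenspace μ = ⊥ := by
        by_contra h3
        exact h2 (Module.End.HasUnifEigenvalue.lt (k := ⊤) zero_lt_one h3)
      rw [h3, Submodule.mem_bot] at hx
      rw [hx]
      exact zero

/-- Solutions of `v' = S v` stay bounded, uniformly in the initial value. -/
theorem IsNeutrallyStable.exists_bound {S : Matrix m m ℝ} (hS : IsNeutrallyStable S) :
    ∃ C : ℝ, 0 ≤ C ∧ ∀ (v : ℝ → m → ℝ) (b : ℝ), ContinuousOn v (Set.Icc 0 b) →
      (∀ t ∈ Set.Ico 0 b, HasDerivWithinAt v (S.mulVec (v t)) (Set.Ici t) t) →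
      ∀ t ∈ Set.Icc 0 b, ‖v t‖ ≤ C * ‖v 0‖ := by
  -- On an eigenvector the solution is `exp(t μ) x`, of constant norm because `Re μ = 0`; other
  -- initial values are sums of these.
  have h1 : ∀ x : m → ℂ, ∃ (C : ℝ) (y : ℝ → m → ℂ), y 0 = x ∧
      (∀ t, HasDerivAt y (cmulVec S (y t)) t) ∧ ∀ t, ‖y t‖ ≤ C := by
    intro x
    induction x using hS.induction with
    | eigen μ x hμ hx =>
      refine ⟨‖x‖, fun t => Complex.exp (t * μ) • x, by simp, fun t => ?_, fun t => ?_⟩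
      · have h2 : HasDerivAt (fun t : ℝ => Complex.exp (t * μ)) (Complex.exp (t * μ) * μ) t := by
          have h3 : HasDerivAt (fun t : ℝ => (t : ℂ) * μ) μ t := by
            simpa using (Complex.ofRealCLM.hasDerivAt (x := t)).mul_const μ
          exact h3.cexp
        have h4 := h2.smul_const x
        have h5 : cmulVec S (Complex.exp (t * μ) • x) = (Complex.exp (t * μ) * μ) • x := by
          rw [cmulVec, Matrix.mulVec_smul, mul_smul, ← hx]
        rw [h5]
        exact h4
      · rw [norm_smul, Complex.norm_exp]
        simp [hμ]
    | zero => exact ⟨0, fun _ => 0, rfl, fun t => by simpa using hasDerivAt_const t (0 : m → ℂ),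
        fun t => by simp⟩
    | add x y hx hy =>
      obtain ⟨C, f, hf0, hf, hfC⟩ := hx
      obtain ⟨D, g, hg0, hg, hgD⟩ := hy
      refine ⟨C + D, fun t => f t + g t, by simp [hf0, hg0], fun t => ?_,
        fun t => (norm_add_le _ _).trans (add_le_add (hfC t) (hgD t))⟩
      rw [cmulVec, Matrix.mulVec_add]
      exact (hf t).add (hg t)
  choose C y hy0 hy hyC using fun j : m => h1 (Pi.single j 1)
  have hC0 : ∀ j, 0 ≤ C j := fun j => (norm_nonneg _).trans (hyC j 0)
  refine ⟨∑ j, C j, Finset.sum_nonneg fun j _ => hC0 j, fun v b hv hv' t ht => ?_⟩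
  set V : ℝ → m → ℂ := fun t i => (v t i : ℂ) with hV
  set Y : ℝ → m → ℂ := fun t => ∑ j, (v 0 j : ℂ) • y j t with hY
  have hVc : ContinuousOn V (Set.Icc 0 b) := by
    refine continuousOn_pi.2 fun i => ?_
    exact Complex.continuous_ofReal.comp_continuousOn ((continuous_apply i).comp_continuousOn hv)
  have hVd : ∀ t ∈ Set.Ico 0 b, HasDerivWithinAt V (cmulVec S (V t)) (Set.Ici t) t := by
    intro t ht
    rw [hasDerivWithinAt_pi]
    intro i
    have h2 := (hasDerivWithinAt_pi.1 (hv' t ht) i).ofReal_comp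
    have h3 : cmulVec S (V t) i = ((S.mulVec (v t) i : ℝ) : ℂ) := by
      simp only [cmulVec, Matrix.mulVec, dotProduct, Matrix.map_apply, hV, Complex.coe_algebraMap]
      push_cast
      rfl
    rw [h3]
    exact h2
  have hYd : ∀ t, HasDerivAt Y (cmulVec S (Y t)) t := by
    intro t
    have h2 : cmulVec S (Y t) = ∑ j, (v 0 j : ℂ) • cmulVec S (y j t) := by
      simp only [hY, cmulVec, Matrix.mulVec_sum, Matrix.mulVec_smul]
    rw [h2]
    exact HasDerivAt.fun_sum fun j _ => (hy j t).fun_const_smul _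
  have hlip : ∀ t ∈ Set.Ico 0 b, LipschitzOnWith
      ‖LinearMap.toContinuousLinearMap (Matrix.mulVecLin (S.map (algebraMap ℝ ℂ)))‖₊
      (fun x => cmulVec S x) Set.univ := fun t _ =>
    (LinearMap.toContinuousLinearMap
      (Matrix.mulVecLin (S.map (algebraMap ℝ ℂ)))).lipschitz.lipschitzOnWith
  -- The given solution, only right-differentiable, is identified with the combination of the
  -- solutions started at the coordinate vectors. The constant is therefore independent of `v` and
  -- of `b`.
  have heq : Set.EqOn V Y (Set.Icc 0 b) :=
    ODE_solution_unique_of_mem_Icc_right hlip hVc hVd (fun _ _ => Set.mem_univ _)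
      (fun t _ => (hYd t).continuousAt.continuousWithinAt) (fun t _ => (hYd t).hasDerivWithinAt)
      (fun _ _ => Set.mem_univ _) (by
        funext i
        simp only [hV, hY, hy0, Finset.sum_apply, Pi.smul_apply, smul_eq_mul, Pi.single_apply,
          mul_ite, mul_one, mul_zero, Finset.sum_ite_eq, Finset.mem_univ, if_true])
  have h2 : ‖Y t‖ ≤ (∑ j, C j) * ‖v 0‖ := by
    rw [Finset.sum_mul]
    refine norm_sum_le_of_le _ fun j _ => ?_
    rw [norm_smul, Complex.norm_real, mul_comm]
    exact mul_le_mul (hyC j t) (norm_le_pi_norm (v 0) j) (norm_nonneg _) (hC0 j)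
  rw [← heq ht] at h2
  refine (pi_norm_le_iff_of_nonneg ((norm_nonneg _).trans h2)).2 fun i => ?_
  have h3 := (norm_le_pi_norm (V t) i).trans h2
  simpa only [hV, Complex.norm_real] using h3

/-- From `Z S = A Z`, an eigenvector of `S` is mapped by `Z` to a solution of `A x = μ x` with `Re μ
= 0`, which must vanish because `A` is Hurwitz. -/
theorem IsHurwitz.eq_zero_of_sylvester {n : Type*} [Fintype n] [DecidableEq n] {A : Matrix n n ℝ}
    (hA : IsHurwitz A) {S : Matrix m m ℝ} (hS : IsNeutrallyStable S) {Z : Matrix n m ℝ}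
    (hZ : Z * S - A * Z = 0) : Z = 0 := by
  have h1 : ∀ x : m → ℂ, cmulVec Z x = 0 := by
    intro x
    induction x using hS.induction with
    | eigen μ x hμ hx =>
      refine (isHurwitz_iff A).1 hA μ _ hμ.ge ?_
      have h2 : Z.map (algebraMap ℝ ℂ) * S.map (algebraMap ℝ ℂ) =
          A.map (algebraMap ℝ ℂ) * Z.map (algebraMap ℝ ℂ) := by
        rw [← Matrix.map_mul, ← Matrix.map_mul, sub_eq_zero.1 hZ]
      rw [cmulVec, cmulVec, Matrix.mulVec_mulVec, ← h2, ← Matrix.mulVec_mulVec, ← Matrix.mulVec_smul]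
      exact congrArg _ hx
    | zero => exact Matrix.mulVec_zero _
    | add x y hx hy =>
      rw [cmulVec] at hx hy ⊢
      rw [Matrix.mulVec_add, hx, hy, add_zero]
  ext i j
  have h2 := congrFun (h1 (Pi.single j 1)) i
  rw [cmulVec, Matrix.mulVec_single_one] at h2
  simpa using h2

theorem IsHurwitz.exists_sylvester {n : Type*} [Fintype n] [DecidableEq n] {A : Matrix n n ℝ}
    (hA : IsHurwitz A) {S : Matrix m m ℝ} (hS : IsNeutrallyStable S) (B : Matrix n m ℝ) :
    ∃ Z : Matrix n m ℝ, Z * S - A * Z = B := by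
  let f : Matrix n m ℝ →ₗ[ℝ] Matrix n m ℝ :=
    mulRightLinearMap n ℝ S - mulLeftLinearMap m ℝ A
  have hinj : Function.Injective f := (injective_iff_map_eq_zero f).2 fun Z hZ =>
    hA.eq_zero_of_sylvester hS hZ
  exact LinearMap.injective_iff_surjective.1 hinj B

/-- The solutions of a compact family of Sylvester equations are uniformly bounded. -/
theorem exists_sylvester_bound {X : Type*} [TopologicalSpace X] {s : Set X} (hs : IsCompact s)
    {n : Type*} [Fintype n] [DecidableEq n] {A : X → Matrix n n ℝ} (hA : ContinuousOn A s)
    (hH : ∀ x ∈ s, IsHurwitz (A x)) {S : Matrix m m ℝ} (hS : IsNeutrallyStable S)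
    {B : X → Matrix n m ℝ} (hB : ContinuousOn B s) :
    ∃ C : ℝ, ∀ x ∈ s, ∀ Z, Z * S - A x * Z = B x →
      Matrix.of.symm Z ∈ Metric.closedBall (0 : n → m → ℝ) C := by
  let f : X → (n → m → ℝ) → (n → m → ℝ) := fun x Z =>
    Matrix.of.symm (Matrix.of Z * S - A x * Matrix.of Z)
  obtain ⟨C, hC0, hC⟩ := exists_uniform_lower_bound hs f (by
      have h1 : ContinuousOn (fun q : X × (n → m → ℝ) => A q.1) (s ×ˢ Set.univ) :=
        hA.comp continuousOn_fst fun q hq => hq.1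
      have h2 : ContinuousOn (fun q : X × (n → m → ℝ) => q.2) (s ×ˢ Set.univ) := continuousOn_snd
      have hc : Continuous fun q : Matrix n n ℝ × Matrix n m ℝ => q.2 * S - q.1 * q.2 := by fun_prop
      exact hc.comp_continuousOn (h1.prodMk h2))
    (fun x _ c P => by
      have h1 : Matrix.of (c • P) = c • Matrix.of P := rfl
      have h2 : ∀ B : Matrix n m ℝ, Matrix.of.symm (c • B) = c • Matrix.of.symm B := fun B => rfl
      simp only [f, h1, ← h2, smul_sub, Matrix.mul_smul, Matrix.smul_mul])
    (fun x hx P hP => (hH x hx).eq_zero_of_sylvester hS hP)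
  have hB' : ContinuousOn (fun x => Matrix.of.symm (B x)) s := hB
  obtain ⟨D, hD⟩ := hs.exists_bound_of_continuousOn hB'
  refine ⟨C * D, fun x hx Z hZ => ?_⟩
  rw [mem_closedBall_zero_iff]
  refine (hC x hx (Matrix.of.symm Z)).trans ?_
  gcongr
  have := hD x hx
  rw [← hZ] at this
  exact this

end Neutral

/-! ### The internal model -/

section InternalModel

theorem companionPhi_mulVec {nv l : ℕ} (S : Matrix (Fin nv) (Fin nv) ℝ) (x : Fin l → ℝ)
    (j : Fin l) : (companionPhi S l).mulVec x j =
      if h : (j : ℕ) + 1 < l then x ⟨j + 1, h⟩ else - ∑ k : Fin l, (minpoly ℝ S).coeff k * x k := by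
  simp only [companionPhi, Matrix.mulVec, dotProduct, Matrix.of_apply]
  split_ifs with h1 h2
  · omega
  · simp [Finset.sum_neg_distrib]
  · rw [Finset.sum_eq_single ⟨j + 1, by omega⟩]
    · simp
    · intro k _ hk
      have : (k : ℕ) ≠ j + 1 := fun h' => hk (Fin.ext h')
      simp [this]
    · simp
  · omega

/-- The solution of `T Φ - M T = Q Γ` is invertible when `(M, Q)` is controllable. -/
theorem isUnit_of_sylvester_companion {nv l : ℕ} {S : Matrix (Fin nv) (Fin nv) ℝ}
    {M : Matrix (Fin l) (Fin l) ℝ} {Q : Fin l → ℝ} (hMQ : IsControllable M Q)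
    {T : Matrix (Fin l) (Fin l) ℝ}
    (hT : T * companionPhi S l - M * T = Matrix.vecMulVec Q (rowGamma l)) : IsUnit T := by
  have hT' : T * companionPhi S l = M * T + Matrix.vecMulVec Q (rowGamma l) :=
    sub_eq_iff_eq_add'.1 hT
  have hrow : ∀ y : Fin l → ℝ, Matrix.vecMul y T = 0 →
      Matrix.vecMul (Matrix.vecMul y M) T = -((y ⬝ᵥ Q) • rowGamma l) := by
    intro y hy
    have h1 := congrArg (Matrix.vecMul y) hT'
    rw [← Matrix.vecMul_vecMul, hy, Matrix.zero_vecMul, Matrix.vecMul_add, ← Matrix.vecMul_vecMul,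
      Matrix.vecMul_vecMulVec] at h1
    rw [eq_neg_iff_add_eq_zero]
    exact h1.symm
  -- If every left null vector of `T` annihilates `Q`, the left kernel is invariant under `M`, so it
  -- annihilates the whole controllability matrix and is zero.
  by_cases hker : ∀ y : Fin l → ℝ, Matrix.vecMul y T = 0 → y ⬝ᵥ Q = 0
  · rw [← Matrix.vecMul_injective_iff_isUnit]
    refine (injective_iff_map_eq_zero (Matrix.vecMulLinear T)).2 fun y hy => ?_
    rw [Matrix.coe_vecMulLinear] at hy
    have h1 : ∀ k : ℕ, Matrix.vecMul (Matrix.vecMul y (M ^ k)) T = 0 := by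
      intro k
      induction k with
      | zero => simpa using hy
      | succ k ih =>
        rw [pow_succ, ← Matrix.vecMul_vecMul, hrow _ ih, hker _ ih]
        simp
    set Ctr : Matrix (Fin l) (Fin l) ℝ :=
      Matrix.of fun a (j : Fin l) => (M ^ (j : ℕ)).mulVec Q a with hCtr
    have h2 : Matrix.vecMul y Ctr = 0 := by
      funext j
      have h3 := hker _ (h1 j)
      rw [← Matrix.dotProduct_mulVec] at h3
      exact h3
    have h4 : IsUnit Ctr := by
      rw [← Matrix.mulVec_surjective_iff_isUnit]
      have h5 : LinearMap.range Ctr.mulVecLin = ⊤ := by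
        apply Submodule.eq_top_of_finrank_eq
        have h6 : Ctr.rank = l := hMQ
        rw [Module.finrank_fin_fun]
        exact h6
      exact LinearMap.range_eq_top.1 h5
    exact (Matrix.vecMul_injective_iff_isUnit.2 h4) (by simpa using h2)
  -- Otherwise some left null vector does not annihilate `Q`. Then the right kernel of `T` lies in
  -- the kernel of `Γ` and is invariant under `Φ`. The pair `(Γ, Φ)` is observable, since `Γ Φᵏ`
  -- reads off the coordinate `k`, so the right kernel is zero.
  · push Not at hker
    obtain ⟨y, hy, hyQ⟩ := hker
    have hΓ : ∀ x : Fin l → ℝ, T.mulVec x = 0 → rowGamma l ⬝ᵥ x = 0 := by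
      intro x hx
      have h1 := congrArg (fun w => w ⬝ᵥ x) (hrow y hy)
      simp only [← Matrix.dotProduct_mulVec, hx, dotProduct_zero, neg_dotProduct,
        smul_dotProduct, smul_eq_mul] at h1
      have := neg_eq_zero.1 h1.symm
      exact (mul_eq_zero.1 this).resolve_left hyQ
    rw [← Matrix.mulVec_injective_iff_isUnit]
    refine (injective_iff_map_eq_zero (Matrix.mulVecLin T)).2 fun x hx => ?_
    have hx' : T.mulVec x = 0 := hx
    have hcoord : ∀ k (hk : k < l), ∀ x : Fin l → ℝ, T.mulVec x = 0 → x ⟨k, hk⟩ = 0 := by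
      intro k
      induction k with
      | zero =>
        intro hk x hx
        have h1 := hΓ x hx
        rw [dotProduct, Finset.sum_eq_single ⟨0, hk⟩] at h1
        · simpa [rowGamma] using h1
        · intro j _ hj
          have : (j : ℕ) ≠ 0 := fun h => hj (Fin.ext h)
          simp [rowGamma, this]
        · simp
      | succ k ih =>
        intro hk x hx
        have h1 := ih (by omega) ((companionPhi S l).mulVec x) (by
          rw [Matrix.mulVec_mulVec, hT', Matrix.add_mulVec, ← Matrix.mulVec_mulVec, hx,
            Matrix.mulVec_zero, Matrix.vecMulVec_mulVec, hΓ x hx]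
          simp)
        rwa [companionPhi_mulVec, dif_pos (by simpa using hk)] at h1
    funext k
    exact hcoord k k.2 x hx'

end InternalModel

/-! ### The closed loop in stacked coordinates -/

section Flat

variable {N nv r l : ℕ} {d : Fin N → ℕ}

/-- The stacked vector `col(z, ξ, η, ζ)`. -/
def flat (y : CState N r l d) : LoopIdx N r l d → ℝ :=
  Sum.elim (Sum.elim (fun q => y.1 q.1 q.2) (fun q => y.2.1 q.1 q.2))
    (Sum.elim (fun q => y.2.2.1 q.1 q.2) (fun q => y.2.2.2 q.1 q.2))

theorem flat_add (y y' : CState N r l d) : flat (y + y') = flat y + flat y' := by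
  funext q
  rcases q with (q | q) | (q | q) <;> rfl

theorem flat_smul (a : ℝ) (y : CState N r l d) : flat (a • y) = a • flat y := by
  funext q
  rcases q with (q | q) | (q | q) <;> rfl

/-- Stacking as a continuous linear map. -/
def flatCLM : CState N r l d →L[ℝ] (LoopIdx N r l d → ℝ) :=
  LinearMap.toContinuousLinearMap
    { toFun := flat, map_add' := flat_add, map_smul' := flat_smul }

theorem norm_le_norm_flat (y : CState N r l d) : ‖y‖ ≤ ‖flat y‖ := by
  have h0 := norm_nonneg (flat y)
  refine norm_prod_le_iff.2 ⟨?_, norm_prod_le_iff.2 ⟨?_, norm_prod_le_iff.2 ⟨?_, ?_⟩⟩⟩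
  · exact (pi_norm_le_iff_of_nonneg h0).2 fun i => (pi_norm_le_iff_of_nonneg h0).2 fun a =>
      norm_le_pi_norm (flat y) (Sum.inl (Sum.inl ⟨i, a⟩))
  · exact (pi_norm_le_iff_of_nonneg h0).2 fun i => (pi_norm_le_iff_of_nonneg h0).2 fun a =>
      norm_le_pi_norm (flat y) (Sum.inl (Sum.inr ⟨i, a⟩))
  · exact (pi_norm_le_iff_of_nonneg h0).2 fun i => (pi_norm_le_iff_of_nonneg h0).2 fun a =>
      norm_le_pi_norm (flat y) (Sum.inr (Sum.inl ⟨i, a⟩))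
  · exact (pi_norm_le_iff_of_nonneg h0).2 fun i => (pi_norm_le_iff_of_nonneg h0).2 fun a =>
      norm_le_pi_norm (flat y) (Sum.inr (Sum.inr ⟨i, a⟩))

theorem sqNorm_flat (y : CState N r l d) : sqNorm (flat y) =
    ∑ i, (sqNorm (y.1 i) + sqNorm (y.2.1 i) + sqNorm (y.2.2.1 i) + sqNorm (y.2.2.2 i)) := by
  simp only [sqNorm, flat, Fintype.sum_sum_type, Sum.elim_inl, Sum.elim_inr, Fintype.sum_sigma,
    Finset.sum_add_distrib]
  ring

theorem controlInput_add (c : Controller r l) (x y : LoopState N nv r l d) (i : Fin N) :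
    controlInput c (x + y) i = controlInput c x i + controlInput c y i := by
  have h1 : stEta (x + y) i = stEta x i + stEta y i := rfl
  have h2 : stZeta (x + y) i = stZeta x i + stZeta y i := rfl
  simp only [controlInput, h1, h2, dotProduct_add]
  ring

theorem controlInput_smul (c : Controller r l) (a : ℝ) (x : LoopState N nv r l d) (i : Fin N) :
    controlInput c (a • x) i = a * controlInput c x i := by
  have h1 : stEta (a • x) i = a • stEta x i := rfl
  have h2 : stZeta (a • x) i = a • stZeta x i := rfl
  simp only [controlInput, h1, h2, dotProduct_smul, smul_eq_mul]
  ring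

end Flat

/-! ### Linearity of the closed-loop vector field -/

section Field

variable {N nv r l : ℕ} {d : Fin N → ℕ} [NeZero r]
variable (S : Matrix (Fin nv) (Fin nv) ℝ) (G : Digraph (Fin (N + 1))) (c : Controller r l)
  (p : PlantParam N nv r d)

theorem nodeOutput_add (x y : LoopState N nv r l d) :
    nodeOutput p (x + y) = nodeOutput p x + nodeOutput p y := by
  funext k
  refine Fin.cases ?_ (fun i => ?_) k
  · simp [nodeOutput, stV, dotProduct_add]
  · simp [nodeOutput, stXi]

theorem nodeOutput_smul (a : ℝ) (x : LoopState N nv r l d) :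
    nodeOutput p (a • x) = a • nodeOutput p x := by
  funext k
  refine Fin.cases ?_ (fun i => ?_) k
  · simp [nodeOutput, stV, dotProduct_smul]
  · simp [nodeOutput, stXi]

theorem virtualOutput_add (x y : LoopState N nv r l d) (i : Fin N) :
    virtualOutput G p (x + y) i = virtualOutput G p x i + virtualOutput G p y i := by
  simp only [virtualOutput, nodeOutput_add, Pi.add_apply, ← Finset.sum_add_distrib]
  exact Finset.sum_congr rfl fun _ _ => by ring

theorem virtualOutput_smul (a : ℝ) (x : LoopState N nv r l d) (i : Fin N) :
    virtualOutput G p (a • x) i = a * virtualOutput G p x i := by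
  simp only [virtualOutput, nodeOutput_smul, Pi.smul_apply, smul_eq_mul, Finset.mul_sum]
  exact Finset.sum_congr rfl fun _ _ => by ring

theorem loopField_add (x y : LoopState N nv r l d) (s s' : Fin N → LoopState N nv r l d) :
    loopField S G c p (x + y) (s + s') = loopField S G c p x s + loopField S G c p y s' := by
  have hv : stV (x + y) = stV x + stV y := rfl
  have hz : ∀ i, stZ (x + y) i = stZ x i + stZ y i := fun _ => rfl
  have hξ : ∀ i, stXi (x + y) i = stXi x i + stXi y i := fun _ => rfl
  have hη : ∀ i, stEta (x + y) i = stEta x i + stEta y i := fun _ => rfl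
  have hζ : ∀ i, stZeta (x + y) i = stZeta x i + stZeta y i := fun _ => rfl
  refine Prod.ext ?_ (Prod.ext ?_ (Prod.ext ?_ (Prod.ext ?_ ?_)))
  · simp [loopField, hv, Matrix.mulVec_add]
  · funext i
    simp only [loopField, hv, hz, hξ, Matrix.mulVec_add, Pi.add_apply, add_smul, Prod.fst_add,
      Prod.snd_add]
    abel
  · funext i q
    simp only [loopField, hv, hz, hξ, Pi.add_apply, Prod.fst_add, Prod.snd_add, controlInput_add,
      dotProduct_add, mul_add]
    split_ifs
    · rfl
    · ring
  · funext i
    simp only [loopField, hη, Matrix.mulVec_add, Pi.add_apply, add_smul, Prod.fst_add,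
      Prod.snd_add, controlInput_add]
    abel
  · funext i
    simp only [loopField, hζ, Matrix.mulVec_add, Pi.add_apply, add_smul,
      Prod.snd_add, virtualOutput_add]
    abel

theorem loopField_smul (a : ℝ) (x : LoopState N nv r l d) (s : Fin N → LoopState N nv r l d) :
    loopField S G c p (a • x) (a • s) = a • loopField S G c p x s := by
  have hv : stV (a • x) = a • stV x := rfl
  have hz : ∀ i, stZ (a • x) i = a • stZ x i := fun _ => rfl
  have hξ : ∀ i, stXi (a • x) i = a • stXi x i := fun _ => rfl
  have hη : ∀ i, stEta (a • x) i = a • stEta x i := fun _ => rfl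
  have hζ : ∀ i, stZeta (a • x) i = a • stZeta x i := fun _ => rfl
  refine Prod.ext ?_ (Prod.ext ?_ (Prod.ext ?_ (Prod.ext ?_ ?_)))
  · simp [loopField, hv, Matrix.mulVec_smul]
  · funext i
    simp only [loopField, hv, hz, hξ, Matrix.mulVec_smul, Pi.smul_apply, smul_smul, Prod.smul_fst,
      Prod.smul_snd, smul_add, smul_eq_mul]
  · funext i q
    simp only [loopField, hv, hz, hξ, Pi.smul_apply, Prod.smul_fst, Prod.smul_snd,
      controlInput_smul, dotProduct_smul, smul_eq_mul]
    split_ifs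
    · rfl
    · ring
  · funext i
    simp only [loopField, hη, Matrix.mulVec_smul, Pi.smul_apply, smul_smul, Prod.smul_fst,
      Prod.smul_snd, controlInput_smul, smul_add]
  · funext i
    simp only [loopField, hζ, Matrix.mulVec_smul, Pi.smul_apply, smul_smul,
      Prod.smul_snd, virtualOutput_smul, smul_add]

/-- The right-hand side of the closed loop as a continuous linear map of the state and of the
sampled states. -/
def loopFieldCLM : (LoopState N nv r l d × (Fin N → LoopState N nv r l d)) →L[ℝ]
    LoopState N nv r l d :=
  LinearMap.toContinuousLinearMap
    { toFun := fun q => loopField S G c p q.1 q.2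
      map_add' := fun q q' => loopField_add S G c p q.1 q'.1 q.2 q'.2
      map_smul' := fun a q => loopField_smul S G c p a q.1 q.2 }

theorem loopFieldCLM_apply (x : LoopState N nv r l d) (s : Fin N → LoopState N nv r l d) :
    loopFieldCLM S G c p (x, s) = loopField S G c p x s := rfl

theorem loopField_sub (x y : LoopState N nv r l d) (s s' : Fin N → LoopState N nv r l d) :
    loopField S G c p (x - y) (s - s') = loopField S G c p x s - loopField S G c p y s' :=
  map_sub (loopFieldCLM S G c p) (x, s) (y, s')

/-- The link between `A_c` and the differential equation: `matAc` is the loop with the exosystem at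
rest and the samples equal to the current state. -/
theorem flat_loopField_zero (y : CState N r l d) :
    flat (loopField S G c p (0, y) fun _ => (0, y)).2 = (matAc G c p).mulVec (flat y) := by
  have hmap : (matAc G c p).map (algebraMap ℝ ℝ) = matAc G c p := by
    ext
    simp
  have hin : ∀ i, controlInput c ((0, y) : LoopState N nv r l d) i =
      inputOf c (fun j => flat y (Sum.inr (Sum.inl ⟨i, j⟩)))
        (fun s' => flat y (Sum.inr (Sum.inr ⟨i, s'⟩))) := fun i => rfl
  have hvo : ∀ i, virtualOutput G p ((0, y) : LoopState N nv r l d) i =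
      ∑ j, graphH G i j * y.2.1 j 0 := by
    intro i
    have h1 := sum_graphH_mul (R := ℝ) G (fun j => y.2.1 j 0) i
    simp only [Algebra.algebraMap_self, RingHom.id_apply] at h1
    rw [h1]
    simp [virtualOutput, nodeOutput, stV, stXi]
  funext q
  rw [← hmap]
  rcases q with (⟨i, a⟩ | ⟨i, s⟩) | (⟨i, j⟩ | ⟨i, s⟩)
  · rw [matAc_row_z]
    simp [flat, loopField, stZ, stXi, stV, Matrix.mulVec, dotProduct, mul_comm]
  · rw [matAc_row_xi, ← hin]
    simp only [flat, loopField, stZ, stXi, stV, dotProduct, Sum.elim_inl, Sum.elim_inr,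
      Algebra.algebraMap_self, RingHom.id_apply, Pi.zero_apply, mul_zero, Finset.sum_const_zero,
      add_zero]
  · rw [matAc_row_eta, ← hin]
    simp [flat, loopField, stEta, Matrix.mulVec, dotProduct, mul_comm]
  · rw [matAc_row_zeta]
    simp [flat, loopField, stZeta, hvo, Matrix.mulVec, dotProduct, mul_comm]

/-- The effect of the sampling errors on the field. -/
theorem loopField_sub_diag (x : LoopState N nv r l d) (s : Fin N → LoopState N nv r l d) :
    loopField S G c p x s - loopField S G c p x (fun _ => x) =
      (0, 0, fun i (q : Fin r) => if (q : ℕ) + 1 < r then 0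
          else coefB p i * (controlInput c (s i) i - controlInput c x i),
        fun i => (controlInput c (s i) i - controlInput c x i) • c.Q,
        fun i => (virtualOutput G p (s i) i - virtualOutput G p x i) • vecBo c.δc c.h) := by
  refine Prod.ext ?_ (Prod.ext ?_ (Prod.ext ?_ (Prod.ext ?_ ?_)))
  · simp [loopField]
  · simp [loopField]
  · funext i q
    simp only [loopField, Prod.fst_sub, Prod.snd_sub, Pi.sub_apply]
    split_ifs
    · simp
    · ring
  · funext i
    simp [loopField, sub_smul]
  · funext i
    simp [loopField, sub_smul]

end Field

/-! ### The steady state -/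

section Steady

variable {N nv r l : ℕ} {d : Fin N → ℕ}

/-- The row of the steady state input of agent `i`. -/
def feedforward (S : Matrix (Fin nv) (Fin nv) ℝ) (p : PlantParam N nv r d)
    (Z : (i : Fin N) → Fin (d i) → Fin nv → ℝ) (i : Fin N) : Fin nv → ℝ :=
  (coefB p i)⁻¹ • (Matrix.vecMul (coefF p) (S ^ r) - Matrix.vecMul (coefA3 p i) (Matrix.of (Z i)) -
    ∑ s : Fin r, coefC p i s • Matrix.vecMul (coefF p) (S ^ (s : ℕ)) - coefEr p i)

/-- The steady state of the plants and of the controllers. -/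
def steadyState (S : Matrix (Fin nv) (Fin nv) ℝ) (T : Matrix (Fin l) (Fin l) ℝ)
    (p : PlantParam N nv r d) (Z : (i : Fin N) → Fin (d i) → Fin nv → ℝ) (v : Fin nv → ℝ) :
    CState N r l d :=
  (fun i => (Matrix.of (Z i)).mulVec v, fun _ s => coefF p ⬝ᵥ (S ^ (s : ℕ)).mulVec v,
    fun i => T.mulVec fun j => feedforward S p Z i ⬝ᵥ (S ^ (j : ℕ)).mulVec v, 0)

/-- The Sylvester equations of the steady states of the zero dynamics. -/
def IsZeroDynamicsSteady (S : Matrix (Fin nv) (Fin nv) ℝ) (p : PlantParam N nv r d)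
    (Z : (i : Fin N) → Fin (d i) → Fin nv → ℝ) : Prop :=
  ∀ i, Matrix.of (Z i) * S - coefA1 p i * Matrix.of (Z i) =
    Matrix.vecMulVec (coefA2 p i) (coefF p) + coefE0 p i

/-- The Sylvester solution `Z` is an independent variable here. Joint continuity on a compact set of
triples `(w, Z, v)` then bounds the steady states without selecting `Z(w)` continuously. -/
theorem continuousOn_steadyState (S : Matrix (Fin nv) (Fin nv) ℝ) (T : Matrix (Fin l) (Fin l) ℝ)
    (nom : PlantParam N nv r d) {W : Set (PlantParam N nv r d)}
    (hb : ∀ w ∈ W, ∀ i, coefB (nom + w) i ≠ 0) :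
    ContinuousOn (fun q : PlantParam N nv r d × ((i : Fin N) → Fin (d i) → Fin nv → ℝ) ×
      (Fin nv → ℝ) => (steadyState S T (nom + q.1) q.2.1 q.2.2 : CState N r l d))
      (W ×ˢ Set.univ) := by
  have h1 := continuous_coefA3 nom
  have h2 := continuous_coefC nom
  have h3 := continuous_coefB nom
  have h4 := continuous_coefF nom
  have h5 := continuous_coefEr nom
  have hff : ∀ i, ContinuousOn (fun q : PlantParam N nv r d ×
      ((i : Fin N) → Fin (d i) → Fin nv → ℝ) × (Fin nv → ℝ) =>
      feedforward S (nom + q.1) q.2.1 i) (W ×ˢ Set.univ) := by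
    intro i
    have hinv : ContinuousOn (fun q : PlantParam N nv r d ×
        ((i : Fin N) → Fin (d i) → Fin nv → ℝ) × (Fin nv → ℝ) => (coefB (nom + q.1) i)⁻¹)
        (W ×ˢ Set.univ) :=
      ContinuousOn.inv₀ (((continuous_apply i).comp h3).comp continuous_fst).continuousOn
        fun q hq => hb q.1 hq.1 i
    have hrow : Continuous (fun q : PlantParam N nv r d ×
        ((i : Fin N) → Fin (d i) → Fin nv → ℝ) × (Fin nv → ℝ) =>
        Matrix.vecMul (coefF (nom + q.1)) (S ^ r) -
          Matrix.vecMul (coefA3 (nom + q.1) i) (Matrix.of (q.2.1 i)) -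
          ∑ s : Fin r, coefC (nom + q.1) i s • Matrix.vecMul (coefF (nom + q.1)) (S ^ (s : ℕ)) -
          coefEr (nom + q.1) i) := by
      refine Continuous.sub (Continuous.sub (Continuous.sub ?_ ?_) ?_) ?_
      · exact (h4.comp continuous_fst).matrix_vecMul continuous_const
      · have h6 : Continuous fun q : PlantParam N nv r d ×
            ((i : Fin N) → Fin (d i) → Fin nv → ℝ) × (Fin nv → ℝ) => Matrix.of (q.2.1 i) :=
          (continuous_apply i).comp (continuous_fst.comp continuous_snd)
        exact ((h1 i).comp continuous_fst).matrix_vecMul h6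
      · refine continuous_finsetSum _ fun s _ => Continuous.fun_smul ?_ ?_
        · exact ((continuous_apply s).comp (h2 i)).comp continuous_fst
        · exact (h4.comp continuous_fst).matrix_vecMul continuous_const
      · exact (h5 i).comp continuous_fst
    exact hinv.smul hrow.continuousOn
  refine ContinuousOn.prodMk (Continuous.continuousOn ?_) (ContinuousOn.prodMk
    (Continuous.continuousOn ?_) (ContinuousOn.prodMk ?_ continuousOn_const))
  · exact continuous_pi fun i => Continuous.matrix_mulVec
      ((continuous_apply i).comp (continuous_fst.comp continuous_snd))
      (continuous_snd.comp continuous_snd)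
  · exact continuous_pi fun i => continuous_pi fun s => Continuous.dotProduct
      (h4.comp continuous_fst)
      (continuous_const.matrix_mulVec (continuous_snd.comp continuous_snd))
  · refine continuousOn_pi.2 fun i => ?_
    have hT : Continuous fun y : Fin l → ℝ => T.mulVec y := by fun_prop
    refine hT.comp_continuousOn (continuousOn_pi.2 fun j => ?_)
    have hd : Continuous fun q : (Fin nv → ℝ) × (Fin nv → ℝ) => q.1 ⬝ᵥ q.2 := by fun_prop
    refine hd.comp_continuousOn ((hff i).prodMk (Continuous.continuousOn ?_))
    exact continuous_const.matrix_mulVec (continuous_snd.comp continuous_snd)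

theorem steadyState_add (S : Matrix (Fin nv) (Fin nv) ℝ) (T : Matrix (Fin l) (Fin l) ℝ)
    (p : PlantParam N nv r d) (Z : (i : Fin N) → Fin (d i) → Fin nv → ℝ) (v v' : Fin nv → ℝ) :
    (steadyState S T p Z (v + v') : CState N r l d) =
      steadyState S T p Z v + steadyState S T p Z v' := by
  refine Prod.ext ?_ (Prod.ext ?_ (Prod.ext ?_ ?_))
  · funext i
    exact Matrix.mulVec_add (Matrix.of (Z i)) v v'
  · funext i s
    simp [steadyState, Matrix.mulVec_add, dotProduct_add]
  · funext i
    simp only [steadyState, Prod.snd_add, Prod.fst_add, Pi.add_apply, Matrix.mulVec_add,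
      dotProduct_add]
    exact Matrix.mulVec_add _ _ _
  · simp [steadyState]

theorem steadyState_smul (S : Matrix (Fin nv) (Fin nv) ℝ) (T : Matrix (Fin l) (Fin l) ℝ)
    (p : PlantParam N nv r d) (Z : (i : Fin N) → Fin (d i) → Fin nv → ℝ) (a : ℝ) (v : Fin nv → ℝ) :
    (steadyState S T p Z (a • v) : CState N r l d) = a • steadyState S T p Z v := by
  refine Prod.ext ?_ (Prod.ext ?_ (Prod.ext ?_ ?_))
  · funext i
    exact Matrix.mulVec_smul (Matrix.of (Z i)) a v
  · funext i s
    simp [steadyState, Matrix.mulVec_smul, dotProduct_smul]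
  · funext i
    simp only [steadyState, Prod.smul_snd, Prod.smul_fst, Pi.smul_apply, Matrix.mulVec_smul,
      dotProduct_smul]
    exact Matrix.mulVec_smul T a fun j : Fin l =>
      feedforward S p Z i ⬝ᵥ (S ^ (j : ℕ)).mulVec v
  · simp [steadyState]

/-- The steady state as a continuous linear map of the state of the exosystem. -/
def steadyCLM (S : Matrix (Fin nv) (Fin nv) ℝ) (T : Matrix (Fin l) (Fin l) ℝ)
    (p : PlantParam N nv r d) (Z : (i : Fin N) → Fin (d i) → Fin nv → ℝ) :
    (Fin nv → ℝ) →L[ℝ] CState N r l d :=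
  LinearMap.toContinuousLinearMap
    { toFun := steadyState S T p Z
      map_add' := steadyState_add S T p Z
      map_smul' := steadyState_smul S T p Z }

variable [NeZero r]

theorem nodeOutput_steadyState (S : Matrix (Fin nv) (Fin nv) ℝ) (T : Matrix (Fin l) (Fin l) ℝ)
    (p : PlantParam N nv r d) (Z : (i : Fin N) → Fin (d i) → Fin nv → ℝ) (v : Fin nv → ℝ)
    (k : Fin (N + 1)) :
    nodeOutput p ((v, steadyState S T p Z v) : LoopState N nv r l d) k = coefF p ⬝ᵥ v := by
  refine Fin.cases ?_ (fun i => ?_) k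
  · rfl
  · simp [nodeOutput, stXi, steadyState]

/-- The steady state is invariant under the closed loop. -/
theorem loopField_steadyState {S : Matrix (Fin nv) (Fin nv) ℝ} (hl : l = (minpoly ℝ S).natDegree)
    (G : Digraph (Fin (N + 1))) {c : Controller r l} {p : PlantParam N nv r d}
    (hb : ∀ i, coefB p i ≠ 0) (hTu : IsUnit c.T)
    (hT : c.T * companionPhi S l - c.M * c.T = Matrix.vecMulVec c.Q (rowGamma l))
    {Z : (i : Fin N) → Fin (d i) → Fin nv → ℝ} (hZ : IsZeroDynamicsSteady S p Z) (v : Fin nv → ℝ) :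
    loopField S G c p (v, steadyState S c.T p Z v) (fun _ => (v, steadyState S c.T p Z v)) =
      (S.mulVec v, steadyState S c.T p Z (S.mulVec v)) := by
  have hpow : ∀ k : ℕ, (S ^ k).mulVec (S.mulVec v) = (S ^ (k + 1)).mulVec v := fun k => by
    rw [Matrix.mulVec_mulVec, pow_succ]
  -- The minimal polynomial annihilates `S`: the top derivative of the steady state input is
  -- expressed by the lower ones with the entries of the last row of `Φ`.
  have hmin : (S ^ l).mulVec v =
      - ∑ k : Fin l, (minpoly ℝ S).coeff k • (S ^ (k : ℕ)).mulVec v := by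
    have h1 := minpoly.aeval ℝ S
    rw [Polynomial.aeval_eq_sum_range, Finset.sum_range_succ, ← hl] at h1
    have h2 : (minpoly ℝ S).coeff l = 1 := by
      rw [hl]
      exact minpoly.monic (Matrix.isIntegral S)
    rw [h2, one_smul, Finset.sum_range] at h1
    have h3 := congrArg (fun B : Matrix (Fin nv) (Fin nv) ℝ => B.mulVec v) h1
    simp only [Matrix.add_mulVec, Matrix.zero_mulVec, Matrix.sum_mulVec, Matrix.smul_mulVec] at h3
    exact eq_neg_of_add_eq_zero_right h3
  set o : Fin N → Fin l → ℝ := fun i j => feedforward S p Z i ⬝ᵥ (S ^ (j : ℕ)).mulVec v with ho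
  have hΓo : ∀ i, rowGamma l ⬝ᵥ o i = feedforward S p Z i ⬝ᵥ v := by
    intro i
    -- Degree zero means that the minimal polynomial is `1`, so `1 = 0` as matrices and `v = 0`;
    -- there `Γ` has no first entry.
    rcases Nat.eq_zero_or_pos l with h0 | h0
    · have hS1 : minpoly ℝ S = 1 :=
        (minpoly.monic (Matrix.isIntegral S)).natDegree_eq_zero.1 (by omega)
      have h1 := minpoly.aeval ℝ S
      rw [hS1, map_one] at h1
      have hv : v = 0 := by
        rw [← Matrix.one_mulVec v, h1, Matrix.zero_mulVec]
      rw [hv, dotProduct_zero]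
      subst h0
      simp
    · rw [dotProduct, Finset.sum_eq_single ⟨0, h0⟩]
      · simp [rowGamma, ho]
      · intro j _ hj
        have : (j : ℕ) ≠ 0 := fun h => hj (Fin.ext h)
        simp [rowGamma, this]
      · simp
  have hu : ∀ i, controlInput c ((v, steadyState S c.T p Z v) : LoopState N nv r l d) i =
      feedforward S p Z i ⬝ᵥ v := by
    intro i
    have h1 : stEta ((v, steadyState S c.T p Z v) : LoopState N nv r l d) i = c.T.mulVec (o i) := rfl
    have h2 : stZeta ((v, steadyState S c.T p Z v) : LoopState N nv r l d) i = 0 := rfl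
    have h3 : c.T⁻¹ * c.T = 1 :=
      Matrix.nonsing_inv_mul _ ((Matrix.isUnit_iff_isUnit_det _).1 hTu)
    rw [controlInput, h1, h2, dotProduct_zero, mul_zero, sub_zero, rowGammaTinv,
      Matrix.dotProduct_mulVec, Matrix.vecMul_vecMul, h3, Matrix.vecMul_one, hΓo]
  -- `Φ` acts on the tuple of derivatives of the steady state input as time differentiation, that is
  -- by replacing `v` with `S v`.
  have hΦ : ∀ i, (companionPhi S l).mulVec (o i) =
      fun j : Fin l => feedforward S p Z i ⬝ᵥ (S ^ (j : ℕ)).mulVec (S.mulVec v) := by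
    intro i
    funext j
    rw [companionPhi_mulVec, hpow]
    split_ifs with h
    · rfl
    · have hj : (j : ℕ) + 1 = l := by omega
      rw [hj, hmin, dotProduct_neg, dotProduct_sum]
      simp only [dotProduct_smul, smul_eq_mul, ho]
  refine Prod.ext rfl (Prod.ext ?_ (Prod.ext ?_ (Prod.ext ?_ ?_)))
  · funext i
    have h1 := congrArg (fun B : Matrix (Fin (d i)) (Fin nv) ℝ => B.mulVec v) (hZ i)
    simp only [Matrix.sub_mulVec, Matrix.add_mulVec, ← Matrix.mulVec_mulVec,
      Matrix.vecMulVec_mulVec] at h1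
    rw [sub_eq_iff_eq_add'] at h1
    have h2 : stXi ((v, steadyState S c.T p Z v) : LoopState N nv r l d) i 0 = coefF p ⬝ᵥ v := by
      simp [stXi, steadyState]
    change (coefA1 p i).mulVec ((Matrix.of (Z i)).mulVec v) +
      stXi ((v, steadyState S c.T p Z v) : LoopState N nv r l d) i 0 • coefA2 p i +
      (coefE0 p i).mulVec v = (Matrix.of (Z i)).mulVec (S.mulVec v)
    rw [h1, h2, add_assoc]
    simp
  · funext i q
    simp only [loopField, hu]
    have h0 : ∀ s : Fin r, stXi ((v, steadyState S c.T p Z v) : LoopState N nv r l d) i s =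
        coefF p ⬝ᵥ (S ^ (s : ℕ)).mulVec v := fun s => rfl
    have h1 : (steadyState S c.T p Z (S.mulVec v)).2.1 i q =
        coefF p ⬝ᵥ (S ^ ((q : ℕ) + 1)).mulVec v := by
      rw [← hpow]
      rfl
    rw [h1]
    split_ifs with hq
    · rw [h0]
    · have hq' : (q : ℕ) + 1 = r := by omega
      have h2 : stZ ((v, steadyState S c.T p Z v) : LoopState N nv r l d) i =
        (Matrix.of (Z i)).mulVec v := rfl
      have h3 : stV ((v, steadyState S c.T p Z v) : LoopState N nv r l d) = v := rfl
      have h4 : coefC p i ⬝ᵥ stXi ((v, steadyState S c.T p Z v) : LoopState N nv r l d) i =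
        ∑ s : Fin r, coefC p i s * (coefF p ⬝ᵥ (S ^ (s : ℕ)).mulVec v) := rfl
      rw [h2, h3, h4, hq', feedforward, smul_dotProduct, smul_eq_mul, mul_inv_cancel_left₀ (hb i),
        sub_dotProduct, sub_dotProduct, sub_dotProduct, sum_dotProduct]
      simp only [smul_dotProduct, smul_eq_mul, ← Matrix.dotProduct_mulVec]
      ring
  · funext i
    change c.M.mulVec (c.T.mulVec (o i)) + controlInput c _ i • c.Q = c.T.mulVec _
    rw [hu, ← hΦ, Matrix.mulVec_mulVec, Matrix.mulVec_mulVec, sub_eq_iff_eq_add'.1 hT,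
      Matrix.add_mulVec, Matrix.vecMulVec_mulVec, hΓo]
    simp
  · funext i
    have h1 : virtualOutput G p ((v, steadyState S c.T p Z v) : LoopState N nv r l d) i = 0 := by
      simp [virtualOutput, nodeOutput_steadyState]
    change (matAo c.δc c.h).mulVec 0 + virtualOutput G p _ i • vecBo c.δc c.h = 0
    rw [h1]
    simp

/-- The dynamics of the deviation from the steady state. -/
theorem flat_loopField_sub_steadyState {S : Matrix (Fin nv) (Fin nv) ℝ}
    (hl : l = (minpoly ℝ S).natDegree)
    (G : Digraph (Fin (N + 1))) {c : Controller r l} {p : PlantParam N nv r d}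
    (hb : ∀ i, coefB p i ≠ 0) (hTu : IsUnit c.T)
    (hT : c.T * companionPhi S l - c.M * c.T = Matrix.vecMulVec c.Q (rowGamma l))
    {Z : (i : Fin N) → Fin (d i) → Fin nv → ℝ} (hZ : IsZeroDynamicsSteady S p Z)
    (x : LoopState N nv r l d) (s : Fin N → LoopState N nv r l d) :
    flat ((loopField S G c p x s).2 - steadyState S c.T p Z (S.mulVec x.1)) =
      (matAc G c p).mulVec (flat (x.2 - steadyState S c.T p Z x.1)) +
      flat (loopField S G c p x s - loopField S G c p x (fun _ => x)).2 := by
  have h1 := loopField_steadyState hl G hb hTu hT hZ x.1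
  have h2 := loopField_sub S G c p x (x.1, steadyState S c.T p Z x.1) (fun _ => x)
    (fun _ => (x.1, steadyState S c.T p Z x.1))
  have h3 : x - (x.1, steadyState S c.T p Z x.1) = (0, x.2 - steadyState S c.T p Z x.1) :=
    Prod.ext (sub_self _) rfl
  have h4 : ((fun _ => x) - (fun _ => (x.1, steadyState S c.T p Z x.1)) :
      Fin N → LoopState N nv r l d) = fun _ => (0, x.2 - steadyState S c.T p Z x.1) :=
    funext fun _ => h3
  rw [h3, h4, h1] at h2
  rw [← flat_loopField_zero S, h2, ← flat_add]
  congr 1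
  simp only [Prod.snd_sub]
  abel

end Steady

/-! ### Flows with frozen samples -/

/-- The affine equation becomes linear after adjoining a coordinate that stays equal to `1`, and is
then solved by the operator exponential. -/
theorem exists_affine_solution {E : Type*} [NormedAddCommGroup E] [NormedSpace ℝ E]
    [CompleteSpace E] (L : E →L[ℝ] E) (b : E) (t₀ : ℝ) (x₀ : E) :
    ∃ y : ℝ → E, y t₀ = x₀ ∧ ∀ t, HasDerivAt y (L (y t) + b) t := by
  let A : (E × ℝ) →L[ℝ] (E × ℝ) :=
    ((L.comp (ContinuousLinearMap.fst ℝ E ℝ)) + (ContinuousLinearMap.snd ℝ E ℝ).smulRight b).prod 0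
  let Y : ℝ → E × ℝ := fun t => NormedSpace.exp ((t - t₀) • A) (x₀, 1)
  have hY : ∀ t, HasDerivAt Y (A (Y t)) t := by
    intro t
    have h1 := (hasDerivAt_exp_smul_const' (𝕂 := ℝ) A (t - t₀)).comp_sub_const t t₀
    have h2 := h1.clm_apply (hasDerivAt_const t ((x₀, 1) : E × ℝ))
    simpa using h2
  have h2 : ∀ t, (Y t).2 = 1 := by
    have hd : ∀ t, HasDerivAt (fun t => (Y t).2) 0 t := fun t => by
      have := (ContinuousLinearMap.snd ℝ E ℝ).hasFDerivAt.comp_hasDerivAt t (hY t)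
      have h0 : (ContinuousLinearMap.snd ℝ E ℝ) (A (Y t)) = 0 := by simp [A]
      rw [h0] at this
      exact this
    intro t
    have h3 := is_const_of_deriv_eq_zero (fun t => (hd t).differentiableAt)
      (fun t => (hd t).deriv) t t₀
    rw [h3]
    simp [Y]
  refine ⟨fun t => (Y t).1, by simp [Y], fun t => ?_⟩
  have := (ContinuousLinearMap.fst ℝ E ℝ).hasFDerivAt.comp_hasDerivAt t (hY t)
  have h3 : (ContinuousLinearMap.fst ℝ E ℝ) (A (Y t)) = L (Y t).1 + b := by
    simp [A, h2]
  rw [h3] at this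
  exact this

section Loop

variable {N nv r l : ℕ} {d : Fin N → ℕ} [NeZero r]
variable {S : Matrix (Fin nv) (Fin nv) ℝ} {G : Digraph (Fin (N + 1))} {c : Controller r l}
  {g : Trigger} {p : PlantParam N nv r d}

theorem loopField_eq_affine (S : Matrix (Fin nv) (Fin nv) ℝ) (G : Digraph (Fin (N + 1)))
    (c : Controller r l) (p : PlantParam N nv r d) (x : LoopState N nv r l d)
    (s : Fin N → LoopState N nv r l d) :
    loopField S G c p x s = (loopFieldCLM S G c p).comp (ContinuousLinearMap.inl ℝ _ _) x +
      loopFieldCLM S G c p (0, s) := by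
  rw [ContinuousLinearMap.comp_apply, ContinuousLinearMap.inl_apply, ← map_add]
  simp [loopFieldCLM_apply]

theorem exists_frozen_flow (S : Matrix (Fin nv) (Fin nv) ℝ) (G : Digraph (Fin (N + 1)))
    (c : Controller r l) (p : PlantParam N nv r d) (s : Fin N → LoopState N nv r l d) (t₀ : ℝ)
    (x₀ : LoopState N nv r l d) :
    ∃ φ : ℝ → LoopState N nv r l d, φ t₀ = x₀ ∧
      ∀ t, HasDerivAt φ (loopField S G c p (φ t) s) t := by
  simp only [loopField_eq_affine]
  exact exists_affine_solution _ _ t₀ x₀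

theorem frozen_flow_unique {s : Fin N → LoopState N nv r l d} {a b : ℝ}
    {x y : ℝ → LoopState N nv r l d}
    (hx : ContinuousOn x (Set.Icc a b)) (hy : ContinuousOn y (Set.Icc a b))
    (hx' : ∀ t ∈ Set.Ico a b, HasDerivWithinAt x (loopField S G c p (x t) s) (Set.Ici t) t)
    (hy' : ∀ t ∈ Set.Ico a b, HasDerivWithinAt y (loopField S G c p (y t) s) (Set.Ici t) t)
    (h : x a = y a) : Set.EqOn x y (Set.Icc a b) := by
  refine ODE_solution_unique_of_mem_Icc_right (s := fun _ => Set.univ)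
    (v := fun _ z => loopField S G c p z s)
    (K := ‖(loopFieldCLM S G c p).comp (ContinuousLinearMap.inl ℝ _ _)‖₊) (fun t _ => ?_) hx hx'
    (fun _ _ => Set.mem_univ _) hy hy' (fun _ _ => Set.mem_univ _) h
  refine LipschitzWith.lipschitzOnWith (LipschitzWith.of_dist_le_mul fun z z' => ?_)
  rw [loopField_eq_affine, loopField_eq_affine, dist_add_right]
  exact ContinuousLinearMap.lipschitz _ |>.dist_le_mul z z'

/-! ### Continuity of the triggering condition -/

theorem continuous_virtualOutput (G : Digraph (Fin (N + 1))) (p : PlantParam N nv r d) (i : Fin N) :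
    Continuous fun x : LoopState N nv r l d => virtualOutput G p x i :=
  LinearMap.continuous_of_finiteDimensional
    { toFun := fun x : LoopState N nv r l d => virtualOutput G p x i
      map_add' := fun x y => virtualOutput_add G p x y i
      map_smul' := fun a x => virtualOutput_smul G p a x i }

theorem continuous_sampleErrorSq (G : Digraph (Fin (N + 1))) (p : PlantParam N nv r d)
    (s : LoopState N nv r l d) (i : Fin N) :
    Continuous fun x : LoopState N nv r l d => sampleErrorSq G p s x i := by
  have h1 := continuous_virtualOutput (l := l) G p i
  unfold sampleErrorSq sqNorm stEta stZeta
  fun_prop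

theorem continuous_threshold (G : Digraph (Fin (N + 1))) (p : PlantParam N nv r d)
    (g : Trigger) (i : Fin N) :
    Continuous fun q : ℝ × LoopState N nv r l d => threshold G p g q.1 q.2 i := by
  have h1 := continuous_virtualOutput (l := l) G p i
  unfold threshold sqNorm stZeta
  fun_prop

theorem sampleErrorSq_self (G : Digraph (Fin (N + 1))) (p : PlantParam N nv r d)
    (x : LoopState N nv r l d) (i : Fin N) : sampleErrorSq G p x x i = 0 := by
  simp [sampleErrorSq, sqNorm]

/-- The signs of the design parameters. -/
structure Trigger.IsPositive (g : Trigger) : Prop where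
  sigmaBar : 0 ≤ g.sigmaBar
  β : 0 < g.β
  δ : 0 < g.δ

/-- The state-independent floor of the threshold is what excludes Zeno behavior, also when the other
terms become small. -/
theorem Trigger.IsPositive.delta_lt_threshold (hg : g.IsPositive) (t : ℝ)
    (x : LoopState N nv r l d) (i : Fin N) : g.δ < threshold G p g t x i := by
  have h1 := mul_nonneg hg.sigmaBar
    (add_nonneg (sqNorm_nonneg (stZeta x i)) (sq_nonneg (virtualOutput G p x i)))
  have h2 := mul_pos hg.β (Real.exp_pos (-g.α * t))
  unfold threshold
  linarith

theorem Trigger.IsPositive.threshold_pos (hg : g.IsPositive) (t : ℝ)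
    (x : LoopState N nv r l d) (i : Fin N) : 0 < threshold G p g t x i :=
  hg.δ.trans (hg.delta_lt_threshold t x i)

/-! ### Event times -/

variable {Tend : EReal} {x y : ℝ → LoopState N nv r l d} {i : Fin N}

/-- The instants at which the event after the one at the time `E` may occur. -/
def triggerSet (G : Digraph (Fin (N + 1))) (p : PlantParam N nv r d) (g : Trigger)
    (Tend : EReal) (x : ℝ → LoopState N nv r l d) (i : Fin N) (E : EReal) : Set ℝ :=
  {t : ℝ | E < (t : EReal) ∧ (t : EReal) < Tend ∧
    threshold G p g t (x t) i ≤ sampleErrorSq G p (x E.toReal) (x t) i}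

theorem eventTime_succ (k : ℕ) : eventTime G p g Tend x i (k + 1) =
    sInf ((fun t : ℝ => (t : EReal)) ''
      triggerSet G p g Tend x i (eventTime G p g Tend x i k)) := rfl

theorem eventTime_le_succ (k : ℕ) :
    eventTime G p g Tend x i k ≤ eventTime G p g Tend x i (k + 1) := by
  rw [eventTime_succ]
  refine le_sInf ?_
  rintro _ ⟨t, ht, rfl⟩
  exact ht.1.le

theorem eventTime_monotone : Monotone (eventTime G p g Tend x i) :=
  monotone_nat_of_le_succ eventTime_le_succ

theorem eventTime_nonneg (k : ℕ) : 0 ≤ eventTime G p g Tend x i k :=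
  eventTime_monotone (Nat.zero_le k)

theorem eventTime_succ_eq_top {k : ℕ}
    (h : triggerSet G p g Tend x i (eventTime G p g Tend x i k) = ∅) :
    eventTime G p g Tend x i (k + 1) = ⊤ := by
  rw [eventTime_succ, h, Set.image_empty, sInf_empty]

theorem eventTime_lt_of_ne_top (hT : 0 < Tend) {k : ℕ} (h : eventTime G p g Tend x i k ≠ ⊤) :
    eventTime G p g Tend x i k < Tend := by
  cases k with
  | zero => exact hT
  | succ k =>
    rw [eventTime_succ] at h ⊢
    rcases Set.eq_empty_or_nonempty
      (triggerSet G p g Tend x i (eventTime G p g Tend x i k)) with h0 | ⟨t, ht⟩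
    · rw [h0, Set.image_empty, sInf_empty] at h
      exact absurd rfl h
    · exact (sInf_le (Set.mem_image_of_mem _ ht)).trans_lt ht.2.1

theorem coe_toReal_eventTime {k : ℕ} (h : eventTime G p g Tend x i k ≠ ⊤) :
    (((eventTime G p g Tend x i k).toReal : ℝ) : EReal) = eventTime G p g Tend x i k :=
  EReal.coe_toReal h (ne_of_gt (lt_of_lt_of_le EReal.bot_lt_zero (eventTime_nonneg k)))

theorem toReal_eventTime_nonneg (k : ℕ) : 0 ≤ (eventTime G p g Tend x i k).toReal :=
  EReal.toReal_nonneg (eventTime_nonneg k)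

theorem eventually_coe_lt {t : ℝ} {T : EReal} (h : (t : EReal) < T) :
    ∀ᶠ u : ℝ in 𝓝 t, (u : EReal) < T :=
  (continuous_coe_real_ereal.tendsto t).eventually_lt_const h

theorem mem_nhdsGE_domain {t : ℝ} (ht0 : 0 ≤ t) (ht : (t : EReal) < Tend) :
    {u : ℝ | 0 ≤ u ∧ (u : EReal) < Tend} ∈ 𝓝[≥] t := by
  filter_upwards [self_mem_nhdsWithin, mem_nhdsWithin_of_mem_nhds (eventually_coe_lt ht)]
    with u hu hu'
  exact ⟨ht0.trans hu, hu'⟩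

theorem exists_sampleErrorSq_lt_threshold {s : LoopState N nv r l d} {t : ℝ}
    (hxt : ContinuousWithinAt x (Set.Ici t) t)
    (hlt : sampleErrorSq G p s (x t) i < threshold G p g t (x t) i) :
    ∃ b, t < b ∧ ∀ u, t ≤ u → u < b → sampleErrorSq G p s (x u) i < threshold G p g u (x u) i := by
  have h1 : ContinuousWithinAt (fun u => sampleErrorSq G p s (x u) i) (Set.Ici t) t :=
    (continuous_sampleErrorSq G p s i).continuousAt.comp_continuousWithinAt hxt
  have h2 : ContinuousWithinAt (fun u => threshold G p g u (x u) i) (Set.Ici t) t :=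
    (continuous_threshold G p g i).continuousAt.comp_continuousWithinAt (f := fun u => (u, x u))
      (continuousWithinAt_id.prodMk hxt)
  have h3 : ∀ᶠ u in 𝓝[≥] t, sampleErrorSq G p s (x u) i < threshold G p g u (x u) i :=
    Tendsto.eventually_lt h1 h2 hlt
  rw [Filter.Eventually, mem_nhdsGE_iff_exists_Ico_subset] at h3
  obtain ⟨b, hb, hb'⟩ := h3
  exact ⟨b, hb, fun u hu hub => hb' ⟨hu, hub⟩⟩

/-- If no triggering instant were at most `t`, the condition would fail at `t` itself, including the
case where `t` is the previous event and the error is zero. By right continuity it would fail on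
some `[t, b)`, contradicting that the infimum is below `b`. -/
theorem exists_mem_triggerSet_le (hg : g.IsPositive)
    (hx : ContinuousOn x {t : ℝ | 0 ≤ t ∧ (t : EReal) < Tend}) {t : ℝ} (ht : (t : EReal) < Tend)
    {k : ℕ} (hk : eventTime G p g Tend x i (k + 1) ≤ t) :
    ∃ u ∈ triggerSet G p g Tend x i (eventTime G p g Tend x i k), u ≤ t := by
  by_contra hne
  push Not at hne
  have ht0 : 0 ≤ t := by exact_mod_cast (eventTime_nonneg (k + 1)).trans hk
  have hkt : eventTime G p g Tend x i k ≤ t := (eventTime_le_succ k).trans hk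
  have hxt : ContinuousWithinAt x (Set.Ici t) t :=
    (hx t ⟨ht0, ht⟩).mono_of_mem_nhdsWithin (mem_nhdsGE_domain ht0 ht)
  have hlt : sampleErrorSq G p (x (eventTime G p g Tend x i k).toReal) (x t) i <
      threshold G p g t (x t) i := by
    rcases hkt.lt_or_eq with h1 | h1
    · exact not_le.1 fun hle => lt_irrefl t (hne t ⟨h1, ht, hle⟩)
    · rw [h1, EReal.toReal_coe, sampleErrorSq_self]
      exact hg.threshold_pos t (x t) i
  obtain ⟨b, hb, hb'⟩ := exists_sampleErrorSq_lt_threshold hxt hlt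
  have h3 : eventTime G p g Tend x i (k + 1) < b := hk.trans_lt (EReal.coe_lt_coe_iff.2 hb)
  rw [eventTime_succ, sInf_lt_iff] at h3
  obtain ⟨_, ⟨u, hu, rfl⟩, hub⟩ := h3
  have h4 : sampleErrorSq G p (x (eventTime G p g Tend x i k).toReal) (x u) i <
      threshold G p g u (x u) i :=
    hb' u (hne u hu).le (EReal.coe_lt_coe_iff.1 hub)
  exact absurd hu.2.2 (not_le.2 h4)

/-- The event times up to `t` depend only on the curve up to `t`. -/
theorem eventTime_congr (hg : g.IsPositive) {Tx Ty : EReal}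
    (hx : ContinuousOn x {t : ℝ | 0 ≤ t ∧ (t : EReal) < Tx}) {t : ℝ} (htx : (t : EReal) < Tx)
    (hty : (t : EReal) < Ty) (hxy : Set.EqOn x y (Set.Icc 0 t)) {k : ℕ}
    (hk : eventTime G p g Tx x i k ≤ t) : eventTime G p g Ty y i k = eventTime G p g Tx x i k := by
  induction k with
  | zero => rfl
  | succ k ih =>
    have hkt : eventTime G p g Tx x i k ≤ t := (eventTime_le_succ k).trans hk
    have ih := ih hkt
    set E := eventTime G p g Tx x i k with hE
    have hE0 : 0 ≤ E := eventTime_nonneg k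
    have hEt : E.toReal ∈ Set.Icc 0 t := by
      refine ⟨toReal_eventTime_nonneg k, ?_⟩
      have h1 : (((E.toReal : ℝ)) : EReal) = E :=
        coe_toReal_eventTime (ne_top_of_le_ne_top (EReal.coe_ne_top t) hkt)
      rw [← h1] at hkt
      exact_mod_cast hkt
    have hiff : ∀ u ≤ t, u ∈ triggerSet G p g Tx x i E ↔ u ∈ triggerSet G p g Ty y i E := by
      intro u hu
      have hu' : (u : EReal) ≤ t := by exact_mod_cast hu
      simp only [triggerSet, Set.mem_ofPred_eq, hu'.trans_lt htx, hu'.trans_lt hty, true_and]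
      refine and_congr_right fun h => ?_
      have hu0 : 0 ≤ u := by exact_mod_cast hE0.trans h.le
      rw [hxy ⟨hu0, hu⟩, hxy hEt]
    obtain ⟨u, hu, hut⟩ := exists_mem_triggerSet_le hg hx htx hk
    rw [eventTime_succ, eventTime_succ, ih, ← hE]
    -- Since a triggering instant `u ≤ t` exists, instants beyond `t`, where the two curves may
    -- differ, do not affect the infimum.
    have hle : ∀ {A B : Set ℝ}, (∀ u ≤ t, u ∈ A → u ∈ B) → u ∈ A →
        sInf ((fun t : ℝ => (t : EReal)) '' B) ≤ sInf ((fun t : ℝ => (t : EReal)) '' A) := by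
      intro A B hAB huA
      refine le_sInf ?_
      rintro _ ⟨q, hq, rfl⟩
      rcases le_or_gt q t with hqt | hqt
      · exact sInf_le (Set.mem_image_of_mem _ (hAB q hqt hq))
      · refine (sInf_le (Set.mem_image_of_mem _ (hAB u hut huA))).trans ?_
        exact EReal.coe_le_coe_iff.2 (hut.trans hqt.le)
    exact le_antisymm (hle (fun u hu => (hiff u hu).1) hu)
      (hle (fun u hu => (hiff u hu).2) ((hiff u hut).1 hu))

/-- The inter-event interval that contains `t` depends only on the curve up to `t`. -/
theorem eventInterval_congr (hg : g.IsPositive) {Tx Ty : EReal}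
    (hx : ContinuousOn x {t : ℝ | 0 ≤ t ∧ (t : EReal) < Tx})
    (hy : ContinuousOn y {t : ℝ | 0 ≤ t ∧ (t : EReal) < Ty})
    {t : ℝ} (htx : (t : EReal) < Tx) (hty : (t : EReal) < Ty) (hxy : Set.EqOn x y (Set.Icc 0 t))
    {k : ℕ} (hk : eventTime G p g Tx x i k ≤ t ∧ (t : EReal) < eventTime G p g Tx x i (k + 1)) :
    eventTime G p g Ty y i k = eventTime G p g Tx x i k ∧ eventTime G p g Ty y i k ≤ t ∧
      (t : EReal) < eventTime G p g Ty y i (k + 1) ∧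
      x (eventTime G p g Tx x i k).toReal = y (eventTime G p g Ty y i k).toReal := by
  have h1 := eventTime_congr hg hx htx hty hxy hk.1
  refine ⟨h1, h1.trans_le hk.1, ?_, ?_⟩
  · by_contra h2
    push Not at h2
    have h3 := eventTime_congr hg hy hty htx hxy.symm h2
    rw [h3] at hk
    exact absurd h2 (not_le.2 hk.2)
  · rw [h1]
    refine hxy ⟨toReal_eventTime_nonneg k, ?_⟩
    have h4 := coe_toReal_eventTime (ne_top_of_le_ne_top (EReal.coe_ne_top t) hk.1)
    have h5 := hk.1
    rw [← h4] at h5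
    exact_mod_cast h5

theorem eventInterval_unique {t : EReal} {k k' : ℕ}
    (h : eventTime G p g Tend x i k ≤ t ∧ t < eventTime G p g Tend x i (k + 1))
    (h' : eventTime G p g Tend x i k' ≤ t ∧ t < eventTime G p g Tend x i (k' + 1)) : k = k' := by
  rcases lt_trichotomy k k' with hlt | heq | hlt
  · exact absurd ((h.2.trans_le (eventTime_monotone hlt)).trans_le h'.1) (lt_irrefl _)
  · exact heq
  · exact absurd ((h'.2.trans_le (eventTime_monotone hlt)).trans_le h.1) (lt_irrefl _)

end Loop

section Loop

variable {N nv r l : ℕ} {d : Fin N → ℕ} [NeZero r]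
variable {S : Matrix (Fin nv) (Fin nv) ℝ} {G : Digraph (Fin (N + 1))} {c : Controller r l}
  {g : Trigger} {p : PlantParam N nv r d} {x₀ : LoopState N nv r l d}

/-! ### Uniqueness of trajectories -/

theorem IsTrajectory.hasDerivWithinAt_of_lt {Tend : EReal} {x : ℝ → LoopState N nv r l d}
    (hx : IsTrajectory S G c g p Tend x₀ x) {t u : ℝ} (ht : 0 ≤ t) (htu : t ≤ u)
    (hu : (u : EReal) < Tend) {k : Fin N → ℕ} (hk : ∀ i, eventTime G p g Tend x i (k i) ≤ t)
    (hk' : ∀ i, (u : EReal) < eventTime G p g Tend x i (k i + 1)) :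
    HasDerivWithinAt x
      (loopField S G c p (x u) fun i => x (eventTime G p g Tend x i (k i)).toReal)
      (Set.Ici u) u :=
  hx.ode u (ht.trans htu) hu k fun i =>
    ⟨(hk i).trans (EReal.coe_le_coe_iff.2 htu), hk' i⟩

/-- Continuous induction. Where two trajectories agree up to `t`, they have the same last events and
samples. Until the next event they solve the same equation with frozen samples, so they agree
slightly beyond `t`; the agreement set is closed. -/
theorem IsTrajectory.eqOn (hg : g.IsPositive) {Tx Ty : EReal} {x y : ℝ → LoopState N nv r l d}
    (hx : IsTrajectory S G c g p Tx x₀ x) (hy : IsTrajectory S G c g p Ty x₀ y) {b : ℝ}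
    (hbx : (b : EReal) < Tx) (hby : (b : EReal) < Ty) :
    Set.EqOn x y (Set.Icc 0 b) := by
  have hsub : ∀ {T : EReal}, (b : EReal) < T → ∀ {a}, 0 ≤ a → ∀ {b'}, b' ≤ b →
      Set.Icc a b' ⊆ {t : ℝ | 0 ≤ t ∧ (t : EReal) < T} := fun h a ha b' hb' t ht =>
    ⟨ha.trans ht.1, (EReal.coe_le_coe_iff.2 (ht.2.trans hb')).trans_lt h⟩
  have hcx := hx.cont.mono (hsub hbx le_rfl le_rfl)
  have hcy := hy.cont.mono (hsub hby le_rfl le_rfl)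
  have hcl : IsClosed ({t | x t = y t} ∩ Set.Icc 0 b) := by
    have := (hcx.prodMk hcy).preimage_isClosed_of_isClosed isClosed_Icc
      (isClosed_diagonal (X := LoopState N nv r l d))
    convert this using 1
    ext t
    simp [and_comm]
  refine hcl.Icc_subset_of_forall_mem_nhdsGT_of_Icc_subset (hx.init.trans hy.init.symm) ?_
  intro t ht hts
  have htx : (t : EReal) < Tx := (EReal.coe_lt_coe_iff.2 ht.2).trans hbx
  have hty : (t : EReal) < Ty := (EReal.coe_lt_coe_iff.2 ht.2).trans hby
  choose k hk using hx.cover t ht.1 htx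
  have hk' := fun i => eventInterval_congr hg hx.cont hy.cont htx hty hts (hk i)
  have hev : ∀ᶠ u : ℝ in 𝓝 t, ∀ i, (u : EReal) < eventTime G p g Tx x i (k i + 1) ∧
      (u : EReal) < eventTime G p g Ty y i (k i + 1) :=
    eventually_all.2 fun i => (eventually_coe_lt (hk i).2).and (eventually_coe_lt (hk' i).2.2.1)
  have hev' : ∀ᶠ u : ℝ in 𝓝[>] t, (∀ i, (u : EReal) < eventTime G p g Tx x i (k i + 1) ∧
      (u : EReal) < eventTime G p g Ty y i (k i + 1)) ∧ u ∈ Set.Ioo t b :=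
    (hev.filter_mono nhdsWithin_le_nhds).and (Ioo_mem_nhdsGT ht.2)
  obtain ⟨t₁, h1, h2⟩ := hev'.exists
  have hlt : ∀ u ∈ Set.Ico t t₁, (u : EReal) < t₁ := fun u hu => EReal.coe_lt_coe_iff.2 hu.2
  have key : Set.EqOn x y (Set.Icc t t₁) := by
    refine frozen_flow_unique (S := S) (G := G) (c := c) (p := p)
      (s := fun i => x (eventTime G p g Tx x i (k i)).toReal)
      (hx.cont.mono (hsub hbx ht.1 h2.2.le)) (hy.cont.mono (hsub hby ht.1 h2.2.le)) ?_ ?_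
      (hts (Set.right_mem_Icc.2 ht.1))
    · intro u hu
      exact hx.hasDerivWithinAt_of_lt ht.1 hu.1
        ((hlt u hu).trans ((EReal.coe_lt_coe_iff.2 h2.2).trans hbx)) (fun i => (hk i).1)
        fun i => (hlt u hu).trans (h1 i).1
    · intro u hu
      have h3 : (fun i => x (eventTime G p g Tx x i (k i)).toReal) =
          fun i => y (eventTime G p g Ty y i (k i)).toReal := funext fun i => (hk' i).2.2.2
      rw [h3]
      exact hy.hasDerivWithinAt_of_lt ht.1 hu.1
        ((hlt u hu).trans ((EReal.coe_lt_coe_iff.2 h2.2).trans hby)) (fun i => (hk' i).2.1)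
        fun i => (hlt u hu).trans (h1 i).2
  exact mem_of_superset (Ioo_mem_nhdsGT h2.1) fun u hu => key ⟨hu.1.le, hu.2.le⟩

/-! ### Gluing -/

/-- The conditions at `t` involve only the past of the curve and its germ to the right of `t`. They
therefore pass between curves that agree on the common part of their intervals. -/
theorem IsTrajectory.transfer (hg : g.IsPositive) {Tx Ty : EReal} {x y : ℝ → LoopState N nv r l d}
    (hy : IsTrajectory S G c g p Ty x₀ y)
    (hx : ContinuousOn x {t : ℝ | 0 ≤ t ∧ (t : EReal) < Tx})
    (hxy : ∀ u : ℝ, 0 ≤ u → (u : EReal) < Tx → (u : EReal) < Ty → x u = y u)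
    {t : ℝ} (ht : 0 ≤ t) (htx : (t : EReal) < Tx) (hty : (t : EReal) < Ty) :
    (∀ i, ∃ k, eventTime G p g Tx x i k ≤ t ∧ (t : EReal) < eventTime G p g Tx x i (k + 1)) ∧
    ∀ k : Fin N → ℕ, (∀ i, eventTime G p g Tx x i (k i) ≤ t ∧
      (t : EReal) < eventTime G p g Tx x i (k i + 1)) →
      HasDerivWithinAt x
        (loopField S G c p (x t) fun i => x (eventTime G p g Tx x i (k i)).toReal)
        (Set.Ici t) t := by
  have hle : ∀ {T : EReal} {u : ℝ}, u ≤ t → (t : EReal) < T → (u : EReal) < T :=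
    fun hu h => (EReal.coe_le_coe_iff.2 hu).trans_lt h
  have heq : Set.EqOn x y (Set.Icc 0 t) := fun u hu => hxy u hu.1 (hle hu.2 htx) (hle hu.2 hty)
  constructor
  · intro i
    obtain ⟨k, hk⟩ := hy.cover t ht hty i
    have := eventInterval_congr hg hy.cont hx hty htx heq.symm hk
    exact ⟨k, this.2.1, this.2.2.1⟩
  · intro k hk
    have h1 := fun i => eventInterval_congr hg hx hy.cont htx hty heq (hk i)
    have h2 := hy.ode t ht hty k fun i => ⟨(h1 i).2.1, (h1 i).2.2.1⟩
    have h3 : (fun i => x (eventTime G p g Tx x i (k i)).toReal) =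
        fun i => y (eventTime G p g Ty y i (k i)).toReal := funext fun i => (h1 i).2.2.2
    rw [h3, hxy t ht htx hty]
    refine h2.congr_of_eventuallyEq ?_ (hxy t ht htx hty)
    filter_upwards [mem_nhdsGE_domain ht htx, mem_nhdsGE_domain ht hty] with u hu hu'
    exact hxy u hu.1 hu.2 hu'.2

theorem isTrajectory_of_forall_exists (hg : g.IsPositive) {Tend : EReal}
    {x : ℝ → LoopState N nv r l d} (h0 : x 0 = x₀)
    (h : ∀ t : ℝ, 0 ≤ t → (t : EReal) < Tend → ∃ (T' : EReal) (y : ℝ → LoopState N nv r l d),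
      (t : EReal) < T' ∧ IsTrajectory S G c g p T' x₀ y ∧
      ∀ u : ℝ, 0 ≤ u → (u : EReal) < Tend → (u : EReal) < T' → x u = y u) :
    IsTrajectory S G c g p Tend x₀ x := by
  have hc : ContinuousOn x {t : ℝ | 0 ≤ t ∧ (t : EReal) < Tend} := by
    rintro t ⟨ht, htT⟩
    obtain ⟨T', y, htT', hy, hxy⟩ := h t ht htT
    have h1 : ∀ᶠ u : ℝ in 𝓝[{t : ℝ | 0 ≤ t ∧ (t : EReal) < Tend}] t, (u : EReal) < T' :=
      (eventually_coe_lt htT').filter_mono nhdsWithin_le_nhds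
    have h2 : ContinuousWithinAt y {t : ℝ | 0 ≤ t ∧ (t : EReal) < Tend} t := by
      refine (hy.cont t ⟨ht, htT'⟩).mono_of_mem_nhdsWithin ?_
      filter_upwards [h1, self_mem_nhdsWithin] with u hu hu'
      exact ⟨hu'.1, hu⟩
    refine h2.congr_of_eventuallyEq ?_ (hxy t ht htT htT')
    filter_upwards [h1, self_mem_nhdsWithin] with u hu hu'
    exact hxy u hu'.1 hu'.2 hu
  refine ⟨h0, hc, fun t ht htT => ?_, fun t ht htT => ?_⟩
  · obtain ⟨T', y, htT', hy, hxy⟩ := h t ht htT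
    exact (hy.transfer hg hc hxy ht htT htT').1
  · obtain ⟨T', y, htT', hy, hxy⟩ := h t ht htT
    exact (hy.transfer hg hc hxy ht htT htT').2

theorem exists_isTrajectory_of_forall_exists (hg : g.IsPositive) {Tend : EReal}
    (h : ∀ t : ℝ, 0 ≤ t → (t : EReal) < Tend → ∃ (T' : EReal) (y : ℝ → LoopState N nv r l d),
      (t : EReal) < T' ∧ IsTrajectory S G c g p T' x₀ y) :
    ∃ x, IsTrajectory S G c g p Tend x₀ x := by
  classical
  choose! T' Y hT' hY using h
  -- A diagonal definition: the value at `t` is taken from a trajectory that lives beyond `t`, and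
  -- uniqueness makes the choice immaterial. The default `x₀` supplies the initial value even when
  -- the interval is empty.
  refine ⟨fun t => if 0 < t ∧ (t : EReal) < Tend then Y t t else x₀,
    isTrajectory_of_forall_exists hg (by simp) fun t ht htT =>
      ⟨T' t, Y t, hT' t ht htT, hY t ht htT, fun u hu huT huT' => ?_⟩⟩
  rcases hu.eq_or_lt with rfl | hu0
  · simp [(hY t ht htT).init]
  · simp only [hu0, huT, and_self, if_true]
    exact (hY u hu huT).eqOn hg (hY t ht htT) (hT' u hu huT) huT' (Set.right_mem_Icc.2 hu)

end Loop

section Loop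

variable {N nv r l : ℕ} {d : Fin N → ℕ} [NeZero r]
variable {S : Matrix (Fin nv) (Fin nv) ℝ} {G : Digraph (Fin (N + 1))} {c : Controller r l}
  {g : Trigger} {p : PlantParam N nv r d} {x₀ : LoopState N nv r l d}

/-! ### Continuation past a finite time -/

/-- The last event of an agent that has only finitely many events. -/
theorem exists_last_event {Tend : EReal} {x : ℝ → LoopState N nv r l d} {i : Fin N}
    (h : ∃ k, eventTime G p g Tend x i (k + 1) = ⊤) :
    ∃ k, eventTime G p g Tend x i k ≠ ⊤ ∧ eventTime G p g Tend x i (k + 1) = ⊤ := by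
  classical
  refine ⟨Nat.find h, ?_, Nat.find_spec h⟩
  rcases hk : Nat.find h with _ | k
  · exact EReal.zero_ne_top
  · exact Nat.find_min h (by omega)

theorem triggerSet_eq_empty {Tend : EReal} {x : ℝ → LoopState N nv r l d} {i : Fin N} {k : ℕ}
    (h : eventTime G p g Tend x i (k + 1) = ⊤) :
    triggerSet G p g Tend x i (eventTime G p g Tend x i k) = ∅ := by
  rw [Set.eq_empty_iff_forall_notMem]
  intro t ht
  rw [eventTime_succ] at h
  have h1 : sInf ((fun t : ℝ => (t : EReal)) ''
      triggerSet G p g Tend x i (eventTime G p g Tend x i k)) ≤ t :=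
    sInf_le (Set.mem_image_of_mem _ ht)
  rw [h] at h1
  exact EReal.coe_ne_top t (top_le_iff.1 h1)

/-- After the time `T`, agent `i` keeps its last sample unless the triggering condition holds at
`T`. -/
theorem eventTime_continuation (hg : g.IsPositive) {T T' : ℝ} (hTT' : T < T')
    {x y : ℝ → LoopState N nv r l d} {s : LoopState N nv r l d} {i : Fin N}
    (hx : ContinuousOn x {t : ℝ | 0 ≤ t ∧ (t : EReal) < T})
    (hxy : ∀ t, 0 ≤ t → t < T → y t = x t) {k : ℕ} (hk : eventTime G p g T x i k ≠ ⊤)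
    (hk' : eventTime G p g T x i (k + 1) = ⊤)
    (hT : eventTime G p g T x i k < T ∨ k = 0 ∧ T = 0)
    (hs : s = y (eventTime G p g T x i k).toReal ∧
        sampleErrorSq G p s (y T) i < threshold G p g T (y T) i ∨
      s = y T ∧ threshold G p g T (y T) i ≤
        sampleErrorSq G p (y (eventTime G p g T x i k).toReal) (y T) i)
    (hs' : ∀ t, T ≤ t → t < T' → sampleErrorSq G p s (y t) i < threshold G p g t (y t) i) :
    ∃ k', eventTime G p g T' y i k' ≤ T ∧ eventTime G p g T' y i (k' + 1) = ⊤ ∧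
      y (eventTime G p g T' y i k').toReal = s := by
  have hE : eventTime G p g T' y i k = eventTime G p g T x i k := by
    rcases hT with h | ⟨rfl, -⟩
    · have h1 := coe_toReal_eventTime hk
      have h2 : ((eventTime G p g T x i k).toReal : EReal) < T := by rw [h1]; exact h
      refine eventTime_congr hg hx h2 (h2.trans (EReal.coe_lt_coe_iff.2 hTT')) ?_ h1.ge
      intro u hu
      exact (hxy u hu.1 (hu.2.trans_lt (EReal.coe_lt_coe_iff.1 h2))).symm
    · rfl
  have hle : eventTime G p g T x i k ≤ T := by
    rcases hT with h | ⟨rfl, rfl⟩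
    · exact h.le
    · exact le_rfl
  -- Event `k` is the last one before `T` and `y` agrees with `x` there, so a new trigger can only
  -- occur from `T` on.
  have hmem : ∀ t ∈ triggerSet G p g T' y i (eventTime G p g T x i k), T ≤ t := by
    intro t ht
    by_contra hlt
    push Not at hlt
    have h0 : 0 ≤ t := by exact_mod_cast (eventTime_nonneg k).trans ht.1.le
    have h1 : (eventTime G p g T x i k).toReal < t := by
      rw [← EReal.coe_lt_coe_iff, coe_toReal_eventTime hk]; exact ht.1
    have h2 : t ∈ triggerSet G p g T x i (eventTime G p g T x i k) := by
      refine ⟨ht.1, EReal.coe_lt_coe_iff.2 hlt, ?_⟩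
      have := ht.2.2
      rwa [hxy t h0 hlt, hxy _ (toReal_eventTime_nonneg k) (h1.trans hlt)] at this
    rw [triggerSet_eq_empty hk'] at h2
    exact h2
  rcases hs with ⟨hs, -⟩ | ⟨hs, hthr⟩
  · refine ⟨k, hE.trans_le hle, eventTime_succ_eq_top ?_, by rw [hE, hs]⟩
    rw [hE, Set.eq_empty_iff_forall_notMem]
    intro t ht
    have h1 := ht.2.2
    rw [← hs] at h1
    exact absurd h1 (not_le.2 (hs' t (hmem t ht) (EReal.coe_lt_coe_iff.1 ht.2.1)))
  -- Here the condition holds at `T`, so `T` is the event `k + 1`. The degenerate case `T = 0` is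
  -- excluded because the error vanishes at the sampling instant.
  · have hlt : eventTime G p g T x i k < T := by
      rcases hT with h | ⟨rfl, rfl⟩
      · exact h
      · have h1 : y (eventTime G p g ((0 : ℝ) : EReal) x i 0).toReal = y 0 := rfl
        rw [h1, sampleErrorSq_self] at hthr
        exact absurd hthr (not_le.2 (hg.threshold_pos _ _ _))
    have hE' : eventTime G p g T' y i (k + 1) = T := by
      rw [eventTime_succ, hE]
      refine le_antisymm ?_ (le_sInf ?_)
      · exact sInf_le (Set.mem_image_of_mem _
          (show T ∈ triggerSet G p g T' y i (eventTime G p g T x i k) from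
            ⟨hlt, EReal.coe_lt_coe_iff.2 hTT', hthr⟩))
      · rintro _ ⟨t, ht, rfl⟩
        exact EReal.coe_le_coe_iff.2 (hmem t ht)
    refine ⟨k + 1, hE'.le, eventTime_succ_eq_top ?_, by rw [hE', hs, EReal.toReal_coe]⟩
    rw [hE', Set.eq_empty_iff_forall_notMem]
    intro t ht
    have h1 := ht.2.2
    rw [EReal.toReal_coe, ← hs] at h1
    exact absurd h1 (not_le.2 (hs' t (EReal.coe_lt_coe_iff.1 ht.1).le
      (EReal.coe_lt_coe_iff.1 ht.2.1)))

/-- With finitely many events the samples are constant shortly before `T`, so the trajectory follows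
a frozen flow and has a limit at `T`. Agents whose condition holds at this limit are resampled. Then
all errors are strictly below the thresholds, and the new frozen flow runs for a positive time
without events. -/
theorem IsTrajectory.exists_continuation (hg : g.IsPositive) {T : ℝ} (hT : 0 ≤ T)
    {x : ℝ → LoopState N nv r l d} (hx : IsTrajectory S G c g p T x₀ x)
    (hfin : ∀ i, ∃ k, eventTime G p g T x i (k + 1) = ⊤) :
    ∃ T' : ℝ, T < T' ∧ ∃ y, IsTrajectory S G c g p T' x₀ y := by
  classical
  choose k hk hk' using fun i => exists_last_event (hfin i)
  have hkT : ∀ i, eventTime G p g T x i (k i) < T ∨ k i = 0 ∧ T = 0 := by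
    intro i
    rcases hT.eq_or_lt with rfl | hT
    · refine Or.inr ⟨?_, rfl⟩
      by_contra h0
      obtain ⟨j, hj⟩ := Nat.exists_eq_succ_of_ne_zero h0
      have h1 := hk i
      rw [hj, eventTime_succ] at h1
      refine h1 ?_
      have h2 : triggerSet G p g ((0 : ℝ) : EReal) x i
          (eventTime G p g ((0 : ℝ) : EReal) x i j) = ∅ := by
        rw [Set.eq_empty_iff_forall_notMem]
        intro t ht
        exact absurd ((eventTime_nonneg j).trans_lt ht.1) (not_lt.2 ht.2.1.le)
      rw [h2, Set.image_empty, sInf_empty]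
    · exact Or.inl (eventTime_lt_of_ne_top (EReal.coe_lt_coe_iff.2 hT) (hk i))
  have ha : ∀ i, eventTime G p g T x i (k i) ≤ T := fun i => by
    rcases hkT i with h | ⟨h, h'⟩
    · exact h.le
    · rw [h, h']; exact le_rfl
  -- From `T₁` on every agent keeps its last sample. The alternative `T₁ = T = 0` covers the start
  -- from the empty interval.
  obtain ⟨T₁, hT₁, haT₁, hT₁T⟩ : ∃ T₁ : ℝ, 0 ≤ T₁ ∧ (∀ i, eventTime G p g T x i (k i) ≤ T₁) ∧
      (T₁ < T ∨ T₁ = 0 ∧ T = 0) := by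
    rcases hT.eq_or_lt with rfl | hT
    · exact ⟨0, le_rfl, ha, Or.inr ⟨rfl, rfl⟩⟩
    · have h1 : ∀ᶠ u : ℝ in 𝓝[<] T, ∀ i, eventTime G p g T x i (k i) < u :=
        eventually_all.2 fun i => Filter.Eventually.filter_mono nhdsWithin_le_nhds
          ((continuous_coe_real_ereal.tendsto T).eventually_const_lt
            (eventTime_lt_of_ne_top (EReal.coe_lt_coe_iff.2 hT) (hk i)))
      obtain ⟨u, hu, hu'⟩ := (h1.and (Ioo_mem_nhdsLT hT)).exists
      exact ⟨u, hu'.1.le, fun i => (hu i).le, Or.inl hu'.2⟩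
  set a : Fin N → ℝ := fun i => (eventTime G p g T x i (k i)).toReal with hadef
  -- `φ` is defined for all times and equals `x` on `[T₁, T)`; its value at `T` replaces the
  -- possibly meaningless `x T`.
  obtain ⟨φ, hφ0, hφ⟩ := exists_frozen_flow S G c p (fun i => x (a i)) T₁ (x T₁)
  have hφx : ∀ t, T₁ ≤ t → t < T → x t = φ t := by
    intro t ht htT
    have h1 : ∀ u ∈ Set.Icc T₁ t, (u : EReal) < T := fun u hu =>
      EReal.coe_lt_coe_iff.2 (hu.2.trans_lt htT)
    refine frozen_flow_unique (S := S) (G := G) (c := c) (p := p) (s := fun i => x (a i))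
      (hx.cont.mono fun u hu => ⟨hT₁.trans hu.1, h1 u hu⟩)
      (fun u _ => (hφ u).continuousAt.continuousWithinAt) (fun u hu => ?_)
      (fun u _ => (hφ u).hasDerivWithinAt) hφ0.symm (Set.right_mem_Icc.2 ht)
    exact hx.hasDerivWithinAt_of_lt hT₁ hu.1 (h1 u ⟨hu.1, hu.2.le⟩) haT₁ fun i => by
      rw [hk']; exact EReal.coe_lt_top u
  set s : Fin N → LoopState N nv r l d := fun i =>
    if threshold G p g T (φ T) i ≤ sampleErrorSq G p (x (a i)) (φ T) i then φ T else x (a i)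
    with hs
  obtain ⟨ψ, hψ0, hψ⟩ := exists_frozen_flow S G c p s T (φ T)
  have hslt : ∀ i, sampleErrorSq G p (s i) (ψ T) i < threshold G p g T (ψ T) i := by
    intro i
    rw [hψ0, hs]
    dsimp only
    split_ifs with h
    · rw [sampleErrorSq_self]
      exact hg.threshold_pos _ _ _
    · exact not_le.1 h
  have hψc : Continuous ψ := continuous_iff_continuousAt.2 fun t => (hψ t).continuousAt
  have hφc : Continuous φ := continuous_iff_continuousAt.2 fun t => (hφ t).continuousAt
  have hb : ∀ᶠ u in 𝓝[>] T, ∀ i, ∀ v, T ≤ v → v < u →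
      sampleErrorSq G p (s i) (ψ v) i < threshold G p g v (ψ v) i := by
    refine eventually_all.2 fun i => ?_
    obtain ⟨b, hb, hb'⟩ :=
      exists_sampleErrorSq_lt_threshold hψc.continuousAt.continuousWithinAt (hslt i)
    filter_upwards [Ioo_mem_nhdsGT hb] with u hu v hv hvu
    exact hb' v hv (hvu.trans hu.2)
  obtain ⟨T', hT', hTT'⟩ := (hb.and self_mem_nhdsWithin).exists
  replace hTT' : T < T' := hTT'
  set y : ℝ → LoopState N nv r l d := fun t => if t < T then x t else ψ t with hy
  have hyx : ∀ t, t < T → y t = x t := fun t ht => by simp only [hy, ht, if_true]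
  have hyψ : ∀ t, T ≤ t → y t = ψ t := fun t ht => by simp only [hy, not_lt.2 ht, if_false]
  have hya : ∀ i, y (a i) = x (a i) := by
    intro i
    rcases hkT i with h | ⟨h, h'⟩
    · refine hyx _ ?_
      rw [← EReal.coe_lt_coe_iff, hadef, coe_toReal_eventTime (hk i)]
      exact h
    · have h2 : a i = 0 := by rw [hadef]; dsimp only; rw [h]; rfl
      have h3 : T₁ = 0 := by
        rcases hT₁T with h4 | h4
        · exact absurd (h'.symm ▸ h4) (not_lt.2 hT₁)
        · exact h4.1
      rw [hyψ _ (by rw [h2, h']), h2]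
      rw [h'] at hψ0
      rw [h3] at hφ0
      rw [hψ0, hφ0]
  have hev : ∀ i, ∃ k', eventTime G p g T' y i k' ≤ T ∧ eventTime G p g T' y i (k' + 1) = ⊤ ∧
      y (eventTime G p g T' y i k').toReal = s i := by
    intro i
    refine eventTime_continuation hg hTT' hx.cont (fun t _ ht => hyx t ht) (hk i) (hk' i) (hkT i)
      ?_ fun t ht htT' => by rw [hyψ t ht]; exact hT' i t ht htT'
    have h1 : y (eventTime G p g T x i (k i)).toReal = x (a i) := hya i
    rw [h1, hyψ T le_rfl, hψ0, hs]
    dsimp only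
    split_ifs with h
    · exact Or.inr ⟨rfl, h⟩
    · exact Or.inl ⟨rfl, not_le.1 h⟩
  have hcy : ContinuousOn y {t : ℝ | 0 ≤ t ∧ (t : EReal) < T'} := by
    rintro t ⟨ht, -⟩
    rcases lt_or_ge t T with htT | htT
    · have h1 : {u : ℝ | 0 ≤ u ∧ (u : EReal) < T} ∈ 𝓝[{t : ℝ | 0 ≤ t ∧ (t : EReal) < T'}] t := by
        filter_upwards [self_mem_nhdsWithin, mem_nhdsWithin_of_mem_nhds (Iio_mem_nhds htT)]
          with u hu hu'
        exact ⟨hu.1, EReal.coe_lt_coe_iff.2 hu'⟩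
      refine ((hx.cont t ⟨ht, EReal.coe_lt_coe_iff.2 htT⟩).mono_of_mem_nhdsWithin
        h1).congr_of_eventuallyEq ?_ (hyx t htT)
      filter_upwards [h1] with u hu
      exact hyx u (EReal.coe_lt_coe_iff.1 hu.2)
    · have hχ : Continuous fun u => if u ≤ T then φ u else ψ u :=
        hφc.if_le hψc continuous_id continuous_const fun u hu => by
          rw [show u = T from hu, hψ0]
      have hyχ : ∀ u, T₁ ≤ u → y u = if u ≤ T then φ u else ψ u := by
        intro u hu
        rcases lt_trichotomy u T with h | h | h
        · rw [hyx u h, if_pos h.le, hφx u hu h]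
        · rw [hyψ u h.ge, if_pos h.le, h, hψ0]
        · rw [hyψ u h.le, if_neg (not_le.2 h)]
      have hT₁le : T₁ ≤ T := by
        rcases hT₁T with h | h
        · exact h.le
        · rw [h.1, h.2]
      refine hχ.continuousAt.continuousWithinAt.congr_of_eventuallyEq ?_
        (hyχ t (hT₁le.trans htT))
      rcases hT₁T with h | h
      · filter_upwards [mem_nhdsWithin_of_mem_nhds (Ioi_mem_nhds (h.trans_le htT))] with u hu
        exact hyχ u (le_of_lt hu)
      · filter_upwards [self_mem_nhdsWithin] with u hu
        exact hyχ u (h.1.le.trans hu.1)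
  have hcover : ∀ t, T ≤ t → ∀ i, ∃ k', eventTime G p g T' y i k' ≤ t ∧
      (t : EReal) < eventTime G p g T' y i (k' + 1) ∧
      y (eventTime G p g T' y i k').toReal = s i := by
    intro t ht i
    obtain ⟨k', h1, h2, h3⟩ := hev i
    exact ⟨k', h1.trans (EReal.coe_le_coe_iff.2 ht), by rw [h2]; exact EReal.coe_lt_top t, h3⟩
  refine ⟨T', hTT', y, ?_, hcy, ?_, ?_⟩
  · rcases hT.eq_or_lt with h0 | h0
    · rw [hyψ 0 h0.ge, h0, hψ0]
      have h3 : T₁ = T := by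
        rcases hT₁T with h4 | h4
        · exact absurd (h0 ▸ h4) (not_lt.2 hT₁)
        · rw [h4.1, h4.2]
      rw [← h3, hφ0, h3, ← h0, hx.init]
    · rw [hyx 0 h0, hx.init]
  · intro t ht htT' i
    rcases lt_or_ge t T with htT | htT
    · exact (hx.transfer hg hcy (fun u _ _ hu => hyx u (EReal.coe_lt_coe_iff.1 hu)) ht htT'
        (EReal.coe_lt_coe_iff.2 htT)).1 i
    · obtain ⟨k', h1, h2, -⟩ := hcover t htT i
      exact ⟨k', h1, h2⟩
  · intro t ht htT' κ hκ
    rcases lt_or_ge t T with htT | htT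
    · exact (hx.transfer hg hcy (fun u _ _ hu => hyx u (EReal.coe_lt_coe_iff.1 hu)) ht htT'
        (EReal.coe_lt_coe_iff.2 htT)).2 κ hκ
    · have h1 : (fun i => y (eventTime G p g T' y i (κ i)).toReal) = s := by
        funext i
        obtain ⟨k', h1, h2, h3⟩ := hcover t htT i
        rw [eventInterval_unique (hκ i) ⟨h1, h2⟩, h3]
      rw [h1, hyψ t htT]
      exact ((hψ t).hasDerivWithinAt).congr (fun u hu => hyψ u (htT.trans hu)) (hyψ t htT)

/-- All conditions on the empty interval `[0, 0)` are vacuous; this starts the continuation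
argument. -/
theorem isTrajectory_zero (hg : g.IsPositive) :
    IsTrajectory S G c g p ((0 : ℝ) : EReal) x₀ fun _ => x₀ :=
  isTrajectory_of_forall_exists hg rfl fun _ ht ht' =>
    absurd (EReal.coe_lt_coe_iff.1 ht') (not_lt.2 ht)

theorem exists_eventTime_eq_top {Tend : ℝ} (hT : 0 < Tend) {x : ℝ → LoopState N nv r l d}
    {i : Fin N} {τ : ℝ} (hτ : 0 < τ)
    (h : ∀ k, eventTime G p g Tend x i k + (τ : EReal) ≤ eventTime G p g Tend x i (k + 1)) :
    ∃ k, eventTime G p g Tend x i (k + 1) = ⊤ := by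
  by_contra hne
  push Not at hne
  have h1 : ∀ k : ℕ, (((k : ℝ) * τ : ℝ) : EReal) ≤ eventTime G p g Tend x i k := by
    intro k
    induction k with
    | zero => simpa using eventTime_nonneg (G := G) (p := p) (g := g) (x := x) (i := i) 0
    | succ k ih =>
      refine le_trans ?_ (h k)
      rw [show ((k + 1 : ℕ) : ℝ) * τ = k * τ + τ by push_cast; ring, EReal.coe_add]
      exact add_le_add_left ih _
  obtain ⟨k, hk⟩ := exists_nat_gt (Tend / τ)
  have h2 := (h1 (k + 1)).trans_lt (eventTime_lt_of_ne_top (EReal.coe_lt_coe_iff.2 hT) (hne k))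
  rw [EReal.coe_lt_coe_iff] at h2
  rw [div_lt_iff₀ hτ] at hk
  push_cast at h2
  nlinarith

/-- A lower bound on the inter-event times of all trajectories on bounded intervals gives a
trajectory on `[0, ∞)`. -/
theorem exists_isTrajectory_top (hg : g.IsPositive) {τ : ℝ} (hτ : 0 < τ)
    (hgap : ∀ (T : ℝ), 0 < T → ∀ x, IsTrajectory S G c g p T x₀ x → ∀ i k,
      eventTime G p g T x i k + (τ : EReal) ≤ eventTime G p g T x i (k + 1)) :
    ∃ x, IsTrajectory S G c g p ⊤ x₀ x := by
  have hfin : ∀ T : ℝ, 0 ≤ T → ∀ x, IsTrajectory S G c g p T x₀ x → ∀ i,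
      ∃ k, eventTime G p g T x i (k + 1) = ⊤ := by
    intro T hT x hx i
    rcases hT.eq_or_lt with rfl | hT
    · refine ⟨0, eventTime_succ_eq_top ?_⟩
      rw [Set.eq_empty_iff_forall_notMem]
      intro t ht
      exact absurd ((eventTime_nonneg 0).trans_lt ht.1) (not_lt.2 ht.2.1.le)
    · exact exists_eventTime_eq_top hT hτ fun k => hgap T hT x hx i k
  set A : Set ℝ := {T | 0 ≤ T ∧ ∃ x, IsTrajectory S G c g p T x₀ x} with hA
  have hA0 : (0 : ℝ) ∈ A := ⟨le_rfl, _, isTrajectory_zero hg⟩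
  -- At a finite supremum the trajectories glue to one on the whole open interval. It has finitely
  -- many events by the lower bound `τ`, so it continues beyond the supremum.
  have hA1 : ¬ BddAbove A := by
    intro hbdd
    have h0 : 0 ≤ sSup A := le_csSup hbdd hA0
    obtain ⟨x, hx⟩ : ∃ x, IsTrajectory S G c g p (sSup A : ℝ) x₀ x := by
      refine exists_isTrajectory_of_forall_exists hg fun t _ htA => ?_
      obtain ⟨T, ⟨-, y, hy⟩, hT⟩ := exists_lt_of_lt_csSup ⟨0, hA0⟩ (EReal.coe_lt_coe_iff.1 htA)
      exact ⟨T, y, EReal.coe_lt_coe_iff.2 hT, hy⟩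
    obtain ⟨T', hT', y, hy⟩ := hx.exists_continuation hg h0 (hfin _ h0 x hx)
    exact absurd (le_csSup hbdd ⟨h0.trans hT'.le, y, hy⟩) (not_le.2 hT')
  refine exists_isTrajectory_of_forall_exists hg fun t _ _ => ?_
  obtain ⟨T, ⟨-, y, hy⟩, hT⟩ := not_bddAbove_iff.1 hA1 t
  exact ⟨T, y, EReal.coe_lt_coe_iff.2 hT, hy⟩

end Loop

/-! ### Quadratic forms and a comparison lemma -/

theorem dotProduct_mulVec_symm {n : Type*} [Fintype n] {P : Matrix n n ℝ} (hP : P.IsHermitian)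
    (x y : n → ℝ) : x ⬝ᵥ P.mulVec y = y ⬝ᵥ P.mulVec x := by
  have h : P.transpose = P := by simpa [Matrix.IsHermitian] using hP
  rw [Matrix.dotProduct_mulVec, ← Matrix.mulVec_transpose, h, dotProduct_comm]

theorem hasDerivWithinAt_quadratic {n : Type*} [Fintype n] {P : Matrix n n ℝ} (hP : P.IsHermitian)
    {X : ℝ → n → ℝ} {X' : n → ℝ} {s : Set ℝ} {t : ℝ} (hX : HasDerivWithinAt X X' s t) :
    HasDerivWithinAt (fun t => X t ⬝ᵥ P.mulVec (X t)) (2 * (X t ⬝ᵥ P.mulVec X')) s t := by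
  have h1 := hasDerivWithinAt_pi.1 hX
  have h2 : HasDerivWithinAt (fun t => ∑ a, X t a * ∑ b, P a b * X t b)
      (∑ a, (X' a * (∑ b, P a b * X t b) + X t a * ∑ b, P a b * X' b)) s t :=
    HasDerivWithinAt.fun_sum fun a _ => (h1 a).fun_mul
      (HasDerivWithinAt.fun_sum fun b _ => (h1 b).const_mul (P a b))
  have h3 : 2 * (X t ⬝ᵥ P.mulVec X') =
      ∑ a, (X' a * (∑ b, P a b * X t b) + X t a * ∑ b, P a b * X' b) := by
    rw [Finset.sum_add_distrib, two_mul]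
    exact congrArg₂ (· + ·) (dotProduct_mulVec_symm hP _ _) rfl
  rw [h3]
  exact h2

/-- The factor `2` in `-2 I` leaves `-2|x|²`, of which one `|x|²` pays for the cross term `2 x · P y
≤ |x|² + |P y|²`. -/
theorem IsLyapunovSolution.two_mul_le {n : Type*} [Fintype n] [DecidableEq n] {A P : Matrix n n ℝ}
    (h : IsLyapunovSolution A P) (x y : n → ℝ) :
    2 * (x ⬝ᵥ P.mulVec (A.mulVec x + y)) ≤ - sqNorm x + opNorm P ^ 2 * sqNorm y := by
  rw [Matrix.mulVec_add, dotProduct_add, h.quadratic_form]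
  have h1 := two_mul_dotProduct_le x (P.mulVec y)
  have h2 := sqNorm_mulVec_le P y
  linarith

/-- Solutions of the differential inequality `V' ≤ -λ V + β e^(-α t) + δ`. -/
theorem le_of_hasDerivWithinAt_le {V V' : ℝ → ℝ} {b rate α β δ : ℝ} (hrate : 0 < rate)
    (hα : α < rate) (hβ : 0 ≤ β) (hδ : 0 ≤ δ) (hV : ContinuousOn V (Set.Icc 0 b))
    (hV' : ∀ t ∈ Set.Ico 0 b, HasDerivWithinAt V (V' t) (Set.Ici t) t)
    (hle : ∀ t ∈ Set.Ico 0 b, V' t ≤ - rate * V t + β * Real.exp (-α * t) + δ) :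
    ∀ t ∈ Set.Icc 0 b, V t ≤
      Real.exp (-rate * t) * V 0 + β / (rate - α) * Real.exp (-α * t) + δ / rate := by
  have hra : rate - α ≠ 0 := (sub_pos.2 hα).ne'
  have hexp : ∀ (a t : ℝ), HasDerivAt (fun t => Real.exp (a * t)) (a * Real.exp (a * t)) t := by
    intro a t
    have := ((hasDerivAt_id t).const_mul a).exp
    simpa [mul_comm] using this
  -- Multiplying by `e^{rate t}` removes the linear term; the product is compared with a primitive
  -- of the remaining right side.
  have key := image_le_of_deriv_right_le_deriv_boundary
    (f := fun t => Real.exp (rate * t) * V t)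
    (f' := fun t => rate * Real.exp (rate * t) * V t + Real.exp (rate * t) * V' t)
    (B := fun t => V 0 + β / (rate - α) * Real.exp ((rate - α) * t) +
      δ / rate * Real.exp (rate * t))
    (B' := fun t => 0 + β / (rate - α) * ((rate - α) * Real.exp ((rate - α) * t)) +
      δ / rate * (rate * Real.exp (rate * t)))
    (a := 0) (b := b) ?_ ?_ ?_ ?_ ?_ ?_
  · intro t ht
    have h1 := key ht
    have h2 : Real.exp (-rate * t) * Real.exp (rate * t) = 1 := by
      rw [← Real.exp_add]; simp
    have h3 : Real.exp (-rate * t) * Real.exp ((rate - α) * t) = Real.exp (-α * t) := by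
      rw [← Real.exp_add]; congr 1; ring
    calc V t = Real.exp (-rate * t) * (Real.exp (rate * t) * V t) := by
          rw [← mul_assoc, h2, one_mul]
      _ ≤ Real.exp (-rate * t) * (V 0 + β / (rate - α) * Real.exp ((rate - α) * t) +
            δ / rate * Real.exp (rate * t)) :=
          mul_le_mul_of_nonneg_left h1 (Real.exp_pos _).le
      _ = _ := by
          rw [← h3]
          linear_combination (δ / rate) * h2
  · exact (Continuous.continuousOn (by fun_prop)).mul hV
  · intro t ht
    exact (hexp rate t).hasDerivWithinAt.fun_mul (hV' t ht)
  · have h1 : 0 ≤ β / (rate - α) := div_nonneg hβ (sub_pos.2 hα).le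
    have h2 : 0 ≤ δ / rate := div_nonneg hδ hrate.le
    simp only [mul_zero, Real.exp_zero]
    linarith
  · exact Continuous.continuousOn (by fun_prop)
  · intro t _
    exact (((hasDerivAt_const t (V 0)).fun_add ((hexp (rate - α) t).const_mul _)).fun_add
      ((hexp rate t).const_mul _)).hasDerivWithinAt
  · intro t ht
    have h1 := mul_le_mul_of_nonneg_left (hle t ht) (Real.exp_pos (rate * t)).le
    have h3 : Real.exp (rate * t) * Real.exp (-α * t) = Real.exp ((rate - α) * t) := by
      rw [← Real.exp_add]; congr 1; ring
    have h4 : β / (rate - α) * ((rate - α) * Real.exp ((rate - α) * t)) =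
        β * Real.exp ((rate - α) * t) := by field_simp
    have h5 : δ / rate * (rate * Real.exp (rate * t)) = δ * Real.exp (rate * t) := by field_simp
    rw [h4, h5, ← h3]
    linarith

/-- Cauchy–Schwarz for two terms, with the cross term `2ab` bounded by `A y + B x`. -/
theorem sub_sq_le_of_sq_le_mul {a b A B x y : ℝ} (hA : 0 ≤ A) (hB : 0 ≤ B) (hx : 0 ≤ x)
    (hy : 0 ≤ y) (ha : a ^ 2 ≤ A * x) (hb : b ^ 2 ≤ B * y) :
    (a - b) ^ 2 ≤ (A + B) * (x + y) := by
  have h1 : |2 * (a * b)| ≤ A * y + B * x := by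
    refine abs_le_of_sq_le_sq ?_ (by positivity)
    have h2 := mul_le_mul ha hb (sq_nonneg b) (by positivity)
    nlinarith [sq_nonneg (A * y - B * x)]
  have h3 := neg_abs_le (2 * (a * b))
  nlinarith

section Loop

variable {N nv r l : ℕ} {d : Fin N → ℕ}
variable {S : Matrix (Fin nv) (Fin nv) ℝ} {G : Digraph (Fin (N + 1))} {c : Controller r l}
  {g : Trigger} {p : PlantParam N nv r d} {Z : (i : Fin N) → Fin (d i) → Fin nv → ℝ}

/-! ### The deviation from the steady state -/

/-- The stacked deviation of the plants and the controllers from their steady states. -/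
def deviation (S : Matrix (Fin nv) (Fin nv) ℝ) (T : Matrix (Fin l) (Fin l) ℝ)
    (p : PlantParam N nv r d) (Z : (i : Fin N) → Fin (d i) → Fin nv → ℝ) :
    LoopState N nv r l d →L[ℝ] (LoopIdx N r l d → ℝ) :=
  flatCLM.comp (ContinuousLinearMap.snd ℝ _ _ -
    (steadyCLM S T p Z).comp (ContinuousLinearMap.fst ℝ _ _))

theorem deviation_apply (T : Matrix (Fin l) (Fin l) ℝ) (x : LoopState N nv r l d) :
    deviation S T p Z x = flat (x.2 - steadyState S T p Z x.1) := rfl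

theorem controlInput_sub_sq_le (s x : LoopState N nv r l d) (i : Fin N) :
    (controlInput c s i - controlInput c x i) ^ 2 ≤
      (sqNorm (rowGammaTinv c.T) + c.K ^ 2 * sqNorm (rowOmega (r := r) c.γ)) *
        (sqNorm (stEta s i - stEta x i) + sqNorm (stZeta s i - stZeta x i)) := by
  have h : controlInput c s i - controlInput c x i =
      rowGammaTinv c.T ⬝ᵥ (stEta s i - stEta x i) -
        c.K * (rowOmega c.γ ⬝ᵥ (stZeta s i - stZeta x i)) := by
    simp only [controlInput, dotProduct_sub]
    ring
  rw [h]
  refine sub_sq_le_of_sq_le_mul (sqNorm_nonneg _) (mul_nonneg (sq_nonneg _) (sqNorm_nonneg _))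
    (sqNorm_nonneg _) (sqNorm_nonneg _) (dotProduct_sq_le _ _) ?_
  rw [mul_pow, mul_assoc]
  exact mul_le_mul_of_nonneg_left (dotProduct_sq_le _ _) (sq_nonneg _)

theorem sqNorm_deviation (T : Matrix (Fin l) (Fin l) ℝ) (x : LoopState N nv r l d) :
    sqNorm (deviation S T p Z x) = ∑ i, (sqNorm (x.2.1 i - (steadyState S T p Z x.1).1 i) +
      sqNorm (x.2.2.1 i - (steadyState S T p Z x.1).2.1 i) +
      sqNorm (x.2.2.2.1 i - (steadyState S T p Z x.1).2.2.1 i) + sqNorm (x.2.2.2.2 i)) := by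
  rw [deviation_apply, sqNorm_flat]
  refine Finset.sum_congr rfl fun i _ => ?_
  have h : (x.2 - steadyState S T p Z x.1).2.2.2 i = x.2.2.2.2 i := by
    change x.2.2.2.2 i - 0 = _
    rw [sub_zero]
  rw [h]
  rfl

variable [NeZero r]

/-- The regulated error of agent `i`. -/
theorem regError_apply (T : Matrix (Fin l) (Fin l) ℝ) (x : LoopState N nv r l d) (i : Fin N) :
    regError p x i = (x.2.2.1 i - (steadyState S T p Z x.1).2.1 i) 0 := by
  change nodeOutput p x i.succ - nodeOutput p x 0 = _
  simp [nodeOutput, steadyState, stXi, stV]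

theorem sum_regError_sq_le (T : Matrix (Fin l) (Fin l) ℝ) (x : LoopState N nv r l d) :
    ∑ i, regError p x i ^ 2 ≤
      ∑ i, sqNorm (x.2.2.1 i - (steadyState S T p Z x.1).2.1 i) := by
  refine Finset.sum_le_sum fun i _ => ?_
  rw [regError_apply (S := S) (Z := Z) T]
  exact Finset.single_le_sum
    (f := fun s => (x.2.2.1 i - (steadyState S T p Z x.1).2.1 i) s ^ 2)
    (fun _ _ => sq_nonneg _) (Finset.mem_univ (0 : Fin r))

theorem norm_regError_sq_le (T : Matrix (Fin l) (Fin l) ℝ) (x : LoopState N nv r l d) :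
    ‖regError p x‖ ^ 2 ≤ sqNorm (deviation S T p Z x) := by
  rw [EuclideanSpace.real_norm_sq_eq, sqNorm_deviation]
  refine (sum_regError_sq_le (S := S) (Z := Z) T x).trans (Finset.sum_le_sum fun i _ => ?_)
  have h1 := sqNorm_nonneg (x.2.1 i - (steadyState S T p Z x.1).1 i)
  have h2 := sqNorm_nonneg (x.2.2.2.1 i - (steadyState S T p Z x.1).2.2.1 i)
  have h3 := sqNorm_nonneg (x.2.2.2.2 i)
  linarith

/-- The vector of virtual outputs is `H e`. -/
theorem virtualOutput_eq_mulVec (x : LoopState N nv r l d) :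
    virtualOutput G p x = (graphH G).mulVec fun i => regError p x i := by
  funext i
  have h := sum_graphH_mul (R := ℝ) G (fun i => regError p x i) i
  simp only [Algebra.algebraMap_self, RingHom.id_apply] at h
  rw [Matrix.mulVec, dotProduct, h, virtualOutput]
  refine Finset.sum_congr rfl fun k _ => ?_
  congr 1
  have h1 : regError p x i = nodeOutput p x i.succ - nodeOutput p x 0 := rfl
  have h2 : (Fin.cons 0 (fun i => regError p x i) : Fin (N + 1) → ℝ) k =
      nodeOutput p x k - nodeOutput p x 0 := by
    refine Fin.cases ?_ (fun j => ?_) k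
    · simp
    · rfl
  rw [h1, h2]
  ring

/-- Both parts are seen in the deviation: `ζ` has steady state zero, and `e_v = H e` where `e_i` is
the first coordinate of the deviation of `ξ_i`. So the state-dependent part of the threshold is
dominated by `|X|²`. -/
theorem sum_sqNorm_stZeta_add_le (hG : HasSpanningTree G 0) (T : Matrix (Fin l) (Fin l) ℝ)
    (x : LoopState N nv r l d) :
    ∑ i, (sqNorm (stZeta x i) + virtualOutput G p x i ^ 2) ≤
      lamBar2 N * sqNorm (deviation S T p Z x) := by
  have h1 : ∑ i, virtualOutput G p x i ^ 2 ≤ lam2 N * ∑ i, regError p x i ^ 2 := by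
    have h := sqNorm_mulVec_le (graphH G) fun i => regError p x i
    rw [← virtualOutput_eq_mulVec] at h
    exact h.trans (mul_le_mul_of_nonneg_right (opNorm_graphH_sq_le_lam2 hG)
      (sqNorm_nonneg fun i => regError p x i))
  have h2 := sum_regError_sq_le (p := p) (S := S) (Z := Z) T x
  have h3 : 1 ≤ lamBar2 N := le_max_left _ _
  have h4 : lam2 N ≤ lamBar2 N := le_max_right _ _
  have h0 : 0 ≤ ∑ i, regError p x i ^ 2 := Finset.sum_nonneg fun _ _ => sq_nonneg _
  have h5 : 0 ≤ ∑ i, sqNorm (stZeta x i) := Finset.sum_nonneg fun _ _ => sqNorm_nonneg _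
  have h6 : ∑ i, sqNorm (x.2.2.1 i - (steadyState S T p Z x.1).2.1 i) + ∑ i, sqNorm (stZeta x i) ≤
      sqNorm (deviation S T p Z x) := by
    rw [sqNorm_deviation, ← Finset.sum_add_distrib]
    refine Finset.sum_le_sum fun i _ => ?_
    have h1 := sqNorm_nonneg (x.2.1 i - (steadyState S T p Z x.1).1 i)
    have h2 := sqNorm_nonneg (x.2.2.2.1 i - (steadyState S T p Z x.1).2.2.1 i)
    have h3 : stZeta x i = x.2.2.2.2 i := rfl
    rw [h3]
    linarith
  rw [Finset.sum_add_distrib]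
  calc ∑ i, sqNorm (stZeta x i) + ∑ i, virtualOutput G p x i ^ 2
      ≤ lamBar2 N * ∑ i, sqNorm (stZeta x i) + lamBar2 N * ∑ i, regError p x i ^ 2 :=
        add_le_add (le_mul_of_one_le_left h5 h3)
          (h1.trans (mul_le_mul_of_nonneg_right h4 h0))
    _ = lamBar2 N * (∑ i, regError p x i ^ 2 + ∑ i, sqNorm (stZeta x i)) := by ring
    _ ≤ lamBar2 N * sqNorm (deviation S T p Z x) :=
        mul_le_mul_of_nonneg_left (by linarith) (zero_le_one.trans h3)

/-! ### The effect of sampling -/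

theorem sqNorm_smul {n : Type*} [Fintype n] (a : ℝ) (x : n → ℝ) :
    sqNorm (a • x) = a ^ 2 * sqNorm x := by
  simp only [sqNorm, Pi.smul_apply, smul_eq_mul, mul_pow, Finset.mul_sum]

theorem sqNorm_last (a : ℝ) :
    sqNorm (fun q : Fin r => if (q : ℕ) + 1 < r then 0 else a) = a ^ 2 := by
  have hr : 0 < r := Nat.pos_of_ne_zero (NeZero.ne r)
  rw [sqNorm, Finset.sum_eq_single (⟨r - 1, by omega⟩ : Fin r)]
  · rw [if_neg (by simp only; omega)]
  · intro q _ hq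
    have hq' : (q : ℕ) ≠ r - 1 := fun h => hq (Fin.ext h)
    rw [if_pos (by omega)]
    ring
  · intro h
    exact absurd (Finset.mem_univ _) h

/-- The input error mixes the errors of `η` and `ζ` and acts on both the plant and the internal
model. `hB` therefore asks `lM` to bound the product of the two sums, and not the `η` and `ζ`
contributions separately. The error of `e_v` acts on `ζ` alone, through `B_o(h)`. -/
theorem sqNorm_loopField_sub_diag_le {lM : ℝ}
    (hB : ∀ i, (coefB p i ^ 2 + sqNorm c.Q) *
      (sqNorm (rowGammaTinv c.T) + c.K ^ 2 * sqNorm (rowOmega (r := r) c.γ)) ≤ lM)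
    (hBo : sqNorm (vecBo c.δc c.h) ≤ lM) (x : LoopState N nv r l d)
    (s : Fin N → LoopState N nv r l d) :
    sqNorm (flat (loopField S G c p x s - loopField S G c p x (fun _ => x)).2) ≤
      lM * ∑ i, sampleErrorSq G p (s i) x i := by
  rw [loopField_sub_diag, sqNorm_flat, Finset.mul_sum]
  refine Finset.sum_le_sum fun i _ => ?_
  have h0 : sqNorm ((0 : (i : Fin N) → Fin (d i) → ℝ) i) = 0 := by simp [sqNorm]
  dsimp only
  rw [h0, sqNorm_last, sqNorm_smul, sqNorm_smul, sampleErrorSq]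
  have h1 := controlInput_sub_sq_le (c := c) (s i) x i
  have h2 := sqNorm_nonneg (stEta (s i) i - stEta x i)
  have h3 := sqNorm_nonneg (stZeta (s i) i - stZeta x i)
  have h4 := sq_nonneg (virtualOutput G p (s i) i - virtualOutput G p x i)
  have h5 : 0 ≤ coefB p i ^ 2 + sqNorm c.Q := add_nonneg (sq_nonneg _) (sqNorm_nonneg _)
  have h6 := mul_le_mul_of_nonneg_left h1 h5
  have h7 := mul_le_mul_of_nonneg_right (hB i) (add_nonneg h2 h3)
  have h8 := mul_le_mul_of_nonneg_left hBo h4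
  nlinarith

/-- Dissipation of the Lyapunov function under the triggering condition. -/
theorem lyapunov_dissipation (hl : l = (minpoly ℝ S).natDegree) (hG : HasSpanningTree G 0)
    (hb : ∀ i, coefB p i ≠ 0) (hTu : IsUnit c.T)
    (hT : c.T * companionPhi S l - c.M * c.T = Matrix.vecMulVec c.Q (rowGamma l))
    (hZ : IsZeroDynamicsSteady S p Z) {P : Matrix (LoopIdx N r l d) (LoopIdx N r l d) ℝ}
    (hP : IsLyapunovSolution (matAc G c p) P) {l1 lM σ : ℝ} (hl1 : opNorm P ^ 2 ≤ l1)
    (hB : ∀ i, (coefB p i ^ 2 + sqNorm c.Q) *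
      (sqNorm (rowGammaTinv c.T) + c.K ^ 2 * sqNorm (rowOmega (r := r) c.γ)) ≤ lM)
    (hBo : sqNorm (vecBo c.δc c.h) ≤ lM) (hg : 0 ≤ g.sigmaBar)
    (hσ : l1 * lM * g.sigmaBar * lamBar2 N = σ) {t : ℝ} {x : LoopState N nv r l d}
    {s : Fin N → LoopState N nv r l d}
    (hs : ∀ i, sampleErrorSq G p (s i) x i ≤ threshold G p g t x i) :
    2 * (deviation S c.T p Z x ⬝ᵥ P.mulVec (deviation S c.T p Z (loopField S G c p x s))) ≤
      - (1 - σ) * sqNorm (deviation S c.T p Z x) +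
        l1 * lM * N * (g.β * Real.exp (-g.α * t) + g.δ) := by
  have hlM : 0 ≤ lM := (sqNorm_nonneg _).trans hBo
  have hl10 : 0 ≤ l1 := (sq_nonneg _).trans hl1
  have h1 : deviation S c.T p Z (loopField S G c p x s) =
      (matAc G c p).mulVec (deviation S c.T p Z x) +
        flat (loopField S G c p x s - loopField S G c p x (fun _ => x)).2 :=
    flat_loopField_sub_steadyState hl G hb hTu hT hZ x s
  rw [h1]
  refine (hP.two_mul_le _ _).trans ?_
  have h2 := sqNorm_loopField_sub_diag_le (S := S) (G := G) hB hBo x s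
  have h3 : ∑ i, sampleErrorSq G p (s i) x i ≤
      g.sigmaBar * ∑ i, (sqNorm (stZeta x i) + virtualOutput G p x i ^ 2) +
        N * (g.β * Real.exp (-g.α * t) + g.δ) := by
    refine (Finset.sum_le_sum fun i _ => hs i).trans (le_of_eq ?_)
    simp only [threshold, Finset.sum_add_distrib, ← Finset.mul_sum, Finset.sum_const,
      Finset.card_univ, Fintype.card_fin, nsmul_eq_mul]
    ring
  have h4 := mul_le_mul_of_nonneg_left
    (sum_sqNorm_stZeta_add_le (S := S) (Z := Z) (p := p) hG c.T x) hg
  -- The triggering rule turns the total sampling error into `σ̄ λ̄₂ |X|²` plus `N` copies of `β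
  -- e^{-αt} + δ`. By `hσ` the first part costs exactly `σ |X|²`.
  have h5 := mul_le_mul hl1 (h2.trans (mul_le_mul_of_nonneg_left
    (h3.trans (add_le_add_left h4 _)) hlM)) (sqNorm_nonneg _) hl10
  refine (add_le_add_right h5 _).trans (le_of_eq ?_)
  rw [← hσ]
  ring

end Loop

/-! ### Uniform bounds for the steady states -/

section Loop

variable {N nv r l : ℕ} {d : Fin N → ℕ}
variable {S : Matrix (Fin nv) (Fin nv) ℝ} {G : Digraph (Fin (N + 1))} {c : Controller r l}
  {g : Trigger} {p : PlantParam N nv r d} {Z : (i : Fin N) → Fin (d i) → Fin nv → ℝ}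
  {x₀ : LoopState N nv r l d}

theorem continuous_controlInput (c : Controller r l) (i : Fin N) :
    Continuous fun x : LoopState N nv r l d => controlInput c x i :=
  LinearMap.continuous_of_finiteDimensional
    { toFun := fun x : LoopState N nv r l d => controlInput c x i
      map_add' := fun x y => controlInput_add c x y i
      map_smul' := fun a x => controlInput_smul c a x i }

/-- The steady states are uniformly bounded. -/
theorem exists_steadyState_bound {S : Matrix (Fin nv) (Fin nv) ℝ} (hS : IsNeutrallyStable S)
    (T : Matrix (Fin l) (Fin l) ℝ) (nom : PlantParam N nv r d) {W : Set (PlantParam N nv r d)}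
    (hW : IsCompact W) (hb : ∀ w ∈ W, ∀ i, coefB (nom + w) i ≠ 0)
    (hmin : ∀ w ∈ W, ∀ i, IsHurwitz (coefA1 (nom + w) i)) (R : ℝ) :
    ∃ C : ℝ, ∀ w ∈ W, ∀ Z, IsZeroDynamicsSteady S (nom + w) Z → ∀ v : Fin nv → ℝ, ‖v‖ ≤ R →
      ‖(steadyState S T (nom + w) Z v : CState N r l d)‖ ≤ C := by
  have h1 : ∀ i, ∃ C : ℝ, ∀ w ∈ W, ∀ Z : Matrix (Fin (d i)) (Fin nv) ℝ,
      Z * S - coefA1 (nom + w) i * Z =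
        Matrix.vecMulVec (coefA2 (nom + w) i) (coefF (nom + w)) + coefE0 (nom + w) i →
      Matrix.of.symm Z ∈ Metric.closedBall (0 : Fin (d i) → Fin nv → ℝ) C := fun i =>
    exists_sylvester_bound hW (continuous_coefA1 nom i).continuousOn (fun w hw => hmin w hw i) hS
      (Continuous.continuousOn (((continuous_coefA2 nom i).matrix_vecMulVec
        (continuous_coefF nom)).add (continuous_coefE0 nom i)))
  choose C hC using h1
  have hK : IsCompact (W ×ˢ ((Set.univ.pi fun i =>
      Metric.closedBall (0 : Fin (d i) → Fin nv → ℝ) (C i)) ×ˢ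
        Metric.closedBall (0 : Fin nv → ℝ) R)) :=
    hW.prod ((isCompact_univ_pi fun i => isCompact_closedBall _ _).prod
      (isCompact_closedBall _ _))
  obtain ⟨B, hB⟩ := hK.exists_bound_of_continuousOn ((continuousOn_steadyState S T nom hb).mono
    (Set.prod_mono le_rfl (Set.subset_univ _)))
  refine ⟨B, fun w hw Z hZ v hv => hB (w, Z, v) ⟨hw, fun i _ => ?_, mem_closedBall_zero_iff.2 hv⟩⟩
  exact hC i w hw (Matrix.of (Z i)) (hZ i)

variable [NeZero r] {Tend : EReal} {x : ℝ → LoopState N nv r l d}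

/-! ### Estimates along trajectories -/

/-- Between two events, the sampling error stays below the threshold. -/
theorem sampleErrorSq_le_threshold (hg : g.IsPositive) {i : Fin N} {t : ℝ} (ht : (t : EReal) < Tend)
    {k : ℕ} (hk : eventTime G p g Tend x i k ≤ t)
    (hk' : (t : EReal) < eventTime G p g Tend x i (k + 1)) :
    sampleErrorSq G p (x (eventTime G p g Tend x i k).toReal) (x t) i ≤
      threshold G p g t (x t) i := by
  rcases hk.lt_or_eq with h | h
  · by_contra hlt
    rw [eventTime_succ] at hk'
    have h1 : t ∈ triggerSet G p g Tend x i (eventTime G p g Tend x i k) :=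
      ⟨h, ht, (not_le.1 hlt).le⟩
    exact absurd (sInf_le (Set.mem_image_of_mem _ h1)) (not_le.2 hk')
  · rw [h, EReal.toReal_coe, sampleErrorSq_self]
    exact (hg.threshold_pos _ _ _).le

/-- All that the estimates need to know about sampling: the field is evaluated at past states whose
errors respect the thresholds. Event indices do not appear any more. -/
theorem IsTrajectory.exists_hasDerivWithinAt (hg : g.IsPositive)
    (hx : IsTrajectory S G c g p Tend x₀ x) {t : ℝ} (ht : 0 ≤ t) (htT : (t : EReal) < Tend) :
    ∃ s : Fin N → LoopState N nv r l d,
      HasDerivWithinAt x (loopField S G c p (x t) s) (Set.Ici t) t ∧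
      (∀ i, sampleErrorSq G p (s i) (x t) i ≤ threshold G p g t (x t) i) ∧
      ∀ i, ∃ u, 0 ≤ u ∧ u ≤ t ∧ s i = x u := by
  choose k hk using hx.cover t ht htT
  refine ⟨_, hx.ode t ht htT k hk,
    fun i => sampleErrorSq_le_threshold hg htT (hk i).1 (hk i).2, fun i => ?_⟩
  refine ⟨_, toReal_eventTime_nonneg (k i), ?_, rfl⟩
  rw [← EReal.coe_le_coe_iff,
    coe_toReal_eventTime (ne_top_of_le_ne_top (EReal.coe_ne_top t) (hk i).1)]
  exact (hk i).1

theorem IsTrajectory.continuousOn_Icc (hx : IsTrajectory S G c g p Tend x₀ x) {a b : ℝ}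
    (ha : 0 ≤ a) (hb : (b : EReal) < Tend) : ContinuousOn x (Set.Icc a b) :=
  hx.cont.mono fun _ ht =>
    ⟨ha.trans ht.1, (EReal.coe_le_coe_iff.2 ht.2).trans_lt hb⟩

theorem IsTrajectory.norm_exosystem_le (hg : g.IsPositive)
    (hx : IsTrajectory S G c g p Tend x₀ x) {C : ℝ}
    (hC : ∀ (v : ℝ → Fin nv → ℝ) (b : ℝ), ContinuousOn v (Set.Icc 0 b) →
      (∀ t ∈ Set.Ico 0 b, HasDerivWithinAt v (S.mulVec (v t)) (Set.Ici t) t) →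
      ∀ t ∈ Set.Icc 0 b, ‖v t‖ ≤ C * ‖v 0‖) {t : ℝ} (ht : 0 ≤ t) (htT : (t : EReal) < Tend) :
    ‖(x t).1‖ ≤ C * ‖x₀.1‖ := by
  have h := hC (fun t => (x t).1) t (hx.continuousOn_Icc le_rfl htT).fst ?_ t
    (Set.right_mem_Icc.2 ht)
  · rwa [hx.init] at h
  · intro u hu
    obtain ⟨s, hs, -⟩ := hx.exists_hasDerivWithinAt hg hu.1
      ((EReal.coe_lt_coe_iff.2 hu.2).trans htT)
    exact (ContinuousLinearMap.fst ℝ _ _).hasFDerivAt.comp_hasDerivWithinAt u hs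

/-- The exponential estimate of the Lyapunov function along a trajectory. -/
theorem IsTrajectory.lyapunov_le (hg : g.IsPositive) (hx : IsTrajectory S G c g p Tend x₀ x)
    (hl : l = (minpoly ℝ S).natDegree) (hG : HasSpanningTree G 0)
    (hb : ∀ i, coefB p i ≠ 0) (hTu : IsUnit c.T)
    (hT : c.T * companionPhi S l - c.M * c.T = Matrix.vecMulVec c.Q (rowGamma l))
    (hZ : IsZeroDynamicsSteady S p Z) {P : Matrix (LoopIdx N r l d) (LoopIdx N r l d) ℝ}
    (hP : IsLyapunovSolution (matAc G c p) P) {l1 lM lmax σ : ℝ} (hl1 : opNorm P ^ 2 ≤ l1)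
    (hB : ∀ i, (coefB p i ^ 2 + sqNorm c.Q) *
      (sqNorm (rowGammaTinv c.T) + c.K ^ 2 * sqNorm (rowOmega (r := r) c.γ)) ≤ lM)
    (hBo : sqNorm (vecBo c.δc c.h) ≤ lM)
    (hσ : l1 * lM * g.sigmaBar * lamBar2 N = σ) (hσ1 : σ < 1) (hlmax : lambdaMax P ≤ lmax)
    (hlmax0 : 0 < lmax) (hα : g.α < (1 - σ) / lmax) {t : ℝ} (ht : 0 ≤ t)
    (htT : (t : EReal) < Tend) :
    deviation S c.T p Z (x t) ⬝ᵥ P.mulVec (deviation S c.T p Z (x t)) ≤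
      Real.exp (-((1 - σ) / lmax) * t) *
        (deviation S c.T p Z x₀ ⬝ᵥ P.mulVec (deviation S c.T p Z x₀)) +
      l1 * lM * N * g.β / ((1 - σ) / lmax - g.α) * Real.exp (-g.α * t) +
      l1 * lM * N * g.δ / ((1 - σ) / lmax) := by
  have h0 : 0 ≤ l1 * lM * N :=
    mul_nonneg (mul_nonneg ((sq_nonneg _).trans hl1) ((sqNorm_nonneg _).trans hBo))
      (Nat.cast_nonneg N)
  choose! s hs using fun (u : ℝ) (hu : 0 ≤ u ∧ (u : EReal) < Tend) =>
    hx.exists_hasDerivWithinAt hg hu.1 hu.2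
  have hIco : ∀ u ∈ Set.Ico 0 t, 0 ≤ u ∧ (u : EReal) < Tend := fun u hu =>
    ⟨hu.1, (EReal.coe_lt_coe_iff.2 hu.2).trans htT⟩
  rw [← hx.init]
  refine le_of_hasDerivWithinAt_le (b := t) (div_pos (sub_pos.2 hσ1) hlmax0) hα
    (mul_nonneg h0 hg.β.le) (mul_nonneg h0 hg.δ.le)
    (V := fun t => deviation S c.T p Z (x t) ⬝ᵥ P.mulVec (deviation S c.T p Z (x t)))
    (V' := fun t => 2 * (deviation S c.T p Z (x t) ⬝ᵥ
      P.mulVec (deviation S c.T p Z (loopField S G c p (x t) (s t))))) ?_ ?_ ?_ t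
    (Set.right_mem_Icc.2 ht)
  · have h1 : Continuous fun X : LoopIdx N r l d → ℝ => X ⬝ᵥ P.mulVec X :=
      continuous_id.dotProduct (continuous_const.matrix_mulVec continuous_id)
    exact (h1.comp (deviation S c.T p Z).continuous).comp_continuousOn
      (hx.continuousOn_Icc le_rfl htT)
  · intro u hu
    exact hasDerivWithinAt_quadratic hP.1.isHermitian
      ((deviation S c.T p Z).hasFDerivAt.comp_hasDerivWithinAt u (hs u (hIco u hu)).1)
  · intro u hu
    refine (lyapunov_dissipation hl hG hb hTu hT hZ hP hl1 hB hBo hg.sigmaBar hσ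
      (hs u (hIco u hu)).2.1).trans ?_
    have h1 := (dotProduct_mulVec_le_lambdaMax hP.1.isHermitian
      (deviation S c.T p Z (x u))).trans
      (mul_le_mul_of_nonneg_right hlmax (sqNorm_nonneg _))
    -- Since `V ≤ λ_max |X|²`, the dissipation `(1 - σ)|X|²` is at least `(1 - σ)/λ_max` times `V`,
    -- which is the decay rate.
    have h2 : (1 - σ) / lmax * (deviation S c.T p Z (x u) ⬝ᵥ
        P.mulVec (deviation S c.T p Z (x u))) ≤
        (1 - σ) * sqNorm (deviation S c.T p Z (x u)) := by
      refine (mul_le_mul_of_nonneg_left h1 (div_pos (sub_pos.2 hσ1) hlmax0).le).trans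
        (le_of_eq ?_)
      field_simp
    linarith

/-! ### A lower bound on the inter-event times -/

/-- At a trigger the error exceeds `δ`, so the state has moved at least `ρ` from its sampled value,
while its speed is at most `L`. The interval end `Tend` is arbitrary, because the bound is needed
before global existence is known. -/
theorem IsTrajectory.eventTime_add_le (hg : g.IsPositive) (hx : IsTrajectory S G c g p Tend x₀ x)
    {R L ρ : ℝ} (hL : 0 < L) (hR : ∀ t : ℝ, 0 ≤ t → (t : EReal) < Tend → ‖x t‖ ≤ R)
    (hf : ∀ (y : LoopState N nv r l d) (s : Fin N → LoopState N nv r l d), ‖y‖ ≤ R →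
      (∀ i, ‖s i‖ ≤ R) → ‖loopField S G c p y s‖ ≤ L)
    (herr : ∀ (s y : LoopState N nv r l d) (i : Fin N), ‖s‖ ≤ R → ‖y‖ ≤ R → ‖y - s‖ < ρ →
      sampleErrorSq G p s y i < g.δ) (i : Fin N) (k : ℕ) :
    eventTime G p g Tend x i k + ((ρ / L : ℝ) : EReal) ≤ eventTime G p g Tend x i (k + 1) := by
  rw [eventTime_succ]
  refine le_sInf ?_
  rintro _ ⟨t, ht, rfl⟩
  have hne : eventTime G p g Tend x i k ≠ ⊤ := ht.1.ne_top
  have hE := coe_toReal_eventTime hne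
  have ha : 0 ≤ (eventTime G p g Tend x i k).toReal := toReal_eventTime_nonneg k
  have hthr := ht.2.2
  have hat := ht.1
  rw [← hE] at hat ⊢
  generalize (eventTime G p g Tend x i k).toReal = a at ha hthr hat
  rw [EReal.coe_lt_coe_iff] at hat
  change (a : EReal) + ((ρ / L : ℝ) : EReal) ≤ (t : EReal)
  rw [← EReal.coe_add, EReal.coe_le_coe_iff]
  have hdom : ∀ u ≤ t, (u : EReal) < Tend := fun u hu =>
    (EReal.coe_le_coe_iff.2 hu).trans_lt ht.2.1
  choose! s hs using fun (u : ℝ) (hu : 0 ≤ u ∧ (u : EReal) < Tend) =>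
    hx.exists_hasDerivWithinAt hg hu.1 hu.2
  have h1 := norm_image_sub_le_of_norm_deriv_right_le_segment (f := x) (a := a) (b := t)
    (f' := fun u => loopField S G c p (x u) (s u)) (C := L) (hx.continuousOn_Icc ha ht.2.1)
    (fun u hu => (hs u ⟨ha.trans hu.1, hdom u hu.2.le⟩).1)
    (fun u hu => by
      have h2 := hs u ⟨ha.trans hu.1, hdom u hu.2.le⟩
      refine hf _ _ (hR u (ha.trans hu.1) (hdom u hu.2.le)) fun j => ?_
      obtain ⟨q, hq0, hqu, hq⟩ := h2.2.2 j
      rw [hq]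
      exact hR q hq0 (hdom q (hqu.trans hu.2.le))) t (Set.right_mem_Icc.2 hat.le)
  have h3 : ρ ≤ ‖x t - x a‖ := by
    by_contra hlt
    have h4 := herr (x a) (x t) i (hR a ha (hdom a hat.le)) (hR t (ha.trans hat.le) ht.2.1)
      (not_le.1 hlt)
    have h5 := hg.delta_lt_threshold (G := G) (p := p) t (x t) i
    linarith
  have h4 : ρ / L ≤ t - a := by
    rw [div_le_iff₀ hL]
    linarith
  linarith

/-! ### Uniform bounds over compact parameter sets -/

variable {X : Type*} [TopologicalSpace X] {w : X → PlantParam N nv r d}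
  {y s : X → LoopState N nv r l d}

theorem continuous_nodeOutput (nom : PlantParam N nv r d) (hw : Continuous w) (hy : Continuous y)
    (k : Fin (N + 1)) : Continuous fun q => nodeOutput (nom + w q) (y q) k := by
  refine Fin.cases ?_ (fun i => ?_) k
  · exact ((continuous_coefF nom).comp hw).dotProduct hy.fst
  · exact (continuous_apply (0 : Fin r)).comp ((continuous_apply i).comp hy.snd.snd.fst)

theorem continuous_virtualOutput_param (G : Digraph (Fin (N + 1))) (nom : PlantParam N nv r d)
    (hw : Continuous w) (hy : Continuous y) (i : Fin N) :
    Continuous fun q => virtualOutput G (nom + w q) (y q) i :=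
  continuous_finsetSum _ fun k _ => continuous_const.mul
    ((continuous_nodeOutput nom hw hy i.succ).sub (continuous_nodeOutput nom hw hy k))

theorem continuous_sampleErrorSq_param (G : Digraph (Fin (N + 1))) (nom : PlantParam N nv r d)
    (hw : Continuous w) (hs : Continuous s) (hy : Continuous y) (i : Fin N) :
    Continuous fun q => sampleErrorSq G (nom + w q) (s q) (y q) i := by
  have h1 := continuous_virtualOutput_param G nom hw hs i
  have h2 := continuous_virtualOutput_param G nom hw hy i
  have h3 : ∀ {y : X → LoopState N nv r l d}, Continuous y →
      Continuous fun q => stEta (y q) i := fun hy =>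
    (continuous_apply i).comp hy.snd.snd.snd.fst
  have h4 : ∀ {y : X → LoopState N nv r l d}, Continuous y →
      Continuous fun q => stZeta (y q) i := fun hy =>
    (continuous_apply i).comp hy.snd.snd.snd.snd
  have h5 : ∀ n : ℕ, Continuous fun x : Fin n → ℝ => sqNorm x := fun n => by
    unfold sqNorm
    fun_prop
  exact (((h5 l).comp ((h3 hs).sub (h3 hy))).add ((h5 r).comp ((h4 hs).sub (h4 hy)))).add
    ((h1.sub h2).pow 2)

/-- The set where `f ≥ δ` over bounded pairs is compact and misses the diagonal, so it has positive
distance from it. This gives a `ρ` uniform in the parameter. -/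
theorem exists_lt_of_continuous_of_diag {X E : Type*} [TopologicalSpace X] [NormedAddCommGroup E]
    [ProperSpace E] {W : Set X} (hW : IsCompact W) {f : X × (E × E) → ℝ} (hf : Continuous f)
    (hf0 : ∀ w s, f (w, s, s) = 0) (R : ℝ) {δ : ℝ} (hδ : 0 < δ) :
    ∃ ρ : ℝ, 0 < ρ ∧ ∀ w ∈ W, ∀ s y : E, ‖s‖ ≤ R → ‖y‖ ≤ R → ‖y - s‖ < ρ → f (w, s, y) < δ := by
  have hK : IsCompact ((W ×ˢ (Metric.closedBall (0 : E) R ×ˢ Metric.closedBall (0 : E) R)) ∩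
      f ⁻¹' Set.Ici δ) :=
    (hW.prod ((isCompact_closedBall _ _).prod (isCompact_closedBall _ _))).inter_right
      (isClosed_Ici.preimage hf)
  have hc : Continuous fun q : X × (E × E) => ‖q.2.2 - q.2.1‖ := by fun_prop
  obtain ⟨ρ, hρ, h⟩ : ∃ ρ : ℝ, 0 < ρ ∧ ∀ q ∈ ((W ×ˢ (Metric.closedBall (0 : E) R ×ˢ
      Metric.closedBall (0 : E) R)) ∩ f ⁻¹' Set.Ici δ), ρ ≤ ‖q.2.2 - q.2.1‖ :=
    hK.exists_forall_le' hc.continuousOn fun ⟨w, s, y⟩ hq => by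
      refine norm_pos_iff.2 fun h => ?_
      have h1 : δ ≤ f (w, s, y) := hq.2
      have h2 : y = s := sub_eq_zero.1 h
      rw [h2, hf0] at h1
      exact absurd h1 (not_le.2 hδ)
  refine ⟨ρ, hρ, fun w hw s y hs hy hsy => ?_⟩
  by_contra hlt
  exact absurd (h (w, s, y) ⟨⟨hw, mem_closedBall_zero_iff.2 hs, mem_closedBall_zero_iff.2 hy⟩,
    not_lt.1 hlt⟩) (not_le.2 hsy)

theorem exists_sampleErrorSq_lt (G : Digraph (Fin (N + 1))) (nom : PlantParam N nv r d)
    {W : Set (PlantParam N nv r d)} (hW : IsCompact W) (R : ℝ) {δ : ℝ} (hδ : 0 < δ) :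
    ∃ ρ : ℝ, 0 < ρ ∧ ∀ w ∈ W, ∀ (s y : LoopState N nv r l d) (i : Fin N), ‖s‖ ≤ R → ‖y‖ ≤ R →
      ‖y - s‖ < ρ → sampleErrorSq G (nom + w) s y i < δ := by
  have h : ∀ i : Fin N, ∀ᶠ ρ : ℝ in 𝓝[>] 0, ∀ w ∈ W, ∀ s y : LoopState N nv r l d, ‖s‖ ≤ R →
      ‖y‖ ≤ R → ‖y - s‖ < ρ → sampleErrorSq G (nom + w) s y i < δ := by
    intro i
    have h1 : Continuous fun q : PlantParam N nv r d ×
        (LoopState N nv r l d × LoopState N nv r l d) => q.1 := continuous_fst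
    have h2 : Continuous fun q : PlantParam N nv r d ×
        (LoopState N nv r l d × LoopState N nv r l d) => q.2.1 := continuous_fst.comp continuous_snd
    have h3 : Continuous fun q : PlantParam N nv r d ×
        (LoopState N nv r l d × LoopState N nv r l d) => q.2.2 := continuous_snd.comp continuous_snd
    have hc := continuous_sampleErrorSq_param G nom h1 h2 h3 i
    obtain ⟨ρ, hρ, h⟩ := exists_lt_of_continuous_of_diag (E := LoopState N nv r l d) hW hc
      (fun w s => sampleErrorSq_self G (nom + w) s i) R hδ
    filter_upwards [Ioo_mem_nhdsGT hρ] with ρ' hρ' w hw s y hs hy hsy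
    exact h w hw s y hs hy (hsy.trans hρ'.2)
  obtain ⟨ρ, h1, h2⟩ := ((eventually_all.2 h).and self_mem_nhdsWithin).exists
  exact ⟨ρ, h2, fun w hw s y i => h1 i w hw s y⟩

theorem continuous_loopField_param (S : Matrix (Fin nv) (Fin nv) ℝ) (G : Digraph (Fin (N + 1)))
    (c : Controller r l) (nom : PlantParam N nv r d) {s : X → Fin N → LoopState N nv r l d}
    (hw : Continuous w) (hy : Continuous y) (hs : Continuous s) :
    Continuous fun q => loopField S G c (nom + w q) (y q) (s q) := by
  have hs' : ∀ i, Continuous fun q => s q i := fun i => (continuous_apply i).comp hs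
  have hv : ∀ i, Continuous fun q => virtualOutput G (nom + w q) (s q i) i := fun i =>
    continuous_virtualOutput_param G nom hw (hs' i) i
  have hu : ∀ i, Continuous fun q => controlInput c (s q i) i := fun i =>
    (continuous_controlInput c i).comp (hs' i)
  have hV : Continuous fun q => stV (y q) := hy.fst
  have hZ : ∀ i, Continuous fun q => stZ (y q) i := fun i => (continuous_apply i).comp hy.snd.fst
  have hX : ∀ i, Continuous fun q => stXi (y q) i := fun i =>
    (continuous_apply i).comp hy.snd.snd.fst
  have hX' : ∀ i j, Continuous fun q => stXi (y q) i j := fun i j =>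
    (continuous_apply j).comp (hX i)
  have hE : ∀ i, Continuous fun q => stEta (y q) i := fun i =>
    (continuous_apply i).comp hy.snd.snd.snd.fst
  have hζ : ∀ i, Continuous fun q => stZeta (y q) i := fun i =>
    (continuous_apply i).comp hy.snd.snd.snd.snd
  refine Continuous.prodMk ?_ (Continuous.prodMk ?_ (Continuous.prodMk ?_
    (Continuous.prodMk ?_ ?_)))
  · exact continuous_const.matrix_mulVec hV
  · refine continuous_pi fun i => ?_
    exact ((((continuous_coefA1 nom i).comp hw).matrix_mulVec (hZ i)).add
      ((hX' i 0).smul ((continuous_coefA2 nom i).comp hw))).add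
      (((continuous_coefE0 nom i).comp hw).matrix_mulVec hV)
  · refine continuous_pi fun i => continuous_pi fun q => ?_
    split_ifs
    · exact hX' i _
    · exact (((((continuous_coefA3 nom i).comp hw).dotProduct (hZ i)).add
        (((continuous_coefC nom i).comp hw).dotProduct (hX i))).add
        (((continuous_coefEr nom i).comp hw).dotProduct hV)).add
        (((continuous_apply i).comp ((continuous_coefB nom).comp hw)).mul (hu i))
  · refine continuous_pi fun i => ?_
    exact (continuous_const.matrix_mulVec (hE i)).add ((hu i).smul continuous_const)
  · refine continuous_pi fun i => ?_
    exact (continuous_const.matrix_mulVec (hζ i)).add ((hv i).smul continuous_const)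

theorem exists_loopField_bound (S : Matrix (Fin nv) (Fin nv) ℝ) (G : Digraph (Fin (N + 1)))
    (c : Controller r l) (nom : PlantParam N nv r d) {W : Set (PlantParam N nv r d)}
    (hW : IsCompact W) (R : ℝ) :
    ∃ L : ℝ, 0 < L ∧ ∀ w ∈ W, ∀ (y : LoopState N nv r l d) (s : Fin N → LoopState N nv r l d),
      ‖y‖ ≤ R → (∀ i, ‖s i‖ ≤ R) → ‖loopField S G c (nom + w) y s‖ ≤ L := by
  have hK : IsCompact (W ×ˢ (Metric.closedBall (0 : LoopState N nv r l d) R ×ˢ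
      Metric.closedBall (0 : Fin N → LoopState N nv r l d) R)) :=
    hW.prod ((isCompact_closedBall _ _).prod (isCompact_closedBall _ _))
  obtain ⟨L, hL⟩ := hK.exists_bound_of_continuousOn
    (continuous_loopField_param S G c nom continuous_fst continuous_snd.fst
      continuous_snd.snd).continuousOn
  refine ⟨max L 1, by positivity, fun w hw y s hy hs => (hL (w, y, s) ⟨hw, ?_, ?_⟩).trans
    (le_max_left _ _)⟩
  · exact mem_closedBall_zero_iff.2 hy
  · exact mem_closedBall_zero_iff.2
      ((pi_norm_le_iff_of_nonneg ((norm_nonneg y).trans hy)).2 hs)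

end Loop

section Loop

variable {N nv r l : ℕ} {d : Fin N → ℕ}
variable {S : Matrix (Fin nv) (Fin nv) ℝ} {G : Digraph (Fin (N + 1))} {c : Controller r l}
  {nom : PlantParam N nv r d} {V : Set (Fin nv → ℝ)} {W : Set (PlantParam N nv r d)}
  {P : PlantParam N nv r d → Matrix (LoopIdx N r l d) (LoopIdx N r l d) ℝ}

/-! ### The constants of the design -/

theorem lambdaMin_le_lambdaMax {n : Type*} [Fintype n] [DecidableEq n] [Nonempty n]
    {P : Matrix n n ℝ} (hP : P.IsHermitian) : lambdaMin P ≤ lambdaMax P := by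
  obtain ⟨μ, hμ⟩ := real_spectrum_nonempty hP
  exact (csInf_le (finite_real_spectrum P).bddBelow hμ).trans
    (le_csSup (finite_real_spectrum P).bddAbove hμ)

/-- Positivity of the extremal values of the Lyapunov matrices, and the estimates they provide. -/
structure LyapunovBounds (W : Set (PlantParam N nv r d))
    (P : PlantParam N nv r d → Matrix (LoopIdx N r l d) (LoopIdx N r l d) ℝ) : Prop where
  lamm_pos : 0 < lamm W P
  lamM_pos : 0 < lamM W P
  lam1_pos : 0 < lam1 W P
  lamm_le : ∀ w ∈ W, lamm W P ≤ lambdaMin (P w)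
  le_lamM : ∀ w ∈ W, lambdaMax (P w) ≤ lamM W P
  le_lam1 : ∀ w ∈ W, opNorm (P w) ^ 2 ≤ lam1 W P

theorem lamBarM_pos (h : 0 < lam3 c) : 0 < lamBarM W nom c := h.trans_le (le_max_left _ _)

theorem LyapunovBounds.lam0_pos [NeZero N] (hL : LyapunovBounds W P) (h : 0 < lam3 c) :
    0 < lam0 W P nom c :=
  mul_pos (mul_pos hL.lam1_pos (lamBarM_pos h)) (Nat.cast_pos.2 (Nat.pos_of_ne_zero (NeZero.ne N)))

theorem LyapunovBounds.designTrigger_isPositive [NeZero N] (hL : LyapunovBounds W P)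
    (h : 0 < lam3 c) {σ β α ε : ℝ} (hσ : 0 < σ) (hσ1 : σ < 1) (hβ : 0 < β) (hε : 0 < ε) :
    (designTrigger W P nom c σ β α ε).IsPositive where
  sigmaBar := div_nonneg hσ.le (mul_nonneg (mul_nonneg hL.lam1_pos.le (lamBarM_pos h).le)
    (zero_le_one.trans (le_max_left _ _)))
  β := hβ
  δ := mul_pos (div_pos (mul_pos (div_pos (sub_pos.2 hσ1) hL.lamM_pos) hL.lamm_pos)
    (hL.lam0_pos h)) (pow_pos hε 2)

variable [NeZero r]

/-- The a priori bounds on `‖P(w)‖` from above and on `λ_min(P(w))` from below make the suprema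
finite and the infimum positive, for any family of solutions `P`. -/
theorem lyapunovBounds [NeZero N] (hW : IsCompact W) (hW0 : W.Nonempty)
    (hH : ∀ w ∈ W, IsHurwitz (matAc G c (nom + w)))
    (hP : ∀ w ∈ W, IsLyapunovSolution (matAc G c (nom + w)) (P w)) : LyapunovBounds W P := by
  have hne : Nonempty (LoopIdx N r l d) := ⟨Sum.inl (Sum.inr ⟨0, 0⟩)⟩
  have hA := (continuous_matAc G c nom).continuousOn (s := W)
  obtain ⟨C, hC0, hC⟩ := exists_lyapunov_bound hW hA hH
  obtain ⟨B, hB0, hB⟩ := exists_opNorm_bound hW hA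
  have hmin : ∀ w ∈ W, B⁻¹ ≤ lambdaMin (P w) := fun w hw => by
    have h1 := (hP w hw).one_le_lambdaMin_mul_opNorm
    have h2 := hB w hw
    have h3 := opNorm_nonneg (matAc G c (nom + w))
    have h4 : 0 < lambdaMin (P w) := by
      by_contra h
      nlinarith
    rw [inv_le_iff_one_le_mul₀ hB0]
    nlinarith
  have hmax : ∀ w ∈ W, lambdaMax (P w) ≤ opNorm (P w) := fun w hw =>
    lambdaMax_le_opNorm (hP w hw).1.isHermitian
  have hmm : ∀ w ∈ W, lambdaMin (P w) ≤ lambdaMax (P w) := fun w hw =>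
    lambdaMin_le_lambdaMax (hP w hw).1.isHermitian
  have hBpos : 0 < B⁻¹ := inv_pos.2 hB0
  have h1 : ∀ w ∈ W, lamm W P ≤ lambdaMin (P w) := fun w hw =>
    csInf_le ⟨B⁻¹, by rintro _ ⟨w, hw, rfl⟩; exact hmin w hw⟩ ⟨w, hw, rfl⟩
  have h2 : ∀ w ∈ W, lambdaMax (P w) ≤ lamM W P := fun w hw =>
    le_csSup ⟨C, by rintro _ ⟨w, hw, rfl⟩; exact (hmax w hw).trans (hC w hw _ (hP w hw))⟩
      ⟨w, hw, rfl⟩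
  have h3 : ∀ w ∈ W, opNorm (P w) ^ 2 ≤ lam1 W P := fun w hw =>
    le_csSup ⟨C ^ 2, by
      rintro _ ⟨w, hw, rfl⟩
      exact pow_le_pow_left₀ (opNorm_nonneg _) (hC w hw _ (hP w hw)) 2⟩ ⟨w, hw, rfl⟩
  obtain ⟨w₀, hw₀⟩ := hW0
  refine ⟨hBpos.trans_le (le_csInf ⟨_, w₀, hw₀, rfl⟩ ?_), ?_, ?_, h1, h2, h3⟩
  · rintro _ ⟨w, hw, rfl⟩
    exact hmin w hw
  · exact hBpos.trans_le ((hmin w₀ hw₀).trans ((hmm w₀ hw₀).trans (h2 w₀ hw₀)))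
  · exact (pow_pos (hBpos.trans_le ((hmin w₀ hw₀).trans ((hmm w₀ hw₀).trans (hmax w₀ hw₀)))) 2
      ).trans_le (h3 w₀ hw₀)

/-- Ultimate boundedness of the deviation from the steady state. -/
theorem LyapunovBounds.sqNorm_deviation_le [NeZero N] (hL : LyapunovBounds W P)
    (hl : l = (minpoly ℝ S).natDegree) (hG : HasSpanningTree G 0)
    (hb : ∀ w ∈ W, ∀ i, coefB (nom + w) i ≠ 0) (hTu : IsUnit c.T)
    (hT : c.T * companionPhi S l - c.M * c.T = Matrix.vecMulVec c.Q (rowGamma l))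
    (hP : ∀ w ∈ W, IsLyapunovSolution (matAc G c (nom + w)) (P w)) (h3 : 0 < lam3 c)
    (hB : ∀ w ∈ W, ∀ i, (coefB (nom + w) i ^ 2 + sqNorm c.Q) *
      (sqNorm (rowGammaTinv c.T) + c.K ^ 2 * sqNorm (rowOmega (r := r) c.γ)) ≤ lam3 c)
    {σ β α ε : ℝ} (hσ : 0 < σ) (hσ1 : σ < 1) (hβ : 0 < β) (hα : α < lamRate W P σ) (hε : 0 < ε)
    {w : PlantParam N nv r d} (hw : w ∈ W) {Z : (i : Fin N) → Fin (d i) → Fin nv → ℝ}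
    (hZ : IsZeroDynamicsSteady S (nom + w) Z) {Tend : EReal} {x₀ : LoopState N nv r l d}
    {x : ℝ → LoopState N nv r l d}
    (hx : IsTrajectory S G c (designTrigger W P nom c σ β α ε) (nom + w) Tend x₀ x) {t : ℝ}
    (ht : 0 ≤ t) (htT : (t : EReal) < Tend) :
    lamm W P * sqNorm (deviation S c.T (nom + w) Z (x t)) ≤
      Real.exp (-lamRate W P σ * t) * (lamM W P * sqNorm (deviation S c.T (nom + w) Z x₀)) +
      lam0 W P nom c * β / (lamRate W P σ - α) * Real.exp (-α * t) + lamm W P * ε ^ 2 := by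
  have hM := lamBarM_pos (W := W) (nom := nom) h3
  have h2 : 0 < lamBar2 N := zero_lt_one.trans_le (le_max_left _ _)
  have h0 := hL.lam0_pos (nom := nom) h3
  have h1 := hL.lam1_pos
  have hr : 0 < lamRate W P σ := div_pos (sub_pos.2 hσ1) hL.lamM_pos
  have hle : lam3 c ≤ lamBarM W nom c := le_max_left _ _
  have hσeq : lam1 W P * lamBarM W nom c * (designTrigger W P nom c σ β α ε).sigmaBar *
      lamBar2 N = σ := by
    simp only [designTrigger]
    field_simp
  have key := hx.lyapunov_le (hL.designTrigger_isPositive h3 hσ hσ1 hβ hε) hl hG (hb w hw) hTu hT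
    hZ (hP w hw) (hL.le_lam1 w hw) (fun i => (hB w hw i).trans hle) hle hσeq hσ1
    (hL.le_lamM w hw) hL.lamM_pos hα ht htT
  -- The choice of `δ` cancels `λ₀` and the decay rate, so that the residual level of `V` is exactly
  -- `λ_m ε²`.
  have hδ : lam1 W P * lamBarM W nom c * N * (designTrigger W P nom c σ β α ε).δ /
      ((1 - σ) / lamM W P) = lamm W P * ε ^ 2 := by
    change lam0 W P nom c * (lamRate W P σ * lamm W P / lam0 W P nom c * ε ^ 2) /
      lamRate W P σ = _
    field_simp
  rw [hδ] at key
  have hH := (hP w hw).1.isHermitian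
  have h4 := (mul_le_mul_of_nonneg_right (hL.lamm_le w hw) (sqNorm_nonneg
    (deviation S c.T (nom + w) Z (x t)))).trans (lambdaMin_le_dotProduct_mulVec hH _)
  have h5 := (dotProduct_mulVec_le_lambdaMax hH (deviation S c.T (nom + w) Z x₀)).trans
    (mul_le_mul_of_nonneg_right (hL.le_lamM w hw) (sqNorm_nonneg _))
  refine h4.trans (key.trans ?_)
  refine add_le_add_left (add_le_add_left ?_ _) _
  exact mul_le_mul_of_nonneg_left h5 (Real.exp_pos _).le

/-! ### Practical output regulation -/

/-- After division by `m`, the square root of the right side tends to `ε` and dominates `f`. -/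
theorem limsup_le_of_mul_sq_le {f : ℝ → ℝ} {m a₁ a₂ b₁ b₂ ε : ℝ} (hm : 0 < m)
    (hb₁ : 0 < b₁) (hb₂ : 0 < b₂) (hε : 0 < ε)
    (h : ∀ t, 0 ≤ t → m * f t ^ 2 ≤
      Real.exp (-b₁ * t) * a₁ + a₂ * Real.exp (-b₂ * t) + m * ε ^ 2) :
    limsup (fun t => (f t : EReal)) atTop ≤ (ε : EReal) := by
  have hexp : ∀ b : ℝ, 0 < b → Tendsto (fun t => Real.exp (-b * t)) atTop (𝓝 0) := fun b hb =>
    Real.tendsto_exp_atBot.comp (tendsto_id.const_mul_atTop_of_neg (neg_neg_of_pos hb))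
  have h1 : Tendsto (fun t => Real.sqrt ((Real.exp (-b₁ * t) * a₁ + a₂ * Real.exp (-b₂ * t) +
      m * ε ^ 2) / m)) atTop (𝓝 ε) := by
    have h2 := ((((hexp b₁ hb₁).mul_const a₁).add ((hexp b₂ hb₂).const_mul a₂)).add_const
      (m * ε ^ 2)).div_const m
    have h3 : Real.sqrt ((0 * a₁ + a₂ * 0 + m * ε ^ 2) / m) = ε := by
      rw [zero_mul, mul_zero, add_zero, zero_add, mul_div_cancel_left₀ _ hm.ne',
        Real.sqrt_sq hε.le]
    have h4 := (Real.continuous_sqrt.tendsto _).comp h2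
    rw [h3] at h4
    exact h4
  have h5 : Tendsto (fun t => ((Real.sqrt ((Real.exp (-b₁ * t) * a₁ + a₂ * Real.exp (-b₂ * t) +
      m * ε ^ 2) / m) : ℝ) : EReal)) atTop (𝓝 (ε : EReal)) :=
    (continuous_coe_real_ereal.tendsto ε).comp h1
  refine (limsup_le_limsup ?_).trans h5.limsup_eq.le
  filter_upwards [eventually_ge_atTop 0] with t ht
  rw [EReal.coe_le_coe_iff]
  refine Real.le_sqrt_of_sq_le ?_
  rw [le_div_iff₀ hm, mul_comm]
  exact h t ht

/-- The order matters: bounds on arbitrary intervals of existence give a lower bound on inter-event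
times there, which gives global existence. Uniqueness then makes every partial trajectory a
restriction of the global one. -/
theorem LyapunovBounds.solvesPracticalRegulation [NeZero N] (hL : LyapunovBounds W P)
    (hl : l = (minpoly ℝ S).natDegree) (hV : IsCompact V) (hW : IsCompact W)
    (hS : IsNeutrallyStable S) (hmin : ∀ w ∈ W, ∀ i, IsHurwitz (coefA1 (nom + w) i))
    (hG : HasSpanningTree G 0) (hb : ∀ w ∈ W, ∀ i, coefB (nom + w) i ≠ 0) (hTu : IsUnit c.T)
    (hT : c.T * companionPhi S l - c.M * c.T = Matrix.vecMulVec c.Q (rowGamma l))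
    (hP : ∀ w ∈ W, IsLyapunovSolution (matAc G c (nom + w)) (P w)) (h3 : 0 < lam3 c)
    (hB : ∀ w ∈ W, ∀ i, (coefB (nom + w) i ^ 2 + sqNorm c.Q) *
      (sqNorm (rowGammaTinv c.T) + c.K ^ 2 * sqNorm (rowOmega (r := r) c.γ)) ≤ lam3 c)
    {σ β α ε : ℝ} (hσ : 0 < σ) (hσ1 : σ < 1) (hβ : 0 < β) (hα0 : 0 < α)
    (hα : α < lamRate W P σ) (hε : 0 < ε) :
    SolvesPracticalRegulation S G nom V W c (designTrigger W P nom c σ β α ε) ε := by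
  have hg := hL.designTrigger_isPositive (nom := nom) (α := α) h3 hσ hσ1 hβ hε
  have hr : 0 < lamRate W P σ := div_pos (sub_pos.2 hσ1) hL.lamM_pos
  have hZ : ∀ w ∈ W, ∃ Z, IsZeroDynamicsSteady S (nom + w) Z := fun w hw => by
    choose Z hZ using fun i => (hmin w hw i).exists_sylvester hS
      (Matrix.vecMulVec (coefA2 (nom + w) i) (coefF (nom + w)) + coefE0 (nom + w) i)
    exact ⟨fun i => Matrix.of.symm (Z i), hZ⟩
  have hest := fun {w} hw {Z} hZ {Tend x₀ x} hx {t} ht htT =>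
    hL.sqNorm_deviation_le (w := w) (Z := Z) (Tend := Tend) (x₀ := x₀) (x := x) (t := t)
      hl hG hb hTu hT hP h3 hB hσ hσ1 hβ hα hε hw hZ hx ht htT
  have hbound : ∀ X : Set (CState N r l d), IsCompact X → ∃ R : ℝ, ∀ v₀ ∈ V, ∀ w ∈ W, ∀ c₀ ∈ X,
      ∀ (Tend : EReal) x, IsTrajectory S G c (designTrigger W P nom c σ β α ε) (nom + w) Tend
        (v₀, c₀) x → ∀ t : ℝ, 0 ≤ t → (t : EReal) < Tend → ‖x t‖ ≤ R := by
    intro X hX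
    obtain ⟨Cv, hCv0, hCv⟩ := hS.exists_bound
    obtain ⟨Rv, hRv⟩ := hV.exists_bound_of_continuousOn continuousOn_id
    obtain ⟨RX, hRX⟩ := hX.exists_bound_of_continuousOn continuousOn_id
    -- The radius must cover both the initial `v` and the later values of `v`, which are bounded by
    -- `Cv * Rv`.
    obtain ⟨B, hBd⟩ := exists_steadyState_bound (l := l) hS c.T nom hW hb hmin (max Rv (Cv * Rv))
    set D : ℝ := Fintype.card (LoopIdx N r l d) *
      (‖(flatCLM : CState N r l d →L[ℝ] (LoopIdx N r l d → ℝ))‖ * (RX + B)) ^ 2 with hD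
    set Q : ℝ := (lamM W P * D + lam0 W P nom c * β / (lamRate W P σ - α) + lamm W P * ε ^ 2) /
      lamm W P with hQ
    refine ⟨max (Cv * Rv) (Real.sqrt Q + B), fun v₀ hv₀ w hw c₀ hc₀ Tend x hx t ht htT => ?_⟩
    obtain ⟨Z, hZ⟩ := hZ w hw
    have hv : ‖(x t).1‖ ≤ Cv * Rv := (hx.norm_exosystem_le hg hCv ht htT).trans
      (mul_le_mul_of_nonneg_left (hRv v₀ hv₀) hCv0)
    have h0 : sqNorm (deviation S c.T (nom + w) Z (v₀, c₀)) ≤ D := by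
      refine (sqNorm_le_card_mul_norm_sq _).trans
        (mul_le_mul_of_nonneg_left (pow_le_pow_left₀ (norm_nonneg _) ?_ 2) (Nat.cast_nonneg _))
      refine (flatCLM.le_opNorm _).trans (mul_le_mul_of_nonneg_left ?_ (norm_nonneg _))
      exact (norm_sub_le _ _).trans (add_le_add (hRX c₀ hc₀)
        (hBd w hw Z hZ v₀ ((hRv v₀ hv₀).trans (le_max_left _ _))))
    have h1 := hest hw hZ hx ht htT
    have h2 : sqNorm (deviation S c.T (nom + w) Z (x t)) ≤ Q := by
      rw [hQ, le_div_iff₀ hL.lamm_pos, mul_comm]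
      refine h1.trans (add_le_add_left (add_le_add ?_ ?_) _)
      · refine (mul_le_of_le_one_left
          (mul_nonneg hL.lamM_pos.le (sqNorm_nonneg _)) ?_).trans
          (mul_le_mul_of_nonneg_left h0 hL.lamM_pos.le)
        exact Real.exp_le_one_iff.2 (by nlinarith)
      · refine mul_le_of_le_one_right ?_ (Real.exp_le_one_iff.2 (by nlinarith))
        exact div_nonneg (mul_nonneg (hL.lam0_pos h3).le hβ.le) (sub_pos.2 hα).le
    have h4 : ‖(x t).2‖ ≤ Real.sqrt Q + B := by
      have h5 : ‖(x t).2 - steadyState S c.T (nom + w) Z (x t).1‖ ≤ Real.sqrt Q :=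
        (norm_le_norm_flat _).trans
          (Real.le_sqrt_of_sq_le ((norm_sq_le_sqNorm _).trans h2))
      have h6 := hBd w hw Z hZ (x t).1 (hv.trans (le_max_right _ _))
      have h7 := norm_le_norm_sub_add (x t).2 (steadyState S c.T (nom + w) Z (x t).1)
      linarith
    exact norm_prod_le_iff.2 ⟨hv.trans (le_max_left _ _), h4.trans (le_max_right _ _)⟩
  have hgap : ∀ X : Set (CState N r l d), IsCompact X → ∃ τ : ℝ, 0 < τ ∧ ∀ v₀ ∈ V, ∀ w ∈ W,
      ∀ c₀ ∈ X, ∀ (Tend : EReal) x, IsTrajectory S G c (designTrigger W P nom c σ β α ε) (nom + w)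
        Tend (v₀, c₀) x → ∀ i k,
          eventTime G (nom + w) (designTrigger W P nom c σ β α ε) Tend x i k + (τ : EReal) ≤
            eventTime G (nom + w) (designTrigger W P nom c σ β α ε) Tend x i (k + 1) := by
    intro X hX
    obtain ⟨R, hR⟩ := hbound X hX
    obtain ⟨L, hL0, hLf⟩ := exists_loopField_bound S G c nom hW R
    obtain ⟨ρ, hρ, herr⟩ := exists_sampleErrorSq_lt (l := l) G nom hW R hg.δ
    exact ⟨ρ / L, div_pos hρ hL0, fun v₀ hv₀ w hw c₀ hc₀ Tend x hx i k =>
      hx.eventTime_add_le hg hL0 (hR v₀ hv₀ w hw c₀ hc₀ Tend x hx) (hLf w hw) (herr w hw) i k⟩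
  have hexist : ∀ v₀ ∈ V, ∀ w ∈ W, ∀ c₀ : CState N r l d, ∃ x,
      IsTrajectory S G c (designTrigger W P nom c σ β α ε) (nom + w) ⊤ (v₀, c₀) x := by
    intro v₀ hv₀ w hw c₀
    -- For one initial state the compact set is a point; uniformity over larger sets matters only
    -- for the last claim.
    obtain ⟨τ, hτ, h⟩ := hgap {c₀} isCompact_singleton
    exact exists_isTrajectory_top hg hτ fun T _ x hx => h v₀ hv₀ w hw c₀ rfl T x hx
  refine ⟨hexist, ?_, ?_, ?_, ?_⟩
  · intro v₀ hv₀ w hw c₀ Tend _ x hx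
    obtain ⟨y, hy⟩ := hexist v₀ hv₀ w hw c₀
    exact ⟨y, hy, fun t ht htT =>
      hy.eqOn hg hx (EReal.coe_lt_top t) htT (Set.right_mem_Icc.2 ht)⟩
  · intro v₀ hv₀ w hw c₀ x hx
    obtain ⟨R, hR⟩ := hbound {c₀} isCompact_singleton
    exact ⟨R, fun t ht => hR v₀ hv₀ w hw c₀ rfl ⊤ x hx t ht (EReal.coe_lt_top t)⟩
  · intro v₀ _ w hw c₀ x hx
    obtain ⟨Z, hZ⟩ := hZ w hw
    refine limsup_le_of_mul_sq_le hL.lamm_pos hr hα0 hε fun t ht =>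
      (mul_le_mul_of_nonneg_left (norm_regError_sq_le (S := S) (Z := Z) c.T (x t))
        hL.lamm_pos.le).trans (hest hw hZ hx ht (EReal.coe_lt_top t))
  · intro X hX
    obtain ⟨τ, hτ, h⟩ := hgap X hX
    exact ⟨τ, hτ, fun v₀ hv₀ w hw c₀ hc₀ x hx => h v₀ hv₀ w hw c₀ hc₀ ⊤ x hx⟩

/-! ### The size of the observer gain -/

theorem IsStableMonic.coeff_zero_ne_zero {δc : Fin r → ℝ} (h : IsStableMonic δc) : δc 0 ≠ 0 := by
  intro h0
  have h1 := h 0 ?_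
  · simp at h1
  · rw [zero_pow (NeZero.ne r), zero_add]
    refine Finset.sum_eq_zero fun j _ => ?_
    rcases eq_or_ne j 0 with rfl | hj
    · simp [h0]
    · rw [zero_pow, mul_zero]
      exact fun h => hj (Fin.ext h)

/-- The last entry `h ^ r δ₀` alone makes `‖B_o(h)‖` grow without bound, since stability forces `δ₀
≠ 0`. -/
theorem mul_le_sqNorm_vecBo (δc : Fin r → ℝ) {h : ℝ} (hh : 1 ≤ h) :
    h * δc 0 ^ 2 ≤ sqNorm (vecBo δc h) := by
  have hr : 0 < r := Nat.pos_of_ne_zero (NeZero.ne r)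
  have h1 : vecBo δc h (⟨r - 1, by omega⟩ : Fin r) = h ^ r * δc 0 := by
    have h2 : (⟨r - 1, by omega⟩ : Fin r).rev = 0 := by
      ext
      simp only [Fin.val_rev, Fin.val_zero]
      omega
    have h3 : r - 1 + 1 = r := by omega
    simp only [vecBo, h2, h3]
  have h4 := Finset.single_le_sum (f := fun s => vecBo δc h s ^ 2) (fun _ _ => sq_nonneg _)
    (Finset.mem_univ (⟨r - 1, by omega⟩ : Fin r))
  refine le_trans ?_ h4
  simp only [h1, mul_pow]
  refine mul_le_mul_of_nonneg_right ?_ (sq_nonneg _)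
  rw [← pow_mul]
  exact le_self_pow₀ hh (by omega)

/-- A threshold on `h` above which `‖B_o(h)‖²` is at least `m` and positive. -/
def gainBo (δc : Fin r → ℝ) (m : ℝ) : ℝ := max 1 (m / δc 0 ^ 2)

theorem IsStableMonic.le_sqNorm_vecBo {δc : Fin r → ℝ} (hδ : IsStableMonic δc) {m h : ℝ}
    (hh : gainBo δc m < h) : m ≤ sqNorm (vecBo δc h) ∧ 0 < sqNorm (vecBo δc h) := by
  have h1 : 1 < h := (le_max_left _ _).trans_lt hh
  have h2 : m / δc 0 ^ 2 < h := (le_max_right _ _).trans_lt hh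
  have h3 : 0 < δc 0 ^ 2 := by
    have := hδ.coeff_zero_ne_zero
    positivity
  have h4 := mul_le_sqNorm_vecBo δc h1.le
  rw [div_lt_iff₀ h3] at h2
  exact ⟨h2.le.trans h4, (by positivity : 0 < h * δc 0 ^ 2).trans_le h4⟩

end Loop

end EventTriggered

end

/-! ### The main theorem -/

theorem theorem1 {N nv r l : ℕ} [NeZero N] [NeZero r] (d : Fin N → ℕ)
    -- the exosystem, the nominal plants, the digraph, the compact sets
    (S : Matrix (Fin nv) (Fin nv) ℝ) (hl : l = (minpoly ℝ S).natDegree)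
    (nom : EventTriggered.PlantParam N nv r d) (G : Digraph (Fin (N + 1)))
    (V : Set (Fin nv → ℝ)) (hV : IsCompact V) (hV0 : 0 ∈ V)
    (W : Set (EventTriggered.PlantParam N nv r d)) (hW : IsCompact W) (hW0 : 0 ∈ W)
    (hb : ∀ w ∈ W, ∀ i, 0 < EventTriggered.coefB (nom + w) i)
    -- the three assumptions
    (hS : EventTriggered.IsNeutrallyStable S)
    (hmin : ∀ w ∈ W, ∀ i, EventTriggered.IsHurwitz (EventTriggered.coefA1 (nom + w) i))
    (hG : EventTriggered.HasSpanningTree G 0)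
    -- the internal model and the solution of the Sylvester equation
    (M : Matrix (Fin l) (Fin l) ℝ) (Q : Fin l → ℝ) (hM : EventTriggered.IsHurwitz M)
    (hMQ : EventTriggered.IsControllable M Q)
    (T : Matrix (Fin l) (Fin l) ℝ)
    (hT : T * EventTriggered.companionPhi S l - M * T =
      Matrix.vecMulVec Q (EventTriggered.rowGamma l))
    -- the stable polynomials of the compensator
    (γ : Fin (r - 1) → ℝ) (hγ : EventTriggered.IsStableMonic γ)
    (δc : Fin r → ℝ) (hδc : EventTriggered.IsStableMonic δc) :
    ∃ Kstar : ℝ, 0 < Kstar ∧ ∃ hstar : ℝ → ℝ, (∀ K, Kstar < K → 0 < hstar K) ∧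
      ∀ K, Kstar < K → ∀ h, hstar K < h →
        -- the Lyapunov matrices `P(w)` are well defined
        (∀ w ∈ W, ∃! P, EventTriggered.IsLyapunovSolution
          (EventTriggered.matAc G ⟨M, Q, T, γ, δc, K, h⟩ (nom + w)) P) ∧
        ∀ P : EventTriggered.PlantParam N nv r d → Matrix (EventTriggered.LoopIdx N r l d)
            (EventTriggered.LoopIdx N r l d) ℝ,
          (∀ w ∈ W, EventTriggered.IsLyapunovSolution
            (EventTriggered.matAc G ⟨M, Q, T, γ, δc, K, h⟩ (nom + w)) (P w)) →
          ∀ σ : ℝ, 0 < σ → σ < 1 → ∀ β : ℝ, 0 < β →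
          ∀ α : ℝ, 0 < α → α < EventTriggered.lamRate W P σ → ∀ ε : ℝ, 0 < ε →
            EventTriggered.SolvesPracticalRegulation S G nom V W ⟨M, Q, T, γ, δc, K, h⟩
              (EventTriggered.designTrigger W P nom ⟨M, Q, T, γ, δc, K, h⟩ σ β α ε) ε := by
  have hTu : IsUnit T := EventTriggered.isUnit_of_sylvester_companion hMQ hT
  obtain ⟨c₀, hc₀⟩ := EventTriggered.exists_loopBounds nom hW hb hmin hG Q hM T hγ hδc
  have hc1 : 1 ≤ c₀ := (hc₀ 0 hW0 0 0).one_le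
  obtain ⟨B, hB⟩ := hW.exists_bound_of_continuousOn
    (EventTriggered.continuous_coefB nom).continuousOn
  -- The joint constant of the input errors, uniform in `w` through `|b_i(w)| ≤ B`. It depends on
  -- `K` but not on `h`, so `h` can afterwards be taken large enough that `‖B_o(h)‖²` exceeds it.
  let m : ℝ → ℝ := fun K => (B ^ 2 + EventTriggered.sqNorm Q) *
    (EventTriggered.sqNorm (EventTriggered.rowGammaTinv T) +
      K ^ 2 * EventTriggered.sqNorm (EventTriggered.rowOmega (r := r) γ))
  -- `hstar` combines two demands: an observer fast enough for `A_c` to be Hurwitz, and `λ₃` large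
  -- enough to dominate `m K`. The second threshold is at least `1`, which makes `hstar` positive.
  refine ⟨EventTriggered.gainK c₀, by unfold EventTriggered.gainK; positivity,
    fun K => max (EventTriggered.gainH c₀ K) (EventTriggered.gainBo δc (m K)),
    fun K _ => lt_max_of_lt_right (zero_lt_one.trans_le (le_max_left _ _)), ?_⟩
  intro K hK h hh
  obtain ⟨hm, h3⟩ := hδc.le_sqNorm_vecBo ((le_max_right _ _).trans_lt hh)
  have hH : ∀ w ∈ W, EventTriggered.IsHurwitz
      (EventTriggered.matAc G ⟨M, Q, T, γ, δc, K, h⟩ (nom + w)) := fun w hw =>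
    (hc₀ w hw K h).isHurwitz_matAc hK ((le_max_left _ _).trans_lt hh)
  refine ⟨fun w hw => (hH w hw).existsUnique_lyapunov, ?_⟩
  intro P hP σ hσ hσ1 β hβ α hα0 hα ε hε
  have hL := EventTriggered.lyapunovBounds hW ⟨0, hW0⟩ hH hP
  refine hL.solvesPracticalRegulation hl hV hW hS hmin hG (fun w hw i => (hb w hw i).ne') hTu hT hP
    h3 (fun w hw i => le_trans ?_ hm) hσ hσ1 hβ hα0 hα hε
  refine mul_le_mul_of_nonneg_right (add_le_add_left ?_ _) (add_nonneg
    (EventTriggered.sqNorm_nonneg _)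
    (mul_nonneg (sq_nonneg _) (EventTriggered.sqNorm_nonneg _)))
  rw [← sq_abs]
  exact pow_le_pow_left₀ (abs_nonneg _) ((norm_le_pi_norm _ i).trans (hB w hw)) 2
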